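/- **Setting.** Let $b,\sigma:[0,\infty)\to\mathbb R$ be locally Lipschitz with $\sigma>0$ on $(0,\infty)$. Put $p'(x)=\exp\big(-2\int_1^x b(s)\sigma(s)^{-2}\,ds\big)$ and $m(dx)=\frac{2}{\sigma^2(x)p'(x)}dx$, and assume that $0$ is inaccessible, $\int_0^1 m((x,1))\,p'(x)\,dx=\infty$, and that $\infty$ is natural, $\int_1^\infty m((1,x))\,p'(x)\,dx=\int_1^\infty m((x,\infty))\,p'(x)\,dx=\infty$. Let $X$ be the $(0,\infty)$-valued diffusion $dX_t=b(X_t)\,dt+\sigma(X_t)\,dW_t$, with $\mathbb E_x$ the expectation for $X_0=x>0$. Let $r:[0,\infty)\to\mathbb R$ be continuous and bounded with $r\ge r_0$ for some constant $r_0>0$; write $\Lambda_t=\int_0^t r(X_u)\,du$ and $$\mathscr L w=\tfrac12\sigma^2 w''+b w'-r w .$$ Let $\varphi,\psi>0$ be $C^2$ solutions of $\mathscr Lw=0$ on $(0,\infty)$ with $\varphi'<0<\psi'$ and $\lim_{x\downarrow0}\varphi(x)=\lim_{x\uparrow\infty}\psi(x)=\infty$. For a Borel function $F$ with $\mathbb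 E_x\int_0^\infty e^{-\Lambda_t}|F(X_t)|\,dt<\infty$ for all $x>0$, set $R_F(x)=\mathbb E_x\int_0^\infty e^{-\Lambda_t}F(X_t)\,dt$. Let $h,k:(0,\infty)\to\mathbb R$ satisfy the following. (i) $h$ is continuous and bounded below, $\lim_{x\downarrow0}h(x)/r(x)$ exists in $\mathbb R$, and $\mathbb E_x\int_0^\infty e^{-\Lambda_t}|h(X_t)|\,dt<\infty$ for all $x>0$. (ii) $k$ is absolutely continuous on compact subintervals of $(0,\infty)$, $\int_0^1|k(s)|\,ds<\infty$, the function $x\mapsto\int_0^xk(s)\,ds$ is bounded below, $\mathbb E_x\int_0^\infty e^{-\Lambda_t}\big|\mathscr L\big(\int_0^{\cdot}k\big)(X_t)\big|\,dt<\infty$ for all $x>0$, and $\limsup_{x\uparrow\infty}\psi(x)^{-1}\int_0^xk(s)\,ds\in[0,\infty)$. (iii) $\Theta:=h+\mathscr L\big(\int_0^{\cdot}k\big)$ is continuous on $(0,\infty)$ and, for some $\xi\in(0,\infty)$, $\Theta/r$ is strictly increasing on $(0,\xi)$ and strictly decreasing on $(\xi,\infty)$. **Critical points.** Write $\rho=R_\Theta'/\psi'$,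 $G_\Theta=R_\Theta-\rho\,\psi$ and $F(\gamma,\beta)=G_\Theta(\beta)-G_\Theta(\gamma)$. Let $\underline x\in(\xi,\infty]$ be the unique point such that $\rho'<0$ on $(0,\underline x)$ and $\rho'>0$ on $(\underline x,\infty)$. Suppose that $\underline x<\infty$ and let $\overline x=\inf\{s>0:\rho(s)>\lim_{x\downarrow0}\rho(x)\}$ (with $\inf\emptyset=\infty$). For $\beta\in(\underline x,\overline x)$ let $\Gamma(\beta)$ be the unique point $\gamma\in(0,\underline x)$ such that $$\rho-\rho(\beta)>0\ \text{ on }(0,\gamma),\qquad \rho(\gamma)=\rho(\beta),\qquad \rho-\rho(\beta)<0\ \text{ on }(\gamma,\beta), \tag{$*$}$$ and let $c^\star=-\lim_{\beta\uparrow\overline x}F(\Gamma(\beta),\beta)\in(0,\infty]$. **Claim.** Fix $c\in(0,c^\star)$. The limit $K_\infty=\lim_{x\uparrow\infty}\psi(x)^{-1}\int_0^xk(s)\,ds$ exists in $[0,\infty)$. There are points $\gamma^\star\in(0,\underline x)$ and $\beta^\star\in(\underline x,\overline x)$ satisfying $(*)$ with $(\gamma,\beta)=(\gamma^\star,\beta^\star)$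 and $F(\gamma^\star,\beta^\star)=-c$, and they form the only pair $0<\gamma<\beta<\infty$ with $\rho(\gamma)=\rho(\beta)$ and $F(\gamma,\beta)=-c$. The function $$w(x)=\begin{cases}R_h(x)+\Big(K_\infty-\dfrac{R_\Theta'(\beta^\star)}{\psi'(\beta^\star)}\Big)\psi(x),&0<x<\beta^\star,\\[2mm] w(\gamma^\star)+\displaystyle\int_{\gamma^\star}^xk(s)\,ds-c,&x\ge\beta^\star,\end{cases}$$ is $C^1$ on $(0,\infty)$, is $C^2$ on $(0,\infty)\setminus\{\beta^\star\}$, and is bounded from below. Moreover $w'$ is absolutely continuous on compact subintervals of $(0,\infty)$ and $w$ satisfies the HJB equation $$\max\Big\{\mathscr Lw(x)+h(x),\ -c+\sup_{z\in[0,x)}\int_{x-z}^x\big(k(s)-w'(s)\big)\,ds\Big\}=0\quad\text{for Lebesgue-a.e. }x\in(0,\infty).$$ -/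

import Mathlib

open MeasureTheory ProbabilityTheory Filter Set
open scoped Topology NNReal ENNReal

namespace Harvest

/-! ### Uncontrolled diffusion -/

/-- `Y` is a continuous `]0, ∞[`-valued solution, started from `x`, of the SDE
`dY = b(Y) dt + σ(Y) dW`, in the sense of the martingale problem for the second-order operator
`f ↦ (1/2) σ² f'' + b f'` with `C²` test functions compactly supported in `]0, ∞[`. -/
structure IsDiffusionFrom {Ω : Type*} [mΩ : MeasurableSpace Ω] (b σ : ℝ → ℝ) (P : Measure Ω)
    (ℱ : Filtration ℝ≥0 mΩ) (Y : ℝ≥0 → Ω → ℝ) (x : ℝ) : Prop where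
  adapted : ∀ t, Measurable[ℱ t] (Y t)
  continuous_paths : ∀ ω, Continuous fun t => Y t ω
  pos : ∀ t ω, 0 < Y t ω
  start : ∀ᵐ ω ∂P, Y 0 ω = x
  martingale : ∀ f : ℝ → ℝ, ContDiff ℝ 2 f → HasCompactSupport f → tsupport f ⊆ Ioi 0 →
    Martingale (fun (t : ℝ≥0) ω => f (Y t ω) - ∫ s in (0 : ℝ)..t,
      (1 / 2 * σ (Y s.toNNReal ω) ^ 2 * deriv (deriv f) (Y s.toNNReal ω)
        + b (Y s.toNNReal ω) * deriv f (Y s.toNNReal ω))) ℱ P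

/-- Locally Lipschitz coefficients on `[0, ∞[` with `σ > 0` on `]0, ∞[`. -/
structure CoefficientAssumption (b σ : ℝ → ℝ) : Prop where
  b_lip : LocallyLipschitzOn (Ici 0) b
  σ_lip : LocallyLipschitzOn (Ici 0) σ
  σ_pos : ∀ x, 0 < x → 0 < σ x

/-- Derivative `p'` of the scale function. -/
noncomputable def scaleDeriv (b σ : ℝ → ℝ) (x : ℝ) : ℝ :=
  Real.exp (-2 * ∫ s in (1 : ℝ)..x, b s / σ s ^ 2)

/-- Speed measure `m(dx) = 2 / (σ²(x) p'(x)) dx`. -/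
noncomputable def speedMeasure (b σ : ℝ → ℝ) : Measure ℝ :=
  (volume.restrict (Ioi 0)).withDensity fun x => ENNReal.ofReal (2 / (σ x ^ 2 * scaleDeriv b σ x))

/-- The boundary point `0` is inaccessible (Feller's test):
`∫_0^1 m(]x,1[) p'(x) dx = ∞`. -/
def ZeroInaccessible (b σ : ℝ → ℝ) : Prop :=
  ∫⁻ x in Ioo (0 : ℝ) 1, speedMeasure b σ (Ioo x 1) * ENNReal.ofReal (scaleDeriv b σ x) = ⊤

/-- The boundary point `∞` is natural, i.e. neither exit nor entrance (Feller's tests):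
`∫_1^∞ m(]1,x[) p'(x) dx = ∞` and `∫_1^∞ m(]x,∞[) p'(x) dx = ∞`. -/
def InftyNatural (b σ : ℝ → ℝ) : Prop :=
  ∫⁻ x in Ioi (1 : ℝ), speedMeasure b σ (Ioo 1 x) * ENNReal.ofReal (scaleDeriv b σ x) = ⊤ ∧
  ∫⁻ x in Ioi (1 : ℝ), speedMeasure b σ (Ioi x) * ENNReal.ofReal (scaleDeriv b σ x) = ⊤

/-- The discounting rate is continuous, bounded, and bounded away from `0`, on `[0, ∞[`. -/
structure DiscountAssumption (r : ℝ → ℝ) : Prop where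
  cont : ContinuousOn r (Ici 0)
  bdd : ∃ M, ∀ x, 0 ≤ x → r x ≤ M
  lower : ∃ r₀, 0 < r₀ ∧ ∀ x, 0 ≤ x → r₀ ≤ r x

/-! ### The operator `𝓛`, discounted expectations and fundamental solutions -/

/-- `𝓛 w = (1/2) σ² w'' + b w' - r w`. -/
noncomputable def opL (b σ r : ℝ → ℝ) (w : ℝ → ℝ) (x : ℝ) : ℝ :=
  1 / 2 * σ x ^ 2 * deriv (deriv w) x + b x * deriv w x - r x * w x

/-- `Λ_t = ∫_0^t r(Y_u) du` along a path `y`. -/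
noncomputable def discount (r : ℝ → ℝ) (y : ℝ≥0 → ℝ) (t : ℝ) : ℝ :=
  ∫ u in (0 : ℝ)..t, r (y u.toNNReal)

/-- `E_x [∫_0^∞ e^{-Λ_t} |F(X_t)| dt] < ∞` for all `x > 0`; here `X x` is the diffusion started
from `x`. -/
def DiscountedIntegrable {Ω : Type*} [MeasurableSpace Ω] (P : Measure Ω)
    (X : ℝ → ℝ≥0 → Ω → ℝ) (r F : ℝ → ℝ) : Prop :=
  ∀ x, 0 < x → ∫⁻ ω, (∫⁻ t in Ioi (0 : ℝ), ENNReal.ofReal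
    (Real.exp (-discount r (fun s => X x s ω) t) * |F (X x t.toNNReal ω)|)) ∂P < ⊤

/-- `R_F(x) = E_x [∫_0^∞ e^{-Λ_t} F(X_t) dt]`. -/
noncomputable def R {Ω : Type*} [MeasurableSpace Ω] (P : Measure Ω)
    (X : ℝ → ℝ≥0 → Ω → ℝ) (r F : ℝ → ℝ) (x : ℝ) : ℝ :=
  ∫ ω, (∫ t in Ioi (0 : ℝ),
    Real.exp (-discount r (fun s => X x s ω) t) * F (X x t.toNNReal ω)) ∂P

/-- `φ`, `ψ` are the (decreasing, resp. increasing) fundamental `C²` solutions of `𝓛 w = 0`;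
each is determined by these properties up to a positive factor. -/
structure FundamentalSolutions (b σ r φ ψ : ℝ → ℝ) : Prop where
  φ_smooth : ContDiffOn ℝ 2 φ (Ioi 0)
  ψ_smooth : ContDiffOn ℝ 2 ψ (Ioi 0)
  φ_ode : ∀ x, 0 < x → opL b σ r φ x = 0
  ψ_ode : ∀ x, 0 < x → opL b σ r ψ x = 0
  φ_pos : ∀ x, 0 < x → 0 < φ x
  ψ_pos : ∀ x, 0 < x → 0 < ψ x
  φ_decr : ∀ x, 0 < x → deriv φ x < 0
  ψ_incr : ∀ x, 0 < x → 0 < deriv ψ x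
  φ_lim : Tendsto φ (𝓝[>] 0) atTop
  ψ_lim : Tendsto ψ atTop atTop

/-! ### Payoff data -/

/-- `x ↦ ∫_0^x k(s) ds`. -/
noncomputable def primK (k : ℝ → ℝ) (x : ℝ) : ℝ := ∫ s in (0 : ℝ)..x, k s

/-- `Θ = h + 𝓛 (∫_0^· k)`. As `k` is only absolutely continuous, `Θ` is a priori determined up to
a Lebesgue-null set. Since `k` is the integral of `k'`, it has a continuous version if and only if
`k` is `C¹` (`h` being continuous), which is the case if and only if this pointwise expression is
continuous. -/
noncomputable def Theta (b σ r h k : ℝ → ℝ) (x : ℝ) : ℝ := h x + opL b σ r (primK k) x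

/-- Assumptions on the running payoff `h`, the marginal profit `k`, and `Θ`. -/
structure PayoffAssumption {Ω : Type*} [MeasurableSpace Ω] (P : Measure Ω)
    (X : ℝ → ℝ≥0 → Ω → ℝ) (b σ r h k ψ : ℝ → ℝ) (ξ : ℝ) : Prop where
  h_cont : ContinuousOn h (Ioi 0)
  h_lower : ∃ M, ∀ x, 0 < x → M ≤ h x
  h_lim : ∃ l : ℝ, Tendsto (fun x => h x / r x) (𝓝[>] 0) (𝓝 l)
  h_int : DiscountedIntegrable P X r h
  k_ac : ∀ u v, 0 < u → u < v → AbsolutelyContinuousOnInterval k u v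
  k_int : IntegrableOn k (Ioc 0 1)
  k_lower : ∃ M, ∀ x, 0 < x → M ≤ primK k x
  Lk_int : DiscountedIntegrable P X r (opL b σ r (primK k))
  k_growth : ∃ l : ℝ, 0 ≤ l ∧
    limsup (fun x => ((primK k x / ψ x : ℝ) : EReal)) atTop = (l : EReal)
  Θ_cont : ContinuousOn (Theta b σ r h k) (Ioi 0)
  ξ_pos : 0 < ξ
  Θ_incr : StrictMonoOn (fun x => Theta b σ r h k x / r x) (Ioo 0 ξ)
  Θ_decr : StrictAntiOn (fun x => Theta b σ r h k x / r x) (Ioi ξ)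

/-! ### The points `x̲`, `x̄`, `c⋆` and the free boundary; `RΘ` stands for `R_Θ` -/

/-- `R_Θ' / ψ'`. -/
noncomputable def ratio (RΘ ψ : ℝ → ℝ) (x : ℝ) : ℝ := deriv RΘ x / deriv ψ x

/-- `G_Θ = R_Θ - (R_Θ' / ψ') ψ`. -/
noncomputable def G (RΘ ψ : ℝ → ℝ) (x : ℝ) : ℝ := RΘ x - ratio RΘ ψ x * ψ x

/-- `F(γ, β) = G_Θ(β) - G_Θ(γ)`. -/
noncomputable def F (RΘ ψ : ℝ → ℝ) (γ β : ℝ) : ℝ := G RΘ ψ β - G RΘ ψ γ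

/-- `y ∈ ]ξ, ∞]` and `(R_Θ'/ψ')'` is `< 0` on `]0, y[` and `> 0` on `]y, ∞[`. -/
def IsTurningPoint (ξ : ℝ) (RΘ ψ : ℝ → ℝ) (y : EReal) : Prop :=
  (ξ : EReal) < y ∧
  (∀ x : ℝ, 0 < x → (x : EReal) < y → deriv (ratio RΘ ψ) x < 0) ∧
  (∀ x : ℝ, y < (x : EReal) → 0 < deriv (ratio RΘ ψ) x)

/-- `x̲`: the unique point of `]ξ, ∞]` at which `R_Θ'/ψ'` turns from decreasing to increasing. -/
noncomputable def xLow (ξ : ℝ) (RΘ ψ : ℝ → ℝ) : EReal :=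
  Classical.epsilon (IsTurningPoint ξ RΘ ψ)

/-- `lim_{x ↓ 0} R_Θ'(x) / ψ'(x)`, in the extended reals. -/
noncomputable def ratioZero (RΘ ψ : ℝ → ℝ) : EReal :=
  limUnder (𝓝[>] (0 : ℝ)) fun x => (ratio RΘ ψ x : EReal)

/-- `x̄ = inf {s > 0 | R_Θ'(s)/ψ'(s) > lim_{x ↓ 0} R_Θ'(x)/ψ'(x)}`, with `inf ∅ = ∞`. -/
noncomputable def xHigh (RΘ ψ : ℝ → ℝ) : EReal :=
  sInf ((fun s : ℝ => (s : EReal)) '' {s | 0 < s ∧ ratioZero RΘ ψ < (ratio RΘ ψ s : EReal)})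

/-- `R_Θ'/ψ' - R_Θ'(β)/ψ'(β)` is `> 0` on `]0, γ[`, `= 0` at `γ`, and `< 0` on `]γ, β[`. -/
def SignPattern (RΘ ψ : ℝ → ℝ) (γ β : ℝ) : Prop :=
  (∀ x ∈ Ioo 0 γ, 0 < ratio RΘ ψ x - ratio RΘ ψ β) ∧
  ratio RΘ ψ γ - ratio RΘ ψ β = 0 ∧
  (∀ x ∈ Ioo γ β, ratio RΘ ψ x - ratio RΘ ψ β < 0)

/-- `Γ(β)`, for `β ∈ ]x̲, x̄[`: the unique point `γ ∈ ]0, x̲[` for which `SignPattern` holds. -/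
noncomputable def Gam (ξ : ℝ) (RΘ ψ : ℝ → ℝ) (β : ℝ) : ℝ :=
  Classical.epsilon fun γ : ℝ => 0 < γ ∧ (γ : EReal) < xLow ξ RΘ ψ ∧ SignPattern RΘ ψ γ β

/-- `c⋆ = - lim_{β ↑ x̄} F(Γ(β), β) ∈ ]0, ∞]`. -/
noncomputable def cStar (ξ : ℝ) (RΘ ψ : ℝ → ℝ) : EReal :=
  -limUnder (comap (fun β : ℝ => (β : EReal)) (𝓝[<] xHigh RΘ ψ))
    fun β => (F RΘ ψ (Gam ξ RΘ ψ β) β : EReal)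

/-- `(γ, β) = (γ⋆(c), β⋆(c))`. -/
structure IsFreeBoundary (ξ : ℝ) (RΘ ψ : ℝ → ℝ) (c γ β : ℝ) : Prop where
  γ_pos : 0 < γ
  γ_lt : (γ : EReal) < xLow ξ RΘ ψ
  β_gt : xLow ξ RΘ ψ < (β : EReal)
  β_lt : (β : EReal) < xHigh RΘ ψ
  sign : SignPattern RΘ ψ γ β
  F_eq : F RΘ ψ γ β = -c

/-! ### The candidate value function and the HJB equation -/

/-- `w = R_h + (K_∞ - R_Θ'(β)/ψ'(β)) ψ` on `]0, β[` and `w = w(γ) + ∫_γ^· k - c` on `[β, ∞[`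
(where `γ < β`, so that `w(γ)` is given by the first expression). -/
noncomputable def candidate (Rh RΘ ψ k : ℝ → ℝ) (Kinf c γ β : ℝ) (x : ℝ) : ℝ :=
  if x < β then Rh x + (Kinf - ratio RΘ ψ β) * ψ x
  else Rh γ + (Kinf - ratio RΘ ψ β) * ψ γ + (∫ s in γ..x, k s) - c

/-- `w` is `C¹` on `]0, ∞[` with absolutely continuous first derivative and, Lebesgue-a.e.,
`max {𝓛 w(x) + h(x), -c + sup_{z ∈ [0,x[} ∫_{x-z}^x (k(s) - w'(s)) ds} = 0`. -/
structure IsHJBSolution (b σ r h k : ℝ → ℝ) (c : ℝ) (w : ℝ → ℝ) : Prop where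
  smooth : ContDiffOn ℝ 1 w (Ioi 0)
  deriv_ac : ∀ u v, 0 < u → u < v → AbsolutelyContinuousOnInterval (deriv w) u v
  hjb : ∀ᵐ x ∂(volume.restrict (Ioi (0 : ℝ))),
    max ((opL b σ r w x + h x : ℝ) : EReal)
      (-(c : EReal) + ⨆ z ∈ Ico 0 x, ((∫ s in (x - z)..x, (k s - deriv w s) : ℝ) : EReal)) = 0

end Harvest

namespace Harvest

/-! ### Discounted martingale problems -/

/-! Everything rests on the Green representation of the resolvent. With `W = φ ψ' - φ' ψ` and `q = 2
/ (σ² W)`, one has `R_F(x) = φ(x) ∫_0^x ψ F q + ψ(x) ∫_x^∞ φ F q`, so `R_F` is a `C²` solution of `𝓛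
u = -F`. For this, the discounted occupation measure is shown to have the Green kernel as density
(`occ_eq_greenMeasure`). The martingale problem only admits compactly supported test functions.
Instead of localizing with stopping times, the proof adds a large killing rate off a compact
interval and lets the interval exhaust the half line. The mass killed there is controlled by `φ +
ψ`, which solves the homogeneous equation and blows up at both ends (`integral_occ_eq_of_bounded`).

The identity `R_r = 1` gives `∫_0^x ψ r q = ψ' / W`. Hence `-ρ'` is a positive multiple of
`turning`, that is, of `∫_0^x (Θ(x)/r(x) - Θ(y)/r(y)) ψ r q dy`. The shape of `Θ / r` makes this
positive up to `ξ` and strictly decreasing afterwards, so `ρ` has at most one turning point. Since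
`G_Θ' = -ρ' ψ`, raising the common level `ρ(γ) = ρ(β)` lowers `G_Θ` more on the right branch, where
`ψ` is larger, than on the left one. So `F(Γ(β), β)` is strictly decreasing in `β`, which gives
uniqueness (`pair_unique`). It is continuous and comes arbitrarily close to `0` near the turning
point, so the intermediate value theorem gives existence (`exists_freeBoundary`).

The function `∫_0^x k + R_{𝓛(∫k)}` solves `𝓛 z = 0`, hence equals `A φ + B ψ`. Comparison with `φ`
at `0` gives `A = 0`, and comparison with `ψ` at `∞` gives `B = K_∞` (`ProfitData.exists_limit`).
Therefore `R_h = R_Θ - K_∞ ψ + ∫_0^x k`, and the candidate is `∫_0^x k` plus the function `excess`,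
which is `R_Θ - ρ(β) ψ` before `β` and the constant `G_Θ(β)` after it.

The derivative of `excess` is `ψ' (ρ - ρ(β))` before `β` and zero after, which gives the `C¹` fit.
By the sign pattern, `excess` increases up to `γ` and then decreases to its final value, and the
total fall is `G_Θ(γ) - G_Θ(β) = c`. Thus no intervention gains more than its cost, and from any `x
≥ β` the jump to `γ` gains exactly that. Before `β` the differential equation holds. Beyond `β`, `𝓛
w + h = Θ - r G_Θ(β) < 0`, because `ρ'(β) > 0` means `Θ(β)/r(β) < G_Θ(β)` and `Θ / r` decreases
there (`verification`). -/

lemma measurable_intervalIntegral_of_continuous {Ω : Type*} [MeasurableSpace Ω] {z : ℝ → Ω → ℝ}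
    (hc : ∀ ω, Continuous fun s => z s ω) (hm : ∀ s, Measurable (z s)) (a b : ℝ) :
    Measurable fun ω => ∫ s in a..b, z s ω := by
  have h : StronglyMeasurable (Function.uncurry z) :=
    (measurable_uncurry_of_continuous_of_measurable hc hm).stronglyMeasurable
  simp only [intervalIntegral]
  have h1 := fun s : Set ℝ => StronglyMeasurable.integral_prod_left' (μ := volume.restrict s) h
  exact ((h1 _).sub (h1 _)).measurable

/-- By Fubini it suffices to treat each time `s` separately. As `a s` is known at time `s`,
conditioning on `ℱ s` replaces `M T` by `M s`. -/
lemma integral_martingale_mul_integral {Ω : Type*} [mΩ : MeasurableSpace Ω] {P : Measure Ω}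
    [IsProbabilityMeasure P] {ℱ : Filtration ℝ≥0 mΩ} {M a : ℝ≥0 → Ω → ℝ} {C B : ℝ}
    (hM : Martingale M ℱ P) (hMc : ∀ ω, Continuous fun s => M s ω)
    (ha : ∀ s, StronglyMeasurable[ℱ s] (a s)) (hac : ∀ ω, Continuous fun s => a s ω)
    (hab : ∀ s ω, |a s ω| ≤ C) (T : ℝ≥0) (hMb : ∀ s ≤ T, ∀ ω, |M s ω| ≤ B) :
    ∫ ω, M T ω * (∫ s in (0 : ℝ)..T, a s.toNNReal ω) ∂P =
      ∫ ω, (∫ s in (0 : ℝ)..T, M s.toNNReal ω * a s.toNNReal ω) ∂P := by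
  have hMm : ∀ s, Measurable (M s) := fun s => ((hM.1 s).mono (ℱ.le s)).measurable
  have ham : ∀ s, Measurable (a s) := fun s => ((ha s).mono (ℱ.le s)).measurable
  have hc : Continuous Real.toNNReal := continuous_real_toNNReal
  have hMj : Measurable (Function.uncurry fun (s : ℝ) ω => M s.toNNReal ω) :=
    measurable_uncurry_of_continuous_of_measurable (fun ω => (hMc ω).comp hc) fun s => hMm _
  have haj : Measurable (Function.uncurry fun (s : ℝ) ω => a s.toNNReal ω) :=
    measurable_uncurry_of_continuous_of_measurable (fun ω => (hac ω).comp hc) fun s => ham _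
  have hsw : Measurable (fun p : Ω × ℝ => (p.2, p.1)) := measurable_swap
  have e1 : ∀ ω, M T ω * ∫ s in (0 : ℝ)..T, a s.toNNReal ω =
      ∫ s in Ioc (0 : ℝ) T, M T ω * a s.toNNReal ω := by
    intro ω
    rw [← intervalIntegral.integral_const_mul, intervalIntegral.integral_of_le T.coe_nonneg]
  have e2 : ∀ ω, ∫ s in (0 : ℝ)..T, M s.toNNReal ω * a s.toNNReal ω =
      ∫ s in Ioc (0 : ℝ) T, M s.toNNReal ω * a s.toNNReal ω := by
    intro ω
    rw [intervalIntegral.integral_of_le T.coe_nonneg]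
  simp only [e1, e2]
  have hBC : ∀ s ≤ T, ∀ t ω, ‖M s ω * a t ω‖ ≤ B * C := fun s hs t ω => by
    rw [norm_mul]
    exact mul_le_mul (hMb s hs ω) (hab t ω) (norm_nonneg _) ((abs_nonneg _).trans (hMb s hs ω))
  have i1 : Integrable (Function.uncurry fun ω s => M T ω * a (Real.toNNReal s) ω)
      (P.prod (volume.restrict (Ioc (0 : ℝ) T))) := by
    refine Integrable.of_bound (C := B * C) ?_ (ae_of_all _ fun p => hBC T le_rfl _ _)
    exact (((hMm T).comp measurable_fst).mul (haj.comp hsw)).aestronglyMeasurable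
  have i2 : Integrable (Function.uncurry fun ω s => M (Real.toNNReal s) ω * a (Real.toNNReal s) ω)
      (P.prod (volume.restrict (Ioc (0 : ℝ) T))) := by
    refine Integrable.of_bound (C := B * C) ?_ ?_
    · exact ((hMj.comp hsw).mul (haj.comp hsw)).aestronglyMeasurable
    · have h0 : ∀ᵐ s ∂(volume.restrict (Ioc (0 : ℝ) T)), s ∈ Ioc (0 : ℝ) T :=
        ae_restrict_mem measurableSet_Ioc
      have h1 := Measure.quasiMeasurePreserving_snd (μ := P)
        (ν := volume.restrict (Ioc (0 : ℝ) T)) |>.ae h0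
      filter_upwards [h1] with p hp
      exact hBC _ (Real.toNNReal_le_iff_le_coe.2 hp.2) _ _
  rw [integral_integral_swap i1, integral_integral_swap i2]
  refine setIntegral_congr_fun measurableSet_Ioc fun s hs => ?_
  have hsT : s.toNNReal ≤ T := Real.toNNReal_le_iff_le_coe.2 hs.2
  set s' := s.toNNReal
  have hint : Integrable (a s' * M T) P :=
    Integrable.of_bound ((ham s').mul (hMm T)).aestronglyMeasurable (B * C) (ae_of_all _ fun ω => by
      rw [Pi.mul_apply, mul_comm]; exact hBC T le_rfl s' ω)
  have hce := condExp_mul_of_stronglyMeasurable_left (ha s') hint (hM.integrable T)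
  calc ∫ ω, M T ω * a s' ω ∂P = ∫ ω, (a s' * M T) ω ∂P := by
        simp only [Pi.mul_apply, mul_comm]
    _ = ∫ ω, (P[a s' * M T | ℱ s']) ω ∂P := (integral_condExp (ℱ.le s')).symm
    _ = ∫ ω, M s' ω * a s' ω ∂P := by
        refine integral_congr_ae ?_
        filter_upwards [hce, hM.condExp_ae_eq hsT] with ω h1 h2
        rw [h1, Pi.mul_apply, h2, mul_comm]

/-! ### The discount factor along a single path. -/

section Discount

variable {ℓ : ℝ → ℝ} {y : ℝ≥0 → ℝ}

lemma continuous_comp_path (hℓ : Continuous ℓ) (hy : Continuous y) :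
    Continuous fun u : ℝ => ℓ (y u.toNNReal) :=
  hℓ.comp (hy.comp continuous_real_toNNReal)

lemma hasDerivAt_discount (hℓ : Continuous ℓ) (hy : Continuous y) (t : ℝ) :
    HasDerivAt (discount ℓ y) (ℓ (y t.toNNReal)) t :=
  (continuous_comp_path hℓ hy).integral_hasStrictDerivAt 0 t |>.hasDerivAt

lemma hasDerivAt_exp_discount (hℓ : Continuous ℓ) (hy : Continuous y) (t : ℝ) :
    HasDerivAt (fun t => Real.exp (-discount ℓ y t))
      (-(ℓ (y t.toNNReal) * Real.exp (-discount ℓ y t))) t := by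
  have h := (hasDerivAt_discount hℓ hy t).neg.exp
  rw [Pi.neg_apply, mul_neg, mul_comm] at h
  exact h

lemma continuous_exp_discount (hℓ : Continuous ℓ) (hy : Continuous y) :
    Continuous (fun t => Real.exp (-discount ℓ y t)) :=
  continuous_iff_continuousAt.2 fun t => (hasDerivAt_exp_discount hℓ hy t).continuousAt

lemma le_discount (hℓ : Continuous ℓ) (hy : Continuous y) {r₀ : ℝ} (hr : ∀ x, r₀ ≤ ℓ x) {t : ℝ}
    (ht : 0 ≤ t) : r₀ * t ≤ discount ℓ y t := by
  have := intervalIntegral.integral_mono_on (μ := volume) (f := fun _ => r₀) ht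
    (by simp) ((continuous_comp_path hℓ hy).intervalIntegrable 0 t)
    (fun u _ => hr _)
  simpa [discount, mul_comm] using this

lemma exp_discount_le (hℓ : Continuous ℓ) (hy : Continuous y) {r₀ : ℝ} (hr : ∀ x, r₀ ≤ ℓ x) {t : ℝ}
    (ht : 0 ≤ t) : Real.exp (-discount ℓ y t) ≤ Real.exp (-r₀ * t) := by
  rw [Real.exp_le_exp]
  have := le_discount hℓ hy hr ht
  linarith

lemma integral_discount_mul (hℓ : Continuous ℓ) (hy : Continuous y) (t : ℝ) :
    ∫ s in (0 : ℝ)..t, ℓ (y s.toNNReal) * Real.exp (-discount ℓ y s) =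
      1 - Real.exp (-discount ℓ y t) := by
  have h := intervalIntegral.integral_eq_sub_of_hasDerivAt (a := 0) (b := t)
    (fun s _ => (hasDerivAt_exp_discount hℓ hy s).neg)
    (((continuous_comp_path hℓ hy).mul (continuous_exp_discount hℓ hy)).neg.neg.intervalIntegrable _ _)
  simp only [neg_neg] at h
  rw [h]
  simp [discount]
  ring

/-- Integration by parts along a path: `M = f - ∫ g`. -/
lemma discounted_path_eq (hℓ : Continuous ℓ) (hy : Continuous y) {f g : ℝ → ℝ}
    (hf : Continuous f) (hg : Continuous g) (T : ℝ≥0) :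
    Real.exp (-discount ℓ y T) * f (y T) =
      (f (y T) - discount g y T)
      - (f (y T) - discount g y T) *
          (∫ s in (0 : ℝ)..T, ℓ (y s.toNNReal) * Real.exp (-discount ℓ y s))
      + (∫ s in (0 : ℝ)..T, (f (y s.toNNReal) - discount g y s) *
          (ℓ (y s.toNNReal) * Real.exp (-discount ℓ y s)))
      - ∫ s in (0 : ℝ)..T, Real.exp (-discount ℓ y s) *
          (ℓ (y s.toNNReal) * f (y s.toNNReal) - g (y s.toNNReal)) := by
  have cl := continuous_comp_path hℓ hy
  have cf := continuous_comp_path hf hy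
  have cg := continuous_comp_path hg hy
  have cD := continuous_exp_discount hℓ hy
  have cI : Continuous (discount g y) :=
    continuous_iff_continuousAt.2 fun t => (hasDerivAt_discount hg hy t).continuousAt
  -- The product rule for `e^{-Λ} ∫ g`; only this absolutely continuous part is differentiated,
  -- never `f` along the path.
  have h := intervalIntegral.integral_eq_sub_of_hasDerivAt (a := 0) (b := (T : ℝ))
    (fun s _ => (hasDerivAt_exp_discount hℓ hy s).mul (hasDerivAt_discount hg hy s))
    ((((cl.mul cD).neg.mul cI).add (cD.mul cg)).intervalIntegrable _ _)
  have h0 : discount g y 0 = 0 := by simp [discount]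
  simp only [Pi.mul_apply, h0, mul_zero, sub_zero] at h
  rw [integral_discount_mul hℓ hy]
  have h2 : (∫ s in (0 : ℝ)..T, (f (y s.toNNReal) - discount g y s) *
          (ℓ (y s.toNNReal) * Real.exp (-discount ℓ y s)))
      - ∫ s in (0 : ℝ)..T, Real.exp (-discount ℓ y s) *
          (ℓ (y s.toNNReal) * f (y s.toNNReal) - g (y s.toNNReal)) =
      Real.exp (-discount ℓ y T) * discount g y T := by
    rw [← h, ← intervalIntegral.integral_sub]
    · refine intervalIntegral.integral_congr fun s _ => ?_
      ring
    · exact ((cf.sub cI).mul (cl.mul cD)).intervalIntegrable _ _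
    · exact (cD.mul ((cl.mul cf).sub cg)).intervalIntegrable _ _
  rw [add_sub_assoc, h2]
  ring

end Discount

lemma abs_discount_le {g : ℝ → ℝ} {B : ℝ} (hB : ∀ x, |g x| ≤ B) (y : ℝ≥0 → ℝ) {t : ℝ}
    (ht : 0 ≤ t) : |discount g y t| ≤ B * t := by
  have := intervalIntegral.norm_integral_le_of_norm_le_const (a := 0) (b := t) (C := B)
    (f := fun u => g (y u.toNNReal)) (fun u _ => hB _)
  simpa [abs_of_nonneg ht, discount] using this

/-! ### Dynkin's formula with discounting. -/

section Dynkin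

variable {Ω : Type*} [mΩ : MeasurableSpace Ω] {P : Measure Ω} {ℱ : Filtration ℝ≥0 mΩ}
  {Y : ℝ≥0 → Ω → ℝ} {f g ℓ : ℝ → ℝ}

lemma measurable_discount_adapted (hℓ : Continuous ℓ) (hYa : ∀ t, Measurable[ℱ t] (Y t))
    (hYc : ∀ ω, Continuous fun t => Y t ω) (t : ℝ≥0) :
    Measurable[ℱ t] fun ω => discount ℓ (fun s => Y s ω) t := by
  -- Freezing the path at time `t` makes every integrand `ℱ t`-measurable without changing the
  -- integral up to `t`.
  have h := @measurable_intervalIntegral_of_continuous Ω (ℱ t)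
    (fun s ω => ℓ (Y (min s.toNNReal t) ω))
    (fun ω => hℓ.comp ((hYc ω).comp (continuous_real_toNNReal.min continuous_const)))
    (fun s => hℓ.measurable.comp ((hYa _).mono (ℱ.mono (min_le_right _ _)) le_rfl)) 0 t
  convert h using 2 with ω
  refine intervalIntegral.integral_congr fun s hs => ?_
  rw [uIcc_of_le t.coe_nonneg] at hs
  have : s.toNNReal ≤ t := Real.toNNReal_le_iff_le_coe.2 hs.2
  simp only [min_eq_left this]

lemma integral_sub_add_sub {A B C D : Ω → ℝ} (hA : Integrable A P) (hB : Integrable B P)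
    (hC : Integrable C P) (hD : Integrable D P) :
    ∫ ω, (A ω - B ω + C ω - D ω) ∂P =
      ∫ ω, A ω ∂P - ∫ ω, B ω ∂P + ∫ ω, C ω ∂P - ∫ ω, D ω ∂P := by
  have h1 : Integrable (fun ω => A ω - B ω) P := hA.sub hB
  have h2 : Integrable (fun ω => A ω - B ω + C ω) P := h1.add hC
  rw [integral_sub h2 hD, integral_add h1 hC, integral_sub hA hB]

lemma continuous_discount (hg : Continuous g) {y : ℝ≥0 → ℝ} (hy : Continuous y) :
    Continuous (discount g y) :=
  continuous_iff_continuousAt.2 fun t => (hasDerivAt_discount hg hy t).continuousAt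

/-- Take expectations in `discounted_path_eq`. The two terms pairing the martingale with `ℓ e^{-Λ}`
cancel by `integral_martingale_mul_integral`, and the martingale itself has mean `f x`. -/
lemma dynkin_finite [IsProbabilityMeasure P] (hYa : ∀ t, Measurable[ℱ t] (Y t))
    (hYc : ∀ ω, Continuous fun t => Y t ω) (hf : Continuous f) (hg : Continuous g)
    (hℓ : Continuous ℓ) {Bf Bg L : ℝ} (hfb : ∀ x, |f x| ≤ Bf) (hgb : ∀ x, |g x| ≤ Bg)
    (hℓ0 : ∀ x, 0 ≤ ℓ x) (hℓb : ∀ x, ℓ x ≤ L)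
    (hM : Martingale (fun t ω => f (Y t ω) - discount g (fun s => Y s ω) t) ℱ P) {x : ℝ}
    (h0 : ∀ᵐ ω ∂P, Y 0 ω = x) (T : ℝ≥0) :
    ∫ ω, Real.exp (-discount ℓ (fun s => Y s ω) T) * f (Y T ω) ∂P =
      f x - ∫ ω, (∫ s in (0 : ℝ)..T, Real.exp (-discount ℓ (fun s => Y s ω) s) *
          (ℓ (Y s.toNNReal ω) * f (Y s.toNNReal ω) - g (Y s.toNNReal ω))) ∂P := by
  have hYm : ∀ t, Measurable (Y t) := fun t => (hYa t).mono (ℱ.le t) le_rfl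
  have cD := fun ω => continuous_exp_discount hℓ (hYc ω)
  have cl := fun ω => continuous_comp_path hℓ (hYc ω)
  have cf := fun ω => continuous_comp_path hf (hYc ω)
  have cg := fun ω => continuous_comp_path hg (hYc ω)
  have hD1 : ∀ ω (s : ℝ), 0 ≤ s → Real.exp (-discount ℓ (fun s => Y s ω) s) ≤ 1 := fun ω s hs => by
    simpa using exp_discount_le hℓ (hYc ω) hℓ0 hs
  have hBf : 0 ≤ Bf := (abs_nonneg _).trans (hfb 0)
  have hBg : 0 ≤ Bg := (abs_nonneg _).trans (hgb 0)
  have hL : 0 ≤ L := (hℓ0 0).trans (hℓb 0)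
  have mdis : ∀ {k : ℝ → ℝ}, Continuous k → ∀ s : ℝ,
      Measurable fun ω => discount k (fun s => Y s ω) s := fun hk s =>
    measurable_intervalIntegral_of_continuous (z := fun s ω => _)
      (fun ω => continuous_comp_path hk (hYc ω)) (fun s => hk.measurable.comp (hYm _)) 0 s
  set M : ℝ≥0 → Ω → ℝ := fun t ω => f (Y t ω) - discount g (fun s => Y s ω) t with hMdef
  set a : ℝ≥0 → Ω → ℝ := fun t ω =>
    ℓ (Y t ω) * Real.exp (-discount ℓ (fun s => Y s ω) t) with hadef
  have hMm : ∀ t, Measurable (M t) := fun t => (hf.measurable.comp (hYm t)).sub (mdis hg t)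
  have hMb : ∀ s ≤ T, ∀ ω, |M s ω| ≤ Bf + Bg * T := by
    intro s hs ω
    have h1 := abs_discount_le hgb (fun s => Y s ω) s.coe_nonneg
    have h2 : Bg * (s : ℝ) ≤ Bg * T := mul_le_mul_of_nonneg_left (by exact_mod_cast hs) hBg
    calc |M s ω| ≤ |f (Y s ω)| + |discount g (fun s => Y s ω) s| := abs_sub _ _
      _ ≤ _ := by linarith [hfb (Y s ω)]
  have hMc : ∀ ω, Continuous fun s => M s ω := fun ω =>
    (hf.comp (hYc ω)).sub ((continuous_discount hg (hYc ω)).comp NNReal.continuous_coe)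
  have ha0 : ∀ s ω, |a s ω| ≤ L := fun s ω => by
    rw [abs_of_nonneg (mul_nonneg (hℓ0 _) (Real.exp_pos _).le)]
    calc a s ω ≤ L * 1 := mul_le_mul (hℓb _) (hD1 ω s s.coe_nonneg) (Real.exp_pos _).le hL
      _ = L := mul_one L
  have key := integral_martingale_mul_integral (a := a) (C := L) hM hMc
    (fun s => ((hℓ.measurable.comp (hYa s)).mul
      (measurable_discount_adapted hℓ hYa hYc s).neg.exp).stronglyMeasurable)
    (fun ω => (hℓ.comp (hYc ω)).mul ((cD ω).comp NNReal.continuous_coe)) ha0 T hMb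
  have hcoe : ∀ s ∈ uIcc (0 : ℝ) T, ((s.toNNReal : ℝ≥0) : ℝ) = s := fun s hs => by
    rw [uIcc_of_le T.coe_nonneg] at hs
    exact Real.coe_toNNReal s hs.1
  have e1 : ∀ ω, ∫ s in (0 : ℝ)..T, a s.toNNReal ω = ∫ s in (0 : ℝ)..T,
      ℓ (Y s.toNNReal ω) * Real.exp (-discount ℓ (fun s => Y s ω) s) := fun ω =>
    intervalIntegral.integral_congr fun s hs => by simp only [hadef, hcoe s hs]
  have e2 : ∀ ω, ∫ s in (0 : ℝ)..T, M s.toNNReal ω * a s.toNNReal ω = ∫ s in (0 : ℝ)..T,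
      (f (Y s.toNNReal ω) - discount g (fun s => Y s ω) s) *
        (ℓ (Y s.toNNReal ω) * Real.exp (-discount ℓ (fun s => Y s ω) s)) := fun ω =>
    intervalIntegral.integral_congr fun s hs => by simp only [hadef, hMdef, hcoe s hs]
  simp only [e1, e2] at key
  have mD : ∀ s : ℝ, Measurable fun ω => Real.exp (-discount ℓ (fun s => Y s ω) s) := fun s =>
    (mdis hℓ s).neg.exp
  have m1 := measurable_intervalIntegral_of_continuous (z := fun s ω =>
    ℓ (Y s.toNNReal ω) * Real.exp (-discount ℓ (fun s => Y s ω) s))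
    (fun ω => (cl ω).mul (cD ω)) (fun s => (hℓ.measurable.comp (hYm _)).mul (mD s)) 0 T
  have m2 := measurable_intervalIntegral_of_continuous (z := fun s ω =>
    (f (Y s.toNNReal ω) - discount g (fun s => Y s ω) s) *
        (ℓ (Y s.toNNReal ω) * Real.exp (-discount ℓ (fun s => Y s ω) s)))
    (fun ω => ((cf ω).sub (continuous_discount hg (hYc ω))).mul ((cl ω).mul (cD ω)))
    (fun s => ((hf.measurable.comp (hYm _)).sub (mdis hg s)).mul
      ((hℓ.measurable.comp (hYm _)).mul (mD s))) 0 T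
  have m3 := measurable_intervalIntegral_of_continuous (z := fun s ω =>
    Real.exp (-discount ℓ (fun s => Y s ω) s) *
          (ℓ (Y s.toNNReal ω) * f (Y s.toNNReal ω) - g (Y s.toNNReal ω)))
    (fun ω => (cD ω).mul (((cl ω).mul (cf ω)).sub (cg ω)))
    (fun s => (mD s).mul (((hℓ.measurable.comp (hYm _)).mul (hf.measurable.comp (hYm _))).sub
      (hg.measurable.comp (hYm _)))) 0 T
  have b1 : ∀ ω, |∫ s in (0 : ℝ)..T,
      ℓ (Y s.toNNReal ω) * Real.exp (-discount ℓ (fun s => Y s ω) s)| ≤ 1 := fun ω => by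
    rw [integral_discount_mul hℓ (hYc ω), abs_le]
    have := hD1 ω T T.coe_nonneg
    have := Real.exp_pos (-discount ℓ (fun s => Y s ω) T)
    constructor <;> linarith
  have b2 : ∀ ω, |∫ s in (0 : ℝ)..T, (f (Y s.toNNReal ω) - discount g (fun s => Y s ω) s) *
        (ℓ (Y s.toNNReal ω) * Real.exp (-discount ℓ (fun s => Y s ω) s))| ≤
      (Bf + Bg * T) * L * |(T : ℝ) - 0| := fun ω => by
    rw [← e2, ← Real.norm_eq_abs]
    refine intervalIntegral.norm_integral_le_of_norm_le_const fun s hs => ?_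
    rw [uIoc_of_le T.coe_nonneg] at hs
    rw [norm_mul]
    exact mul_le_mul (hMb _ (Real.toNNReal_le_iff_le_coe.2 hs.2) ω) (ha0 _ _) (norm_nonneg _)
      (by positivity)
  have b3 : ∀ ω, |∫ s in (0 : ℝ)..T, Real.exp (-discount ℓ (fun s => Y s ω) s) *
          (ℓ (Y s.toNNReal ω) * f (Y s.toNNReal ω) - g (Y s.toNNReal ω))| ≤
      1 * (L * Bf + Bg) * |(T : ℝ) - 0| := fun ω => by
    rw [← Real.norm_eq_abs]
    refine intervalIntegral.norm_integral_le_of_norm_le_const fun s hs => ?_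
    rw [uIoc_of_le T.coe_nonneg] at hs
    rw [norm_mul, Real.norm_of_nonneg (Real.exp_pos _).le]
    refine mul_le_mul (hD1 ω s hs.1.le) ?_ (norm_nonneg _) zero_le_one
    refine (abs_sub _ _).trans (add_le_add ?_ (hgb _))
    rw [abs_mul, abs_of_nonneg (hℓ0 _)]
    exact mul_le_mul (hℓb _) (hfb _) (abs_nonneg _) hL
  have i0 : Integrable (M T) P := hM.integrable T
  have i1 : Integrable (fun ω => M T ω * ∫ s in (0 : ℝ)..T,
      ℓ (Y s.toNNReal ω) * Real.exp (-discount ℓ (fun s => Y s ω) s)) P := by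
    refine Integrable.of_bound ((hMm T).mul m1).aestronglyMeasurable ((Bf + Bg * T) * 1)
      (ae_of_all _ fun ω => ?_)
    rw [norm_mul]
    exact mul_le_mul (hMb T le_rfl ω) (b1 ω) (norm_nonneg _) (by positivity)
  have i2 := Integrable.of_bound (μ := P) m2.aestronglyMeasurable _ (ae_of_all _ b2)
  have i3 := Integrable.of_bound (μ := P) m3.aestronglyMeasurable _ (ae_of_all _ b3)
  have hE : ∫ ω, M T ω ∂P = f x := by
    rw [← integral_condExp (ℱ.le 0), integral_congr_ae (hM.condExp_ae_eq (zero_le (a := T)))]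
    have : ∀ᵐ ω ∂P, M 0 ω = f x := by
      filter_upwards [h0] with ω hω
      simp [hMdef, hω, discount]
    rw [integral_congr_ae this]
    simp
  calc _ = ∫ ω, (M T ω - M T ω * (∫ s in (0 : ℝ)..T,
          ℓ (Y s.toNNReal ω) * Real.exp (-discount ℓ (fun s => Y s ω) s))
        + (∫ s in (0 : ℝ)..T, (f (Y s.toNNReal ω) - discount g (fun s => Y s ω) s) *
          (ℓ (Y s.toNNReal ω) * Real.exp (-discount ℓ (fun s => Y s ω) s)))
        - ∫ s in (0 : ℝ)..T, Real.exp (-discount ℓ (fun s => Y s ω) s) *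
          (ℓ (Y s.toNNReal ω) * f (Y s.toNNReal ω) - g (Y s.toNNReal ω))) ∂P :=
        integral_congr_ae (ae_of_all _ fun ω => discounted_path_eq hℓ (hYc ω) hf hg T)
    _ = _ := by
        rw [integral_sub_add_sub i0 i1 i2 i3, hE, key]
        ring

lemma norm_exp_discount_mul_le (hℓ : Continuous ℓ) {y : ℝ≥0 → ℝ} (hy : Continuous y) {r₀ C : ℝ}
    (hr : ∀ x, r₀ ≤ ℓ x) {q : ℝ → ℝ} (hq : ∀ t, |q t| ≤ C) {t : ℝ} (ht : 0 ≤ t) :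
    ‖Real.exp (-discount ℓ y t) * q t‖ ≤ Real.exp (-r₀ * t) * C := by
  rw [norm_mul, Real.norm_of_nonneg (Real.exp_pos _).le]
  exact mul_le_mul (exp_discount_le hℓ hy hr ht) (hq t) (norm_nonneg _) (Real.exp_pos _).le

lemma integrableOn_exp_discount_mul (hℓ : Continuous ℓ) {y : ℝ≥0 → ℝ} (hy : Continuous y)
    {r₀ C : ℝ} (hr₀ : 0 < r₀) (hr : ∀ x, r₀ ≤ ℓ x) {q : ℝ → ℝ} (hqc : Continuous q)
    (hq : ∀ t, |q t| ≤ C) :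
    IntegrableOn (fun t => Real.exp (-discount ℓ y t) * q t) (Ioi 0) := by
  refine Integrable.mono' (g := fun t => Real.exp (-r₀ * t) * C)
    ((exp_neg_integrableOn_Ioi 0 hr₀).mul_const C)
    ((continuous_exp_discount hℓ hy).mul hqc).aestronglyMeasurable ?_
  filter_upwards [ae_restrict_mem measurableSet_Ioi] with t ht
  exact norm_exp_discount_mul_le hℓ hy hr hq (le_of_lt ht)

/-- Dynkin's formula on the infinite horizon. -/
theorem dynkin [IsProbabilityMeasure P] (hYa : ∀ t, Measurable[ℱ t] (Y t))
    (hYc : ∀ ω, Continuous fun t => Y t ω) (hf : Continuous f) (hg : Continuous g)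
    (hℓ : Continuous ℓ) {Bf Bg L r₀ : ℝ} (hfb : ∀ x, |f x| ≤ Bf) (hgb : ∀ x, |g x| ≤ Bg)
    (hr₀ : 0 < r₀) (hℓ0 : ∀ x, r₀ ≤ ℓ x) (hℓb : ∀ x, ℓ x ≤ L)
    (hM : Martingale (fun t ω => f (Y t ω) - discount g (fun s => Y s ω) t) ℱ P) {x : ℝ}
    (h0 : ∀ᵐ ω ∂P, Y 0 ω = x) :
    ∫ ω, (∫ t in Ioi (0 : ℝ), Real.exp (-discount ℓ (fun s => Y s ω) t) *
      (ℓ (Y t.toNNReal ω) * f (Y t.toNNReal ω) - g (Y t.toNNReal ω))) ∂P = f x := by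
  have hYm : ∀ t, Measurable (Y t) := fun t => (hYa t).mono (ℱ.le t) le_rfl
  have hℓ00 : ∀ x, 0 ≤ ℓ x := fun x => hr₀.le.trans (hℓ0 x)
  have hL : 0 ≤ L := (hℓ00 0).trans (hℓb 0)
  have hqb : ∀ ω (t : ℝ), |ℓ (Y t.toNNReal ω) * f (Y t.toNNReal ω) - g (Y t.toNNReal ω)| ≤
      L * Bf + Bg := fun ω t => by
    refine (abs_sub _ _).trans (add_le_add ?_ (hgb _))
    rw [abs_mul, abs_of_nonneg (hℓ00 _)]
    exact mul_le_mul (hℓb _) (hfb _) (abs_nonneg _) hL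
  have hqc : ∀ ω, Continuous fun t : ℝ =>
      ℓ (Y t.toNNReal ω) * f (Y t.toNNReal ω) - g (Y t.toNNReal ω) := fun ω =>
    ((continuous_comp_path hℓ (hYc ω)).mul (continuous_comp_path hf (hYc ω))).sub
      (continuous_comp_path hg (hYc ω))
  have hint := fun ω => integrableOn_exp_discount_mul hℓ (hYc ω) hr₀ hℓ0 (hqc ω) (hqb ω)
  have hbint : IntegrableOn (fun t => Real.exp (-r₀ * t) * (L * Bf + Bg)) (Ioi 0) :=
    (exp_neg_integrableOn_Ioi 0 hr₀).mul_const _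
  have hmeas : ∀ T : ℝ, Measurable fun ω => ∫ s in (0 : ℝ)..T,
      Real.exp (-discount ℓ (fun s => Y s ω) s) *
          (ℓ (Y s.toNNReal ω) * f (Y s.toNNReal ω) - g (Y s.toNNReal ω)) := fun T =>
    measurable_intervalIntegral_of_continuous (z := fun s ω =>
      Real.exp (-discount ℓ (fun s => Y s ω) s) *
          (ℓ (Y s.toNNReal ω) * f (Y s.toNNReal ω) - g (Y s.toNNReal ω)))
    (fun ω => (continuous_exp_discount hℓ (hYc ω)).mul (hqc ω))
    (fun s => (measurable_intervalIntegral_of_continuous (z := fun s ω => ℓ (Y s.toNNReal ω))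
      (fun ω => continuous_comp_path hℓ (hYc ω))
      (fun s => hℓ.measurable.comp (hYm _)) 0 s).neg.exp.mul
        (((hℓ.measurable.comp (hYm _)).mul (hf.measurable.comp (hYm _))).sub
      (hg.measurable.comp (hYm _)))) 0 T
  have t1 : Tendsto (fun n : ℕ => ∫ ω, (∫ s in (0 : ℝ)..n,
      Real.exp (-discount ℓ (fun s => Y s ω) s) *
          (ℓ (Y s.toNNReal ω) * f (Y s.toNNReal ω) - g (Y s.toNNReal ω))) ∂P) atTop
      (𝓝 (∫ ω, (∫ t in Ioi (0 : ℝ), Real.exp (-discount ℓ (fun s => Y s ω) t) *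
      (ℓ (Y t.toNNReal ω) * f (Y t.toNNReal ω) - g (Y t.toNNReal ω))) ∂P)) := by
    refine tendsto_integral_of_dominated_convergence
      (fun _ => ∫ t in Ioi (0 : ℝ), Real.exp (-r₀ * t) * (L * Bf + Bg))
      (fun n => (hmeas n).aestronglyMeasurable) (integrable_const _) (fun n => ae_of_all _ fun ω => ?_)
      (ae_of_all _ fun ω => intervalIntegral_tendsto_integral_Ioi 0 (hint ω)
        tendsto_natCast_atTop_atTop)
    rw [intervalIntegral.integral_of_le (Nat.cast_nonneg n)]
    refine (norm_integral_le_integral_norm _).trans ?_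
    have hsub : Ioc (0 : ℝ) n ⊆ Ioi 0 := fun t ht => ht.1
    calc _ ≤ ∫ t in Ioc (0 : ℝ) n, Real.exp (-r₀ * t) * (L * Bf + Bg) :=
          setIntegral_mono_on ((hint ω).mono_set hsub).norm (hbint.mono_set hsub)
            measurableSet_Ioc fun t ht =>
              norm_exp_discount_mul_le hℓ (hYc ω) hℓ0 (hqb ω) ht.1.le
      _ ≤ _ := setIntegral_mono_set hbint (ae_of_all _ fun t =>
          mul_nonneg (Real.exp_pos _).le ((abs_nonneg _).trans (hqb ω t))) hsub.eventuallyLE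
  -- The terminal term vanishes because `f` is bounded and the discount rate is at least `r₀ > 0`.
  have t2 : Tendsto (fun n : ℕ => ∫ ω, Real.exp (-discount ℓ (fun s => Y s ω) ((n : ℝ≥0) : ℝ)) *
      f (Y n ω) ∂P) atTop (𝓝 0) := by
    have hb : Tendsto (fun n : ℕ => Real.exp (-r₀ * n) * Bf) atTop (𝓝 (0 * Bf)) := by
      refine Tendsto.mul_const _ (Real.tendsto_exp_atBot.comp ?_)
      exact Tendsto.const_mul_atTop_of_neg (neg_neg_of_pos hr₀) tendsto_natCast_atTop_atTop
    rw [zero_mul] at hb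
    refine squeeze_zero_norm (fun n => ?_) hb
    have : ∀ ω, ‖Real.exp (-discount ℓ (fun s => Y s ω) ((n : ℝ≥0) : ℝ)) * f (Y n ω)‖ ≤
        Real.exp (-r₀ * n) * Bf := fun ω => by
      have := norm_exp_discount_mul_le hℓ (hYc ω) hℓ0 (q := fun _ => f (Y n ω)) (fun _ => hfb _)
        (t := ((n : ℝ≥0) : ℝ)) (NNReal.coe_nonneg _)
      simpa using this
    simpa using norm_integral_le_of_norm_le_const (ae_of_all P this)
  have t3 : Tendsto (fun n : ℕ => f x - ∫ ω, (∫ s in (0 : ℝ)..n,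
      Real.exp (-discount ℓ (fun s => Y s ω) s) *
          (ℓ (Y s.toNNReal ω) * f (Y s.toNNReal ω) - g (Y s.toNNReal ω))) ∂P) atTop (𝓝 0) := by
    refine t2.congr fun n => ?_
    have := dynkin_finite hYa hYc hf hg hℓ hfb hgb hℓ00 hℓb hM h0 (n : ℝ≥0)
    rwa [NNReal.coe_natCast] at this
  have := tendsto_nhds_unique t3 (t1.const_sub (f x))
  linarith

end Dynkin

/-! ### Discounted occupation measures -/

/-- The discounted occupation measure `A ↦ E ∫_0^∞ exp (-∫_0^t ℓ(Y_s) ds) 1_A(Y_t) dt`. -/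
noncomputable def occ {Ω : Type*} [MeasurableSpace Ω] (P : Measure Ω) (Y : ℝ≥0 → Ω → ℝ)
    (ℓ : ℝ → ℝ) : Measure ℝ :=
  ((P.prod (volume.restrict (Ioi (0 : ℝ)))).withDensity fun p =>
    ENNReal.ofReal (Real.exp (-discount ℓ (fun s => Y s p.1) p.2))).map
      fun p => Y p.2.toNNReal p.1

section Occ

variable {Ω : Type*} [mΩ : MeasurableSpace Ω] {P : Measure Ω} {Y : ℝ≥0 → Ω → ℝ} {ℓ : ℝ → ℝ}

lemma measurable_path (hYm : ∀ t, Measurable (Y t)) (hYc : ∀ ω, Continuous fun t => Y t ω) :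
    Measurable fun p : Ω × ℝ => Y p.2.toNNReal p.1 :=
  (measurable_uncurry_of_continuous_of_measurable (u := fun (t : ℝ) ω => Y t.toNNReal ω)
    (fun ω => (hYc ω).comp continuous_real_toNNReal) fun _ => hYm _).comp measurable_swap

lemma measurable_discount (hYm : ∀ t, Measurable (Y t)) (hYc : ∀ ω, Continuous fun t => Y t ω)
    (hℓ : Continuous ℓ) : Measurable fun p : Ω × ℝ => discount ℓ (fun s => Y s p.1) p.2 :=
  (measurable_uncurry_of_continuous_of_measurable
    (u := fun (t : ℝ) ω => discount ℓ (fun s => Y s ω) t)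
    (fun ω => continuous_discount hℓ (hYc ω)) fun t =>
      measurable_intervalIntegral_of_continuous (fun ω => continuous_comp_path hℓ (hYc ω))
        (fun _ => hℓ.measurable.comp (hYm _)) 0 t).comp measurable_swap

lemma measurable_occDensity (hYm : ∀ t, Measurable (Y t)) (hYc : ∀ ω, Continuous fun t => Y t ω)
    (hℓ : Continuous ℓ) : Measurable fun p : Ω × ℝ =>
      ENNReal.ofReal (Real.exp (-discount ℓ (fun s => Y s p.1) p.2)) :=
  (measurable_discount hYm hYc hℓ).neg.exp.ennreal_ofReal

lemma lintegral_occ [SFinite P] (hYm : ∀ t, Measurable (Y t))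
    (hYc : ∀ ω, Continuous fun t => Y t ω) (hℓ : Continuous ℓ) {F : ℝ → ℝ≥0∞} (hF : Measurable F) :
    ∫⁻ y, F y ∂(occ P Y ℓ) = ∫⁻ ω, (∫⁻ t in Ioi (0 : ℝ),
      ENNReal.ofReal (Real.exp (-discount ℓ (fun s => Y s ω) t)) * F (Y t.toNNReal ω)) ∂P := by
  have h1 := measurable_path hYm hYc
  have h2 := measurable_occDensity hYm hYc hℓ
  have h3 : Measurable fun p : Ω × ℝ => F (Y p.2.toNNReal p.1) := hF.comp h1
  rw [occ, lintegral_map hF h1, lintegral_withDensity_eq_lintegral_mul _ h2 h3,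
    lintegral_prod _ (h2.mul h3).aemeasurable]
  rfl

lemma isFiniteMeasure_occ [IsProbabilityMeasure P] (hYm : ∀ t, Measurable (Y t))
    (hYc : ∀ ω, Continuous fun t => Y t ω) (hℓ : Continuous ℓ) {r₀ : ℝ} (hr₀ : 0 < r₀)
    (hℓ0 : ∀ x, r₀ ≤ ℓ x) : IsFiniteMeasure (occ P Y ℓ) := by
  refine ⟨?_⟩
  have h := lintegral_occ (P := P) hYm hYc hℓ (F := fun _ => 1) measurable_const
  rw [lintegral_one] at h
  rw [h]
  have hlt : ∫⁻ t in Ioi (0 : ℝ), ENNReal.ofReal (Real.exp (-r₀ * t)) < ⊤ :=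
    (exp_neg_integrableOn_Ioi 0 hr₀).lintegral_lt_top
  refine lt_of_le_of_lt (lintegral_mono (g := fun _ =>
    ∫⁻ t in Ioi (0 : ℝ), ENNReal.ofReal (Real.exp (-r₀ * t))) fun ω => ?_) (by simpa using hlt)
  refine setLIntegral_mono (by fun_prop) fun t ht => ?_
  rw [mul_one]
  exact ENNReal.ofReal_le_ofReal (exp_discount_le hℓ (hYc ω) hℓ0 (le_of_lt ht))

lemma integrable_prod_of_occ (hYm : ∀ t, Measurable (Y t))
    (hYc : ∀ ω, Continuous fun t => Y t ω) (hℓ : Continuous ℓ) {F : ℝ → ℝ}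
    (hF : Integrable F (occ P Y ℓ)) :
    Integrable (fun p : Ω × ℝ => Real.exp (-discount ℓ (fun s => Y s p.1) p.2) *
      F (Y p.2.toNNReal p.1)) (P.prod (volume.restrict (Ioi (0 : ℝ)))) := by
  rw [occ, integrable_map_measure hF.1 (measurable_path hYm hYc).aemeasurable,
    integrable_withDensity_iff_integrable_smul' (measurable_occDensity hYm hYc hℓ)
      (ae_of_all _ fun p => ENNReal.ofReal_lt_top)] at hF
  convert hF using 2 with p
  rw [ENNReal.toReal_ofReal (Real.exp_pos _).le]
  rfl

lemma integral_occ_prod (hYm : ∀ t, Measurable (Y t))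
    (hYc : ∀ ω, Continuous fun t => Y t ω) (hℓ : Continuous ℓ) {F : ℝ → ℝ}
    (hF : Integrable F (occ P Y ℓ)) :
    ∫ y, F y ∂(occ P Y ℓ) = ∫ p : Ω × ℝ, Real.exp (-discount ℓ (fun s => Y s p.1) p.2) *
      F (Y p.2.toNNReal p.1) ∂(P.prod (volume.restrict (Ioi (0 : ℝ)))) := by
  rw [occ, integral_map (measurable_path hYm hYc).aemeasurable hF.1,
    integral_withDensity_eq_integral_toReal_smul (measurable_occDensity hYm hYc hℓ)
      (ae_of_all _ fun p => ENNReal.ofReal_lt_top)]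
  refine integral_congr_ae (ae_of_all _ fun p => ?_)
  simp only
  rw [ENNReal.toReal_ofReal (Real.exp_pos _).le]
  rfl

lemma integral_occ [SFinite P] (hYm : ∀ t, Measurable (Y t))
    (hYc : ∀ ω, Continuous fun t => Y t ω) (hℓ : Continuous ℓ) {F : ℝ → ℝ}
    (hF : Integrable F (occ P Y ℓ)) :
    ∫ y, F y ∂(occ P Y ℓ) = ∫ ω, (∫ t in Ioi (0 : ℝ),
      Real.exp (-discount ℓ (fun s => Y s ω) t) * F (Y t.toNNReal ω)) ∂P := by
  rw [integral_occ_prod hYm hYc hℓ hF, integral_prod _ (integrable_prod_of_occ hYm hYc hℓ hF)]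

lemma ae_occ_pos (hYm : ∀ t, Measurable (Y t))
    (hYc : ∀ ω, Continuous fun t => Y t ω) (hpos : ∀ t ω, 0 < Y t ω) :
    ∀ᵐ y ∂(occ P Y ℓ), y ∈ Ioi (0 : ℝ) := by
  exact (ae_map_iff (p := (· ∈ Ioi (0 : ℝ))) (measurable_path hYm hYc).aemeasurable
    measurableSet_Ioi).2 (ae_of_all _ fun p => hpos _ _)

lemma aestronglyMeasurable_occ (hYm : ∀ t, Measurable (Y t))
    (hYc : ∀ ω, Continuous fun t => Y t ω) (hpos : ∀ t ω, 0 < Y t ω) {F : ℝ → ℝ}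
    (hF : ContinuousOn F (Ioi 0)) : AEStronglyMeasurable F (occ P Y ℓ) := by
  rw [← Measure.restrict_eq_self_of_ae_mem (ae_occ_pos (P := P) (ℓ := ℓ) hYm hYc hpos)]
  exact hF.aestronglyMeasurable measurableSet_Ioi

lemma integrable_occ_of_bound [IsProbabilityMeasure P] (hYm : ∀ t, Measurable (Y t))
    (hYc : ∀ ω, Continuous fun t => Y t ω) (hpos : ∀ t ω, 0 < Y t ω) (hℓ : Continuous ℓ) {r₀ : ℝ}
    (hr₀ : 0 < r₀) (hℓ0 : ∀ x, r₀ ≤ ℓ x) {F : ℝ → ℝ} (hF : ContinuousOn F (Ioi 0)) {C : ℝ}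
    (hC : ∀ y, 0 < y → |F y| ≤ C) : Integrable F (occ P Y ℓ) := by
  have := isFiniteMeasure_occ (P := P) hYm hYc hℓ hr₀ hℓ0
  refine Integrable.of_bound (aestronglyMeasurable_occ hYm hYc hpos hF) C ?_
  filter_upwards [ae_occ_pos hYm hYc hpos] with y hy using hC y hy

lemma integral_exp_discount (hℓ : Continuous ℓ) {y : ℝ≥0 → ℝ} (hy : Continuous y) {r₀ L : ℝ}
    (hr₀ : 0 < r₀) (hr : ∀ x, r₀ ≤ ℓ x) (hL : ∀ x, ℓ x ≤ L) :
    ∫ t in Ioi (0 : ℝ), Real.exp (-discount ℓ y t) * ℓ (y t.toNNReal) = 1 := by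
  have hint := integrableOn_exp_discount_mul hℓ hy hr₀ hr (continuous_comp_path hℓ hy)
    (C := L) (fun t => by rw [abs_of_nonneg (hr₀.le.trans (hr _))]; exact hL _)
  have t1 := intervalIntegral_tendsto_integral_Ioi 0 hint tendsto_id
  have t2 : Tendsto (fun t => 1 - Real.exp (-discount ℓ y t)) atTop (𝓝 (1 - 0)) := by
    refine Tendsto.const_sub _ ?_
    have : Tendsto (fun t => Real.exp (-r₀ * t)) atTop (𝓝 0) :=
      Real.tendsto_exp_atBot.comp (tendsto_id.const_mul_atTop_of_neg (neg_neg_of_pos hr₀))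
    refine squeeze_zero' (Eventually.of_forall fun t => (Real.exp_pos _).le) ?_ this
    filter_upwards [eventually_ge_atTop 0] with t ht using exp_discount_le hℓ hy hr ht
  rw [sub_zero] at t2
  refine tendsto_nhds_unique t1 (t2.congr fun t => ?_)
  rw [← integral_discount_mul hℓ hy]
  exact intervalIntegral.integral_congr fun s _ => mul_comm _ _

/-- Along each path, `∫_0^∞ Λ' e^{-Λ} = 1` because `Λ` tends to infinity. This one identity later
bounds the killed mass and yields `R_r = 1`. -/
lemma integral_occ_self [IsProbabilityMeasure P] (hYm : ∀ t, Measurable (Y t))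
    (hYc : ∀ ω, Continuous fun t => Y t ω) (hpos : ∀ t ω, 0 < Y t ω) (hℓ : Continuous ℓ)
    {r₀ L : ℝ} (hr₀ : 0 < r₀) (hℓ0 : ∀ x, r₀ ≤ ℓ x) (hL : ∀ x, ℓ x ≤ L) :
    ∫ y, ℓ y ∂(occ P Y ℓ) = 1 := by
  rw [integral_occ hYm hYc hℓ (integrable_occ_of_bound hYm hYc hpos hℓ hr₀ hℓ0 hℓ.continuousOn
    (C := L) fun y _ => by rw [abs_of_nonneg (hr₀.le.trans (hℓ0 _))]; exact hL _)]
  simp [integral_exp_discount hℓ (hYc _) hr₀ hℓ0 hL]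

/-- Potentials that agree on an exhausting sequence of sets give, in the limit, the same
discounted occupation integrals. -/
lemma tendsto_integral_occ [IsProbabilityMeasure P] (hYm : ∀ t, Measurable (Y t))
    (hYc : ∀ ω, Continuous fun t => Y t ω) (hpos : ∀ t ω, 0 < Y t ω) (hℓ : Continuous ℓ)
    {r₀ : ℝ} (hr₀ : 0 < r₀) (hℓ0 : ∀ x, r₀ ≤ ℓ x) {ℓs : ℕ → ℝ → ℝ} (hℓs : ∀ n, Continuous (ℓs n))
    (hℓs0 : ∀ n x, r₀ ≤ ℓs n x)
    (hev : ∀ a b : ℝ, 0 < a → ∀ᶠ n in atTop, ∀ y ∈ Icc a b, ℓs n y = ℓ y)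
    {G : ℝ → ℝ} (hG : ContinuousOn G (Ioi 0)) {C : ℝ} (hC : ∀ y, 0 < y → |G y| ≤ C) :
    Tendsto (fun n => ∫ y, G y ∂(occ P Y (ℓs n))) atTop (𝓝 (∫ y, G y ∂(occ P Y ℓ))) := by
  have hi := fun n => integrable_occ_of_bound (P := P) hYm hYc hpos (hℓs n) hr₀ (hℓs0 n) hG hC
  have hi' := integrable_occ_of_bound (P := P) hYm hYc hpos hℓ hr₀ hℓ0 hG hC
  simp only [fun n => integral_occ_prod hYm hYc (hℓs n) (hi n), integral_occ_prod hYm hYc hℓ hi']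
  have hC0 : 0 ≤ C := (abs_nonneg _).trans (hC 1 one_pos)
  have hb : Integrable (fun p : Ω × ℝ => 1 * (Real.exp (-r₀ * p.2) * C))
      (P.prod (volume.restrict (Ioi (0 : ℝ)))) :=
    Integrable.mul_prod (integrable_const (1 : ℝ)) ((exp_neg_integrableOn_Ioi 0 hr₀).mul_const C)
  refine tendsto_integral_of_dominated_convergence _
    (fun n => (integrable_prod_of_occ hYm hYc (hℓs n) (hi n)).1) hb (fun n => ?_)
    (ae_of_all _ fun p => ?_)
  · have h0 : ∀ᵐ s ∂(volume.restrict (Ioi (0 : ℝ))), s ∈ Ioi (0 : ℝ) :=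
      ae_restrict_mem measurableSet_Ioi
    filter_upwards [Measure.quasiMeasurePreserving_snd (μ := P) |>.ae h0] with p hp
    rw [one_mul]
    exact norm_exp_discount_mul_le (hℓs n) (hYc p.1) (hℓs0 n)
      (q := fun _ => G (Y p.2.toNNReal p.1)) (fun _ => hC _ (hpos _ _)) (le_of_lt hp)
  -- Up to a fixed time a path stays in a compact subinterval of `]0, ∞[`, so the discount factors
  -- are eventually equal, not merely close.
  · refine tendsto_const_nhds.congr' ?_
    have hcont : ContinuousOn (fun u : ℝ => Y u.toNNReal p.1) (uIcc 0 p.2) :=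
      ((hYc p.1).comp continuous_real_toNNReal).continuousOn
    obtain ⟨u, -, hu⟩ := isCompact_uIcc.exists_isMinOn nonempty_uIcc hcont
    obtain ⟨v, -, hv⟩ := isCompact_uIcc.exists_isMaxOn nonempty_uIcc hcont
    filter_upwards [hev (Y u.toNNReal p.1) (Y v.toNNReal p.1) (hpos _ _)] with n hn
    have : discount (ℓs n) (fun s => Y s p.1) p.2 = discount ℓ (fun s => Y s p.1) p.2 :=
      intervalIntegral.integral_congr fun s hs => hn _ ⟨hu hs, hv hs⟩
    rw [this]

end Occ

/-! ### Feynman–Kac representation for bounded solutions -/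

/-- Coefficients are controlled on `[0, ∞[` only. Composing with `max · 0` makes them continuous on
the line and changes nothing along positive paths. -/
lemma continuous_comp_max_zero {f : ℝ → ℝ} (hf : ContinuousOn f (Ici 0)) :
    Continuous fun x => f (max x 0) :=
  hf.comp_continuous (continuous_id.max continuous_const) fun x => le_max_right x 0

section Feynman

variable {Ω : Type*} [mΩ : MeasurableSpace Ω] {P : Measure Ω} {ℱ : Filtration ℝ≥0 mΩ}
  {Y : ℝ≥0 → Ω → ℝ} {b σ r : ℝ → ℝ} {x : ℝ}

lemma IsDiffusionFrom.measurable (hY : IsDiffusionFrom b σ P ℱ Y x) (t : ℝ≥0) :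
    Measurable (Y t) := (hY.adapted t).mono (ℱ.le t) le_rfl

/-- The drift term of a compactly supported test function. -/
noncomputable def generator (b σ f : ℝ → ℝ) (y : ℝ) : ℝ :=
  1 / 2 * σ (max y 0) ^ 2 * deriv (deriv f) y + b (max y 0) * deriv f y

lemma continuous_generator (hb : ContinuousOn b (Ici 0)) (hσ : ContinuousOn σ (Ici 0)) {f : ℝ → ℝ}
    (hf : ContDiff ℝ 2 f) : Continuous (generator b σ f) := by
  have h1 : ContDiff ℝ 1 (deriv f) := hf.deriv' (n := 1)
  have h2 : Continuous (deriv (deriv f)) := h1.continuous_deriv le_rfl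
  exact ((continuous_const.mul ((continuous_comp_max_zero hσ).pow 2)).mul h2).add
    ((continuous_comp_max_zero hb).mul h1.continuous)

lemma exists_bound_generator (hb : ContinuousOn b (Ici 0)) (hσ : ContinuousOn σ (Ici 0))
    {f : ℝ → ℝ} (hf : ContDiff ℝ 2 f) (hc : HasCompactSupport f) :
    ∃ C, ∀ y, |generator b σ f y| ≤ C :=
  (continuous_generator hb hσ hf).bounded_above_of_compact_support
    ((hc.deriv.deriv.mul_left).add hc.deriv.mul_left)

/-- Adding the constant `m` is free, since constants are martingales. It allows test functions equal
to `m`, rather than `0`, off a compact set, as needed for a supersolution that is large near the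
boundary. -/
lemma integral_occ_test [IsProbabilityMeasure P] (hY : IsDiffusionFrom b σ P ℱ Y x)
    (hb : ContinuousOn b (Ici 0)) (hσ : ContinuousOn σ (Ici 0)) {ℓ : ℝ → ℝ} (hℓ : Continuous ℓ)
    {r₀ L : ℝ} (hr₀ : 0 < r₀) (hℓ0 : ∀ x, r₀ ≤ ℓ x) (hℓb : ∀ x, ℓ x ≤ L) {f : ℝ → ℝ}
    (hf : ContDiff ℝ 2 f) (hc : HasCompactSupport f) (hs : tsupport f ⊆ Ioi 0) (m : ℝ) :
    ∫ y, (ℓ y * (m + f y) - generator b σ f y) ∂(occ P Y ℓ) = m + f x := by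
  obtain ⟨Cf, hCf⟩ := hf.continuous.bounded_above_of_compact_support hc
  obtain ⟨Cg, hCg⟩ := exists_bound_generator hb hσ hf hc
  have hg := continuous_generator hb hσ hf
  have hcf : Continuous fun y => m + f y := continuous_const.add hf.continuous
  have hfb : ∀ y, |m + f y| ≤ |m| + Cf := fun y => (abs_add_le _ _).trans (by
    have := hCf y; rw [Real.norm_eq_abs] at this; linarith)
  have hM : Martingale (fun t ω => (m + f (Y t ω)) -
      discount (generator b σ f) (fun s => Y s ω) t) ℱ P := by
    have h := (martingale_const ℱ P m).add (hY.martingale f hf hc hs)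
    convert h using 1
    funext t ω
    simp only [Pi.add_apply, add_sub_assoc, discount, generator, max_eq_left (hY.pos _ ω).le]
  have hcont : Continuous fun y => ℓ y * (m + f y) - generator b σ f y := (hℓ.mul hcf).sub hg
  rw [integral_occ hY.measurable hY.continuous_paths hℓ
    (integrable_occ_of_bound hY.measurable hY.continuous_paths hY.pos hℓ hr₀ hℓ0
      hcont.continuousOn (C := L * (|m| + Cf) + Cg) fun y _ => ?_)]
  · exact dynkin hY.adapted hY.continuous_paths hcf hg hℓ hfb hCg hr₀ hℓ0 hℓb hM hY.start
  · refine (abs_sub _ _).trans (add_le_add ?_ (hCg y))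
    have h0 := hr₀.le.trans (hℓ0 y)
    rw [abs_mul, abs_of_nonneg h0]
    exact mul_le_mul (hℓb y) (hfb y) (abs_nonneg _) (h0.trans (hℓb y))

section Cutoff

variable {c : ℝ} (χ : ContDiffBump c) {u : ℝ → ℝ} (m : ℝ)

lemma contDiff_cutoff (hu : ContDiffOn ℝ 2 u (Ioi 0)) (hχ : Metric.closedBall c χ.rOut ⊆ Ioi 0) :
    ContDiff ℝ 2 fun y => χ y * (u y - m) := by
  rw [contDiff_iff_contDiffAt]
  intro y
  by_cases hy : 0 < y
  · exact (χ.contDiff (n := 2)).contDiffAt.mul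
      ((hu.contDiffAt (Ioi_mem_nhds hy)).sub contDiffAt_const)
  · have hy' : y ∉ tsupport χ := by rw [χ.tsupport_eq]; exact fun h => hy (hχ h)
    refine (contDiffAt_const (c := (0 : ℝ))).congr_of_eventuallyEq ?_
    filter_upwards [notMem_tsupport_iff_eventuallyEq.1 hy'] with z hz
    simp [hz]

lemma hasCompactSupport_cutoff : HasCompactSupport fun y => χ y * (u y - m) :=
  χ.hasCompactSupport.mul_right

lemma tsupport_cutoff (hχ : Metric.closedBall c χ.rOut ⊆ Ioi 0) :
    (tsupport fun y => χ y * (u y - m)) ⊆ Ioi 0 :=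
  (tsupport_mul_subset_left.trans χ.tsupport_eq.subset).trans hχ

lemma generator_cutoff {y : ℝ} (hy : y ∈ Metric.ball c χ.rIn) (hy0 : 0 < y) :
    r y * (m + χ y * (u y - m)) - generator b σ (fun y => χ y * (u y - m)) y =
      -opL b σ r u y := by
  have h : (fun y => χ y * (u y - m)) =ᶠ[𝓝 y] fun y => u y - m := by
    filter_upwards [χ.eventuallyEq_one_of_mem_ball hy] with z hz
    simp [hz]
  have h1 : deriv (fun y => χ y * (u y - m)) =ᶠ[𝓝 y] deriv u := by
    refine h.deriv.trans (Eventually.of_forall fun z => ?_)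
    simp
  rw [generator, opL, max_eq_left hy0.le, h1.deriv_eq, h1.eq_of_nhds, h.eq_of_nhds]
  ring

end Cutoff

/-- With the potential `N v` added to the discounting rate, a cut-off solution satisfies the
Dynkin formula up to an error of order `1 / N`. -/
lemma exists_penalized_bound [IsProbabilityMeasure P] (hY : IsDiffusionFrom b σ P ℱ Y x)
    (hb : ContinuousOn b (Ici 0)) (hσ : ContinuousOn σ (Ici 0)) (hr : Continuous r)
    {r₀ L : ℝ} (hr₀ : 0 < r₀) (hr0 : ∀ x, r₀ ≤ r x) (hrb : ∀ x, r x ≤ L) {c : ℝ}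
    (χ : ContDiffBump c) (hχ : Metric.closedBall c χ.rOut ⊆ Ioi 0) {v : ℝ → ℝ} (hv : Continuous v)
    (hv0 : ∀ y, 0 ≤ v y) (hv1 : ∀ y, v y ≤ 1) (hvb : ∀ y ∉ Metric.ball c χ.rIn, v y = 1)
    (hx : x ∈ Metric.ball c χ.rIn) {u G : ℝ → ℝ} (hu : ContDiffOn ℝ 2 u (Ioi 0))
    (hG : ContinuousOn G (Ioi 0)) {B : ℝ} (hGb : ∀ y, 0 < y → |G y| ≤ B)
    (huG : ∀ y, 0 < y → opL b σ r u y = -G y) (m : ℝ) :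
    ∃ C, ∀ N, 0 < N → |∫ y, G y ∂(occ P Y fun y => r y + N * v y) +
      N * ∫ y, v y * (m + χ y * (u y - m)) ∂(occ P Y fun y => r y + N * v y) - u x| ≤ C / N := by
  set f : ℝ → ℝ := fun y => χ y * (u y - m) with hfdef
  have hf : ContDiff ℝ 2 f := contDiff_cutoff χ m hu hχ
  have hfc : HasCompactSupport f := hasCompactSupport_cutoff χ m
  obtain ⟨Cf, hCf⟩ := hf.continuous.bounded_above_of_compact_support hfc
  obtain ⟨Cg, hCg⟩ := exists_bound_generator hb hσ hf hfc
  have hg := continuous_generator hb hσ hf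
  have hL : 0 ≤ L := (hr₀.le.trans (hr0 0)).trans (hrb 0)
  have hfb : ∀ y, |m + f y| ≤ |m| + Cf := fun y => (abs_add_le _ _).trans (by
    have := hCf y; rw [Real.norm_eq_abs] at this; linarith)
  have hmf : 0 ≤ |m| + Cf := (abs_nonneg _).trans (hfb 0)
  set h : ℝ → ℝ := fun y => r y * (m + f y) - generator b σ f y with hhdef
  have hhc : Continuous h := (hr.mul (continuous_const.add hf.continuous)).sub hg
  have hhb : ∀ y, |h y| ≤ L * (|m| + Cf) + Cg := fun y => by
    refine (abs_sub _ _).trans (add_le_add ?_ (hCg y))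
    rw [abs_mul, abs_of_nonneg (hr₀.le.trans (hr0 y))]
    exact mul_le_mul (hrb y) (hfb y) (abs_nonneg _) hL
  have hB : 0 ≤ B := (abs_nonneg _).trans (hGb 1 one_pos)
  set C := L * (|m| + Cf) + Cg + B with hCdef
  have hC : 0 ≤ C := add_nonneg ((abs_nonneg _).trans (hhb 0)) hB
  -- Where the cut-off is inactive the equation for `u` holds exactly; elsewhere `v = 1` absorbs a
  -- crude bound.
  have hhG : ∀ y, 0 < y → |h y - G y| ≤ C * v y := fun y hy => by
    by_cases hyb : y ∈ Metric.ball c χ.rIn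
    · have : h y = G y := by
        have := generator_cutoff (b := b) (σ := σ) (r := r) χ (u := u) m hyb hy
        rw [huG y hy, neg_neg] at this
        exact this
      rw [this, sub_self, abs_zero]
      exact mul_nonneg hC (hv0 y)
    · rw [hvb y hyb, mul_one]
      exact (abs_sub _ _).trans (add_le_add (hhb y) (hGb y hy))
  refine ⟨C, fun N hN => ?_⟩
  set ℓ : ℝ → ℝ := fun y => r y + N * v y with hℓdef
  have hℓ : Continuous ℓ := hr.add (continuous_const.mul hv)
  have hℓ0 : ∀ y, r₀ ≤ ℓ y := fun y => by
    have := mul_nonneg hN.le (hv0 y)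
    have := hr0 y
    simp only [hℓdef]; linarith
  have hℓb : ∀ y, ℓ y ≤ L + N := fun y => by
    have := mul_le_mul_of_nonneg_left (hv1 y) hN.le
    have := hrb y
    simp only [hℓdef]; linarith
  have hI := fun {F : ℝ → ℝ} (hF : ContinuousOn F (Ioi 0)) {C : ℝ} (hC : ∀ y, 0 < y → |F y| ≤ C) =>
    integrable_occ_of_bound (P := P) hY.measurable hY.continuous_paths hY.pos hℓ hr₀ hℓ0 hF hC
  have iv : Integrable v (occ P Y ℓ) := hI hv.continuousOn (C := 1) fun y _ => by
    rw [abs_of_nonneg (hv0 y)]; exact hv1 y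
  have iG : Integrable G (occ P Y ℓ) := hI hG hGb
  have ih : Integrable h (occ P Y ℓ) := hI hhc.continuousOn fun y _ => hhb y
  have ivf : Integrable (fun y => v y * (m + f y)) (occ P Y ℓ) :=
    hI (hv.mul (continuous_const.add hf.continuous)).continuousOn (C := 1 * (|m| + Cf)) fun y _ => by
      rw [abs_mul, abs_of_nonneg (hv0 y)]
      exact mul_le_mul (hv1 y) (hfb y) (abs_nonneg _) zero_le_one
  have iℓ : Integrable ℓ (occ P Y ℓ) := hI hℓ.continuousOn (C := L + N) fun y _ => by
    rw [abs_of_nonneg (hr₀.le.trans (hℓ0 y))]; exact hℓb y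
  -- The full potential integrates to `1` and dominates `N v`; this is the source of the rate `1 /
  -- N`.
  have hvN : N * ∫ y, v y ∂(occ P Y ℓ) ≤ 1 := by
    refine le_of_le_of_eq ?_ (integral_occ_self (P := P) hY.measurable hY.continuous_paths hY.pos
      hℓ hr₀ hℓ0 hℓb)
    rw [← integral_const_mul]
    refine integral_mono (iv.const_mul N) iℓ fun y => ?_
    have := hr₀.le.trans (hr0 y)
    simp only [hℓdef]; linarith
  have key := integral_occ_test hY hb hσ hℓ hr₀ hℓ0 hℓb hf hfc (tsupport_cutoff χ m hχ) m
  have hxu : m + f x = u x := by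
    have := (χ.eventuallyEq_one_of_mem_ball hx).eq_of_nhds
    simp [hfdef, this]
  have hsplit : ∫ y, (ℓ y * (m + f y) - generator b σ f y) ∂(occ P Y ℓ) =
      ∫ y, h y ∂(occ P Y ℓ) + N * ∫ y, v y * (m + f y) ∂(occ P Y ℓ) := by
    rw [← integral_const_mul, ← integral_add ih (ivf.const_mul N)]
    refine integral_congr_ae (ae_of_all _ fun y => ?_)
    simp only [hℓdef, hhdef]
    ring
  rw [hsplit, hxu] at key
  have hdiff : |∫ y, (h y - G y) ∂(occ P Y ℓ)| ≤ C * ∫ y, v y ∂(occ P Y ℓ) := by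
    rw [← integral_const_mul]
    refine (abs_integral_le_integral_abs).trans (integral_mono_ae (ih.sub iG).abs
      (iv.const_mul C) ?_)
    filter_upwards [ae_occ_pos hY.measurable hY.continuous_paths hY.pos] with y hy using hhG y hy
  rw [integral_sub ih iG] at hdiff
  have e : ∫ y, G y ∂(occ P Y ℓ) + N * ∫ y, v y * (m + f y) ∂(occ P Y ℓ) - u x =
      -(∫ y, h y ∂(occ P Y ℓ) - ∫ y, G y ∂(occ P Y ℓ)) := by linarith
  rw [e, abs_neg]
  refine hdiff.trans ?_
  rw [le_div_iff₀ hN, mul_assoc]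
  calc C * ((∫ y, v y ∂(occ P Y ℓ)) * N) ≤ C * 1 :=
        mul_le_mul_of_nonneg_left (by rwa [mul_comm]) hC
    _ = C := mul_one C

end Feynman

section Feynman

variable {Ω : Type*} [mΩ : MeasurableSpace Ω] {P : Measure Ω} {ℱ : Filtration ℝ≥0 mΩ}
  {Y : ℝ≥0 → Ω → ℝ} {b σ r : ℝ → ℝ} {x : ℝ}

/-- The penalized identity is applied twice. For `u` it leaves the error `N ∫ v χ u`, at most `Bu ·
N ∫ v` in absolute value. For `S`, with outer level `m`, the cut-off function is at least `m`
wherever `v` is nonzero, so `m · N ∫ v ≤ S x + 1`. -/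
lemma exists_potential_approx [IsProbabilityMeasure P] (hY : IsDiffusionFrom b σ P ℱ Y x)
    (hb : ContinuousOn b (Ici 0)) (hσ : ContinuousOn σ (Ici 0)) (hr : Continuous r)
    {r₀ L : ℝ} (hr₀ : 0 < r₀) (hr0 : ∀ x, r₀ ≤ r x) (hrb : ∀ x, r x ≤ L)
    {u G S : ℝ → ℝ} (hu : ContDiffOn ℝ 2 u (Ioi 0))
    (hG : ContinuousOn G (Ioi 0)) {B Bu : ℝ} (hGb : ∀ y, 0 < y → |G y| ≤ B)
    (hub : ∀ y, 0 < y → |u y| ≤ Bu)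
    (huG : ∀ y, 0 < y → opL b σ r u y = -G y) (hS : ContDiffOn ℝ 2 S (Ioi 0))
    (hSL : ∀ y, 0 < y → opL b σ r S y = 0) {a d m ε : ℝ} (ha : 0 < a) (had : a < d)
    (hx : x ∈ Icc a d) (hm : 0 < m) (hSm : ∀ y, 0 < y → y ∉ Icc a d → m ≤ S y) (hε : 0 < ε)
    (hε1 : ε ≤ 1) :
    ∃ ℓ : ℝ → ℝ, Continuous ℓ ∧ (∀ y, r₀ ≤ ℓ y) ∧ (∀ y ∈ Icc a d, ℓ y = r y) ∧
      |∫ y, G y ∂(occ P Y ℓ) - u x| ≤ ε + Bu * ((S x + 1) / m) := by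
  have hBu : 0 ≤ Bu := (abs_nonneg _).trans (hub 1 one_pos)
  set c := (a + d) / 2 with hc
  -- `χ₁` is `1` on `[a, d]` and vanishes before `χ₂` starts to fall, so `v = 1` wherever `χ₂` may
  -- differ from `1`. The support of `χ₂` begins at `a / 4 > 0`.
  let χ₁ : ContDiffBump c := ⟨(d - a) / 2, (d - a) / 2 + a / 4, by linarith, by linarith⟩
  let χ₂ : ContDiffBump c := ⟨(d - a) / 2 + a / 2, (d - a) / 2 + 3 * a / 4, by linarith, by linarith⟩
  have hcl : Metric.closedBall c χ₁.rIn = Icc a d := by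
    rw [Real.closedBall_eq_Icc]
    congr 1 <;> simp only [χ₁, hc] <;> ring
  have hχ : Metric.closedBall c χ₂.rOut ⊆ Ioi 0 := fun y hy => by
    rw [Real.closedBall_eq_Icc] at hy
    have := hy.1
    simp only [χ₂, hc] at this
    exact mem_Ioi.2 (by linarith)
  set v : ℝ → ℝ := fun y => 1 - χ₁ y with hv
  have hvc : Continuous v := continuous_const.sub χ₁.continuous
  have hv0 : ∀ y, 0 ≤ v y := fun y => sub_nonneg.2 χ₁.le_one
  have hv1 : ∀ y, v y ≤ 1 := fun y => sub_le_self _ χ₁.nonneg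
  have hvin : ∀ y ∈ Icc a d, v y = 0 := fun y hy => by
    rw [← hcl] at hy
    simp [hv, χ₁.one_of_mem_closedBall hy]
  have hvout : ∀ y ∉ Metric.ball c χ₂.rIn, v y = 1 := fun y hy => by
    have : χ₁ y = 0 := χ₁.zero_of_le_dist (by
      rw [Metric.mem_ball, not_lt] at hy
      refine le_trans ?_ hy
      simp only [χ₁, χ₂]; linarith)
    simp [hv, this]
  have hx0 : 0 < x := ha.trans_le hx.1
  have hxb : x ∈ Metric.ball c χ₂.rIn := by
    rw [← hcl] at hx
    refine Metric.closedBall_subset_ball ?_ hx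
    simp only [χ₁, χ₂]; linarith
  obtain ⟨C₁, h₁⟩ := exists_penalized_bound hY hb hσ hr hr₀ hr0 hrb χ₂ hχ hvc hv0 hv1 hvout hxb
    hu hG hGb huG 0
  obtain ⟨C₂, h₂⟩ := exists_penalized_bound hY hb hσ hr hr₀ hr0 hrb χ₂ hχ hvc hv0 hv1 hvout hxb
    hS (G := fun _ => 0) continuousOn_const (B := 0) (by simp) (by simpa using hSL) m
  -- Large enough for both errors to be at most `ε`; the summand `1` keeps `N` positive.
  set N := (|C₁| + |C₂| + 1) / ε with hN
  have hNpos : 0 < N := by positivity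
  have hCN : ∀ C, |C| ≤ |C₁| + |C₂| → C / N ≤ ε := fun C hC => by
    rw [div_le_iff₀ hNpos, hN, mul_div_cancel₀ _ hε.ne']
    linarith [le_abs_self C]
  have k₁ := (h₁ N hNpos).trans (hCN C₁ (by linarith [abs_nonneg C₂]))
  have k₂ := (h₂ N hNpos).trans (hCN C₂ (by linarith [abs_nonneg C₁]))
  set ℓ : ℝ → ℝ := fun y => r y + N * v y with hℓdef
  have hℓ : Continuous ℓ := hr.add (continuous_const.mul hvc)
  have hℓ0 : ∀ y, r₀ ≤ ℓ y := fun y => by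
    have := mul_nonneg hNpos.le (hv0 y)
    have := hr0 y
    simp only [hℓdef]; linarith
  refine ⟨ℓ, hℓ, hℓ0, fun y hy => by simp [hℓdef, hvin y hy], ?_⟩
  have hI := fun {F : ℝ → ℝ} (hF : ContinuousOn F (Ioi 0)) {C : ℝ} (hC : ∀ y, 0 < y → |F y| ≤ C) =>
    integrable_occ_of_bound (P := P) hY.measurable hY.continuous_paths hY.pos hℓ hr₀ hℓ0 hF hC
  have hpos : ∀ᵐ y ∂(occ P Y ℓ), y ∈ Ioi (0 : ℝ) :=
    ae_occ_pos hY.measurable hY.continuous_paths hY.pos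
  have iv : Integrable v (occ P Y ℓ) := hI hvc.continuousOn (C := 1) fun y _ => by
    rw [abs_of_nonneg (hv0 y)]; exact hv1 y
  have iS : Integrable (fun y => v y * (m + χ₂ y * (S y - m))) (occ P Y ℓ) := by
    have hcc := (contDiff_cutoff χ₂ m hS hχ).continuous
    obtain ⟨C, hC⟩ := hcc.bounded_above_of_compact_support (hasCompactSupport_cutoff χ₂ m)
    refine hI (hvc.mul (continuous_const.add hcc)).continuousOn (C := 1 * (|m| + C)) fun y _ => ?_
    rw [abs_mul, abs_of_nonneg (hv0 y)]
    exact mul_le_mul (hv1 y) ((abs_add_le _ _).trans (add_le_add le_rfl (hC y))) (abs_nonneg _)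
      zero_le_one
  have e1 : m * ∫ y, v y ∂(occ P Y ℓ) ≤ ∫ y, v y * (m + χ₂ y * (S y - m)) ∂(occ P Y ℓ) := by
    rw [← integral_const_mul]
    refine integral_mono_ae (iv.const_mul m) iS ?_
    filter_upwards [hpos] with y hy
    by_cases hyI : y ∈ Icc a d
    · simp [hvin y hyI]
    · have := mul_nonneg (hv0 y) (mul_nonneg (χ₂.nonneg' y) (sub_nonneg.2 (hSm y hy hyI)))
      linarith
  have e2 : |∫ y, v y * (0 + χ₂ y * (u y - 0)) ∂(occ P Y ℓ)| ≤ Bu * ∫ y, v y ∂(occ P Y ℓ) := by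
    rw [← integral_const_mul, ← Real.norm_eq_abs]
    refine norm_integral_le_of_norm_le (iv.const_mul Bu) ?_
    filter_upwards [hpos] with y hy
    rw [norm_mul, Real.norm_of_nonneg (hv0 y), zero_add, sub_zero, mul_comm, norm_mul,
      Real.norm_of_nonneg (χ₂.nonneg' y)]
    refine mul_le_mul_of_nonneg_right ?_ (hv0 y)
    calc χ₂ y * ‖u y‖ ≤ 1 * Bu :=
          mul_le_mul χ₂.le_one (hub y hy) (norm_nonneg _) zero_le_one
      _ = Bu := one_mul _
  rw [integral_zero, zero_add, abs_le] at k₂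
  rw [abs_le] at k₁ e2
  have e3 : N * ∫ y, v y ∂(occ P Y ℓ) ≤ (S x + 1) / m := by
    rw [le_div_iff₀ hm]
    have := mul_le_mul_of_nonneg_left e1 hNpos.le
    linarith [k₂.2]
  have e4 := mul_le_mul_of_nonneg_left e3 hBu
  have e5 := mul_le_mul_of_nonneg_left e2.1 hNpos.le
  have e6 := mul_le_mul_of_nonneg_left e2.2 hNpos.le
  rw [abs_le]
  constructor <;> linarith [k₁.1, k₁.2]

/-- Let the level `m` grow. As `S` is infinite at both ends, the sets where `S` may be below the
level are contained in compact intervals; the killed mass is of order `1 / m`, and the potentials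
agree with `r` on larger and larger intervals. -/
theorem integral_occ_eq_of_bounded [IsProbabilityMeasure P] (hY : IsDiffusionFrom b σ P ℱ Y x)
    (hx : 0 < x)
    (hb : ContinuousOn b (Ici 0)) (hσ : ContinuousOn σ (Ici 0)) (hr : Continuous r)
    {r₀ L : ℝ} (hr₀ : 0 < r₀) (hr0 : ∀ x, r₀ ≤ r x) (hrb : ∀ x, r x ≤ L)
    {u G S : ℝ → ℝ} (hu : ContDiffOn ℝ 2 u (Ioi 0))
    (hG : ContinuousOn G (Ioi 0)) {B Bu : ℝ} (hGb : ∀ y, 0 < y → |G y| ≤ B)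
    (hub : ∀ y, 0 < y → |u y| ≤ Bu)
    (huG : ∀ y, 0 < y → opL b σ r u y = -G y) (hS : ContDiffOn ℝ 2 S (Ioi 0))
    (hSL : ∀ y, 0 < y → opL b σ r S y = 0) (hS0 : Tendsto S (𝓝[>] 0) atTop)
    (hSi : Tendsto S atTop atTop) :
    ∫ y, G y ∂(occ P Y r) = u x := by
  have hstep : ∀ n : ℕ, ∃ ℓ : ℝ → ℝ, Continuous ℓ ∧ (∀ y, r₀ ≤ ℓ y) ∧
      (∀ y ∈ Icc (1 / ((n : ℝ) + 1)) n, ℓ y = r y) ∧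
      |∫ y, G y ∂(occ P Y ℓ) - u x| ≤ 1 / ((n : ℝ) + 1) + Bu * ((S x + 1) * (1 / ((n : ℝ) + 1))) := by
    intro n
    have hn : (0 : ℝ) < (n : ℝ) + 1 := by positivity
    obtain ⟨a', ha', h1⟩ := mem_nhdsGT_iff_exists_Ioo_subset.1 (hS0.eventually_ge_atTop ((n : ℝ) + 1))
    obtain ⟨d', h2⟩ := eventually_atTop.1 (hSi.eventually_ge_atTop ((n : ℝ) + 1))
    -- The interval must contain `x`, must contain `[1/(n+1), n]` to exhaust the half line, and must
    -- have `S ≥ n + 1` outside it. Halving `a'` stays inside the open interval where the last bound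
    -- is known.
    set a := min (a' / 2) (min x (1 / ((n : ℝ) + 1))) with ha
    set d := max d' (max (x + 1) n) with hd
    have ha0 : 0 < a := lt_min (half_pos ha') (lt_min hx (by positivity))
    have hax : a ≤ x := (min_le_right _ _).trans (min_le_left _ _)
    have hxd : x + 1 ≤ d := (le_max_left _ _).trans (le_max_right _ _)
    have hout : ∀ y, 0 < y → y ∉ Icc a d → (n : ℝ) + 1 ≤ S y := by
      intro y hy hyI
      by_cases hya : a ≤ y
      · have hyd : d < y := by
          by_contra h
          exact hyI ⟨hya, not_lt.1 h⟩
        exact h2 y ((le_max_left _ _).trans hyd.le)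
      · refine h1 ⟨hy, ?_⟩
        have := (not_le.1 hya).trans_le (min_le_left _ _)
        have ha'' : (0 : ℝ) < a' := ha'
        linarith
    obtain ⟨ℓ, k1, k2, k3, k4⟩ := exists_potential_approx hY hb hσ hr hr₀ hr0 hrb hu hG hGb hub huG
      hS hSL (a := a) (d := d) (m := (n : ℝ) + 1) (ε := 1 / ((n : ℝ) + 1)) ha0 (by linarith)
      ⟨hax, by linarith⟩ hn hout (by positivity)
      (by rw [div_le_one hn]; linarith [Nat.cast_nonneg (α := ℝ) n])
    refine ⟨ℓ, k1, k2, fun y hy => k3 y ⟨?_, ?_⟩, ?_⟩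
    · exact ((min_le_right _ _).trans (min_le_right _ _)).trans hy.1
    · exact hy.2.trans ((le_max_right _ _).trans (le_max_right _ _))
    · rwa [mul_one_div]
  choose ℓs h1 h2 h3 h4 using hstep
  have t1 := tendsto_integral_occ (P := P) (C := B) hY.measurable hY.continuous_paths hY.pos hr hr₀
    hr0 h1 h2 (fun a d ha => ?_) hG hGb
  · have hlim : Tendsto (fun n : ℕ => 1 / ((n : ℝ) + 1)) atTop (𝓝 0) :=
      tendsto_one_div_add_atTop_nhds_zero_nat
    have hz : Tendsto (fun n : ℕ => 1 / ((n : ℝ) + 1) + Bu * ((S x + 1) * (1 / ((n : ℝ) + 1))))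
        atTop (𝓝 (0 + Bu * ((S x + 1) * 0))) :=
      hlim.add ((hlim.const_mul _).const_mul _)
    simp only [mul_zero, add_zero] at hz
    have t2 : Tendsto (fun n => ∫ y, G y ∂(occ P Y (ℓs n)) - u x) atTop (𝓝 0) :=
      squeeze_zero_norm h4 hz
    have t3 := t1.sub_const (u x)
    have := tendsto_nhds_unique t3 t2
    linarith
  · have hlim : Tendsto (fun n : ℕ => 1 / ((n : ℝ) + 1)) atTop (𝓝 0) :=
      tendsto_one_div_add_atTop_nhds_zero_nat
    filter_upwards [hlim.eventually (Iio_mem_nhds ha),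
      tendsto_natCast_atTop_atTop.eventually_ge_atTop d] with n hn hd y hy
    exact h3 n y ⟨(le_of_lt hn).trans hy.1, hy.2.trans hd⟩

end Feynman

/-! ### Calculus on the half line -/

section Calculus

variable {f g g' u u' u'' : ℝ → ℝ} {x : ℝ}

lemma hasDerivAt_intervalIntegral_zero (hf : ContinuousOn f (Ioi 0)) (hx : 0 < x)
    (hi : IntegrableOn f (Ioc 0 x)) :
    HasDerivAt (fun y => ∫ t in (0 : ℝ)..y, f t) (f x) x :=
  intervalIntegral.integral_hasDerivAt_right
    ((intervalIntegrable_iff_integrableOn_Ioc_of_le hx.le).2 hi)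
    (hf.stronglyMeasurableAtFilter isOpen_Ioi x hx) (hf.continuousAt (Ioi_mem_nhds hx))

lemma hasDerivAt_integral_Ioc_zero (hf : ContinuousOn f (Ioi 0)) (hx : 0 < x)
    (hi : IntegrableOn f (Ioc 0 x)) :
    HasDerivAt (fun y => ∫ t in Ioc 0 y, f t) (f x) x := by
  refine (hasDerivAt_intervalIntegral_zero hf hx hi).congr_of_eventuallyEq ?_
  filter_upwards [Ioi_mem_nhds hx] with y hy
  rw [intervalIntegral.integral_of_le (le_of_lt hy)]

lemma integral_Ioi_eq_sub (hi : ∀ x, 0 < x → IntegrableOn f (Ioi x)) {a y : ℝ} (ha : 0 < a)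
    (hy : 0 < y) : ∫ t in Ioi y, f t = (∫ t in Ioi a, f t) - ∫ t in a..y, f t := by
  rw [← intervalIntegral.integral_interval_add_Ioi (hi a ha) (hi y hy)]
  ring

lemma hasDerivAt_integral_Ioi (hf : ContinuousOn f (Ioi 0)) (hx : 0 < x)
    (hi : ∀ x, 0 < x → IntegrableOn f (Ioi x)) :
    HasDerivAt (fun y => ∫ t in Ioi y, f t) (-f x) x := by
  have h : HasDerivAt (fun y => (∫ t in Ioi x, f t) - ∫ t in x..y, f t) (-f x) x :=
    (intervalIntegral.integral_hasDerivAt_right IntervalIntegrable.refl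
    (hf.stronglyMeasurableAtFilter isOpen_Ioi x hx) (hf.continuousAt (Ioi_mem_nhds hx))).const_sub _
  refine h.congr_of_eventuallyEq ?_
  filter_upwards [Ioi_mem_nhds hx] with y hy
  exact integral_Ioi_eq_sub hi hx hy

lemma tendsto_integral_Ioc_zero (hx : 0 < x) (hi : IntegrableOn f (Ioc 0 x)) :
    Tendsto (fun y => ∫ t in Ioc 0 y, f t) (𝓝[>] 0) (𝓝 0) := by
  have h := intervalIntegral.continuousOn_primitive (μ := volume) (f := f) (a := 0) (b := x)
    ((integrableOn_Icc_iff_integrableOn_Ioc).2 hi) 0 ⟨le_rfl, hx.le⟩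
  have h2 := h.tendsto
  simp only [Ioc_self, Measure.restrict_empty, integral_zero_measure] at h2
  refine h2.mono_left ?_
  rw [← nhdsWithin_Ioo_eq_nhdsGT hx]
  exact nhdsWithin_mono _ Ioo_subset_Icc_self

lemma tendsto_integral_Ioi_atTop (hi : ∀ x, 0 < x → IntegrableOn f (Ioi x)) :
    Tendsto (fun y => ∫ t in Ioi y, f t) atTop (𝓝 0) := by
  have h := (intervalIntegral_tendsto_integral_Ioi 1 (hi 1 one_pos) tendsto_id).const_sub
    (∫ t in Ioi 1, f t)
  rw [sub_self] at h
  refine h.congr' ?_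
  filter_upwards [Ioi_mem_atTop 0] with y hy
  exact (integral_Ioi_eq_sub hi one_pos hy).symm

lemma integral_eq_sub_of_hasDerivAt_Ioi (hg : ∀ x, 0 < x → HasDerivAt g (g' x) x)
    (hg' : ContinuousOn g' (Ioi 0)) {a y : ℝ} (ha : 0 < a) (hy : 0 < y) :
    ∫ t in a..y, g' t = g y - g a := by
  have hsub : uIcc a y ⊆ Ioi 0 := fun t ht => lt_of_lt_of_le (lt_min ha hy) ht.1
  exact intervalIntegral.integral_eq_sub_of_hasDerivAt (fun t ht => hg t (hsub ht))
    (hg'.mono hsub).intervalIntegrable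

lemma integrableOn_Ioc_of_Ioi (hg' : ContinuousOn g' (Ioi 0)) {a y : ℝ} (ha : 0 < a) :
    IntegrableOn g' (Ioc a y) :=
  ((hg'.mono fun _ ht => ha.trans_le ht.1).integrableOn_Icc (a := a) (b := y)).mono_set
    Ioc_subset_Icc_self

/-- The integrals `∫_ε^x g' = g x - g ε` are bounded by `g x`, and the integrand is nonnegative. No
limit of `g` at `0` is needed. -/
lemma integrableOn_Ioc_zero_of_deriv_nonneg (hg : ∀ x, 0 < x → HasDerivAt g (g' x) x)
    (hg' : ContinuousOn g' (Ioi 0)) (h0 : ∀ x, 0 < x → 0 ≤ g' x) (hg0 : ∀ x, 0 < x → 0 ≤ g x)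
    (hx : 0 < x) : IntegrableOn g' (Ioc 0 x) ∧ ∫ t in Ioc 0 x, g' t ≤ g x := by
  have hi : IntegrableOn g' (Ioc 0 x) := by
    refine integrableOn_Ioc_of_intervalIntegral_norm_bounded_left (l := atTop)
      (a := fun n : ℕ => x * (1 / ((n : ℝ) + 1))) (I := g x)
      (fun n => integrableOn_Ioc_of_Ioi hg' (by positivity)) ?_ (Eventually.of_forall fun n => ?_)
    · simpa using tendsto_one_div_add_atTop_nhds_zero_nat.const_mul x
    · have hpos : 0 < x * (1 / ((n : ℝ) + 1)) := by positivity
      have hle : x * (1 / ((n : ℝ) + 1)) ≤ x := by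
        refine mul_le_of_le_one_right hx.le ?_
        rw [div_le_one (by positivity)]
        linarith [Nat.cast_nonneg (α := ℝ) n]
      rw [setIntegral_congr_fun (g := g') measurableSet_Ioc fun t ht =>
        Real.norm_of_nonneg (h0 t (hpos.trans ht.1)), ← intervalIntegral.integral_of_le hle,
        integral_eq_sub_of_hasDerivAt_Ioi hg hg' hpos hx]
      linarith [hg0 _ hpos]
  refine ⟨hi, ?_⟩
  have ht := (tendsto_integral_Ioc_zero hx hi).const_sub (∫ t in Ioc 0 x, g' t)
  rw [sub_zero] at ht
  refine le_of_tendsto ht ?_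
  filter_upwards [Ioo_mem_nhdsGT hx] with y hy
  rw [← intervalIntegral.integral_of_le hx.le, ← intervalIntegral.integral_of_le hy.1.le,
    intervalIntegral.integral_interval_sub_left
      ((intervalIntegrable_iff_integrableOn_Ioc_of_le hx.le).2 hi)
      ((intervalIntegrable_iff_integrableOn_Ioc_of_le hy.1.le).2
        (hi.mono_set (Ioc_subset_Ioc_right hy.2.le))),
    integral_eq_sub_of_hasDerivAt_Ioi hg hg' hy.1 hx]
  linarith [hg0 y hy.1]

lemma integrableOn_Ioi_of_deriv_nonneg (hg : ∀ x, 0 < x → HasDerivAt g (g' x) x)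
    (hg' : ContinuousOn g' (Ioi 0)) (h0 : ∀ x, 0 < x → 0 ≤ g' x) (hg0 : ∀ x, 0 < x → g x ≤ 0)
    (hx : 0 < x) : IntegrableOn g' (Ioi x) ∧ ∫ t in Ioi x, g' t ≤ -g x := by
  have hb : ∀ y, x ≤ y → ∫ t in x..y, g' t ≤ -g x := fun y hy => by
    rw [integral_eq_sub_of_hasDerivAt_Ioi hg hg' hx (hx.trans_le hy)]
    linarith [hg0 y (hx.trans_le hy)]
  have hi : IntegrableOn g' (Ioi x) := by
    refine integrableOn_Ioi_of_intervalIntegral_norm_bounded (l := atTop) (b := id) (-g x) x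
      (fun y => integrableOn_Ioc_of_Ioi hg' hx) tendsto_id ?_
    filter_upwards [eventually_ge_atTop x] with y hy
    refine le_trans (le_of_eq ?_) (hb y hy)
    refine intervalIntegral.integral_congr fun t ht => ?_
    rw [id, uIcc_of_le hy] at ht
    exact Real.norm_of_nonneg (h0 t (hx.trans_le ht.1))
  refine ⟨hi, le_of_tendsto (intervalIntegral_tendsto_integral_Ioi x hi tendsto_id) ?_⟩
  filter_upwards [eventually_ge_atTop x] with y hy using hb y hy

lemma contDiffOn_one_of_hasDerivAt {s : Set ℝ} (hs : IsOpen s)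
    (h1 : ∀ x ∈ s, HasDerivAt u (u' x) x) (hc : ContinuousOn u' s) : ContDiffOn ℝ 1 u s := by
  rw [show (1 : WithTop ℕ∞) = 0 + 1 from rfl, contDiffOn_succ_iff_deriv_of_isOpen hs]
  refine ⟨fun x hx => (h1 x hx).differentiableAt.differentiableWithinAt, by simp, ?_⟩
  rw [contDiffOn_zero]
  exact hc.congr fun x hx => (h1 x hx).deriv

lemma contDiffOn_two_of_hasDerivAt {s : Set ℝ} (hs : IsOpen s)
    (h1 : ∀ x ∈ s, HasDerivAt u (u' x) x) (h2 : ∀ x ∈ s, HasDerivAt u' (u'' x) x)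
    (hc : ContinuousOn u'' s) : ContDiffOn ℝ 2 u s := by
  rw [show (2 : WithTop ℕ∞) = 1 + 1 from rfl, contDiffOn_succ_iff_deriv_of_isOpen hs]
  refine ⟨fun x hx => (h1 x hx).differentiableAt.differentiableWithinAt, by simp, ?_⟩
  exact (contDiffOn_one_of_hasDerivAt hs h2 hc).congr fun x hx => (h1 x hx).deriv

lemma deriv_deriv_eq_of_hasDerivAt (h1 : ∀ x, 0 < x → HasDerivAt u (u' x) x) (hx : 0 < x)
    (h2 : HasDerivAt u' (u'' x) x) : deriv (deriv u) x = u'' x := by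
  rw [← h2.deriv]
  refine EventuallyEq.deriv_eq ?_
  filter_upwards [Ioi_mem_nhds hx] with y hy using (h1 y hy).deriv

lemma hasDerivAt_of_contDiffOn (hu : ContDiffOn ℝ 2 u (Ioi 0)) (hx : 0 < x) :
    HasDerivAt u (deriv u x) x :=
  ((hu.contDiffAt (Ioi_mem_nhds hx)).differentiableAt (by simp)).hasDerivAt

lemma contDiffOn_deriv (hu : ContDiffOn ℝ 2 u (Ioi 0)) : ContDiffOn ℝ 1 (deriv u) (Ioi 0) :=
  hu.deriv_of_isOpen isOpen_Ioi (m := 1) le_rfl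

lemma hasDerivAt_deriv_of_contDiffOn (hu : ContDiffOn ℝ 2 u (Ioi 0)) (hx : 0 < x) :
    HasDerivAt (deriv u) (deriv (deriv u) x) x :=
  (((contDiffOn_deriv hu).contDiffAt (Ioi_mem_nhds hx)).differentiableAt (by simp)).hasDerivAt

end Calculus

/-! ### The Green kernel -/

/-- Standing regularity of the coefficients, the discounting rate and the fundamental solutions. -/
structure GreenData (b σ r φ ψ : ℝ → ℝ) : Prop where
  b_cont : ContinuousOn b (Ioi 0)
  σ_cont : ContinuousOn σ (Ioi 0)
  σ_pos : ∀ x, 0 < x → 0 < σ x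
  r_cont : ContinuousOn r (Ioi 0)
  r_lower : ∃ r₀, 0 < r₀ ∧ ∀ x, 0 < x → r₀ ≤ r x
  fund : FundamentalSolutions b σ r φ ψ

/-- The Wronskian `φ ψ' - φ' ψ`. -/
noncomputable def wronskian (φ ψ : ℝ → ℝ) (x : ℝ) : ℝ := φ x * deriv ψ x - deriv φ x * ψ x

/-- The density `2 / (σ² W)`. -/
noncomputable def weight (σ φ ψ : ℝ → ℝ) (x : ℝ) : ℝ := 2 / (σ x ^ 2 * wronskian φ ψ x)

/-- `∫_0^x ψ F q`. -/
noncomputable def lowerInt (σ φ ψ F : ℝ → ℝ) (x : ℝ) : ℝ :=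
  ∫ y in Ioc 0 x, ψ y * (F y * weight σ φ ψ y)

/-- `∫_x^∞ φ F q`. -/
noncomputable def upperInt (σ φ ψ F : ℝ → ℝ) (x : ℝ) : ℝ :=
  ∫ y in Ioi x, φ y * (F y * weight σ φ ψ y)

/-- `φ(x) ∫_0^x ψ F q + ψ(x) ∫_x^∞ φ F q`. -/
noncomputable def greenSol (σ φ ψ F : ℝ → ℝ) (x : ℝ) : ℝ :=
  φ x * lowerInt σ φ ψ F x + ψ x * upperInt σ φ ψ F x

/-- Convergence of the two integrals in `greenSol`. -/
def GreenIntegrable (σ φ ψ F : ℝ → ℝ) : Prop :=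
  ∀ x, 0 < x → IntegrableOn (fun y => ψ y * (F y * weight σ φ ψ y)) (Ioc 0 x) ∧
    IntegrableOn (fun y => φ y * (F y * weight σ φ ψ y)) (Ioi x)

namespace GreenData

variable {b σ r φ ψ : ℝ → ℝ} {x : ℝ}

lemma r_pos (H : GreenData b σ r φ ψ) (hx : 0 < x) : 0 < r x := by
  obtain ⟨r₀, h0, h⟩ := H.r_lower
  exact h0.trans_le (h x hx)

lemma deriv_deriv (H : GreenData b σ r φ ψ) {u : ℝ → ℝ} (hx : 0 < x) (hu : opL b σ r u x = 0) :
    deriv (deriv u) x = 2 / σ x ^ 2 * (r x * u x - b x * deriv u x) := by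
  have hσ := H.σ_pos x hx
  rw [opL] at hu
  field_simp
  linarith

lemma wronskian_pos (H : GreenData b σ r φ ψ) (hx : 0 < x) : 0 < wronskian φ ψ x := by
  have h1 := mul_pos (H.fund.φ_pos x hx) (H.fund.ψ_incr x hx)
  have h2 := mul_pos_of_neg_of_neg (H.fund.φ_decr x hx) (neg_neg_of_pos (H.fund.ψ_pos x hx))
  rw [wronskian]
  linarith

lemma weight_pos (H : GreenData b σ r φ ψ) (hx : 0 < x) : 0 < weight σ φ ψ x :=
  div_pos two_pos (mul_pos (pow_pos (H.σ_pos x hx) 2) (H.wronskian_pos hx))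

lemma hasDerivAt_φ (H : GreenData b σ r φ ψ) (hx : 0 < x) : HasDerivAt φ (deriv φ x) x :=
  hasDerivAt_of_contDiffOn H.fund.φ_smooth hx

lemma hasDerivAt_ψ (H : GreenData b σ r φ ψ) (hx : 0 < x) : HasDerivAt ψ (deriv ψ x) x :=
  hasDerivAt_of_contDiffOn H.fund.ψ_smooth hx

lemma hasDerivAt_deriv_φ (H : GreenData b σ r φ ψ) (hx : 0 < x) :
    HasDerivAt (deriv φ) (2 / σ x ^ 2 * (r x * φ x - b x * deriv φ x)) x := by
  rw [← H.deriv_deriv hx (H.fund.φ_ode x hx)]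
  exact hasDerivAt_deriv_of_contDiffOn H.fund.φ_smooth hx

lemma hasDerivAt_deriv_ψ (H : GreenData b σ r φ ψ) (hx : 0 < x) :
    HasDerivAt (deriv ψ) (2 / σ x ^ 2 * (r x * ψ x - b x * deriv ψ x)) x := by
  rw [← H.deriv_deriv hx (H.fund.ψ_ode x hx)]
  exact hasDerivAt_deriv_of_contDiffOn H.fund.ψ_smooth hx

lemma cont_φ (H : GreenData b σ r φ ψ) : ContinuousOn φ (Ioi 0) := H.fund.φ_smooth.continuousOn

lemma cont_ψ (H : GreenData b σ r φ ψ) : ContinuousOn ψ (Ioi 0) := H.fund.ψ_smooth.continuousOn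

lemma cont_deriv_φ (H : GreenData b σ r φ ψ) : ContinuousOn (deriv φ) (Ioi 0) :=
  (contDiffOn_deriv H.fund.φ_smooth).continuousOn

lemma cont_deriv_ψ (H : GreenData b σ r φ ψ) : ContinuousOn (deriv ψ) (Ioi 0) :=
  (contDiffOn_deriv H.fund.ψ_smooth).continuousOn

lemma cont_wronskian (H : GreenData b σ r φ ψ) : ContinuousOn (wronskian φ ψ) (Ioi 0) :=
  (H.cont_φ.mul H.cont_deriv_ψ).sub (H.cont_deriv_φ.mul H.cont_ψ)

lemma cont_weight (H : GreenData b σ r φ ψ) : ContinuousOn (weight σ φ ψ) (Ioi 0) :=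
  continuousOn_const.div ((H.σ_cont.pow 2).mul H.cont_wronskian) fun x hx =>
    (mul_pos (pow_pos (H.σ_pos x hx) 2) (H.wronskian_pos hx)).ne'

lemma mono_ψ (H : GreenData b σ r φ ψ) : StrictMonoOn ψ (Ioi 0) :=
  strictMonoOn_of_deriv_pos (convex_Ioi 0) H.cont_ψ fun x hx => by
    rw [interior_Ioi] at hx; exact H.fund.ψ_incr x hx

lemma anti_φ (H : GreenData b σ r φ ψ) : StrictAntiOn φ (Ioi 0) :=
  strictAntiOn_of_deriv_neg (convex_Ioi 0) H.cont_φ fun x hx => by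
    rw [interior_Ioi] at hx; exact H.fund.φ_decr x hx

/-- Abel's identity. It is stated for arbitrary solutions so that quotients of Wronskians can later
be recognized as constants. -/
lemma hasDerivAt_wronskian_of (H : GreenData b σ r φ ψ) {u v : ℝ → ℝ} (hx : 0 < x)
    (hu : ContDiffOn ℝ 2 u (Ioi 0)) (hv : ContDiffOn ℝ 2 v (Ioi 0)) (hu0 : opL b σ r u x = 0)
    (hv0 : opL b σ r v x = 0) :
    HasDerivAt (wronskian u v) (-(2 * b x / σ x ^ 2) * wronskian u v x) x := by
  have h := ((hasDerivAt_of_contDiffOn hu hx).mul (hasDerivAt_deriv_of_contDiffOn hv hx)).sub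
    ((hasDerivAt_deriv_of_contDiffOn hu hx).mul (hasDerivAt_of_contDiffOn hv hx))
  refine HasDerivAt.congr_deriv (f := wronskian u v) h ?_
  rw [H.deriv_deriv hx hu0, H.deriv_deriv hx hv0, wronskian]
  ring

lemma hasDerivAt_wronskian (H : GreenData b σ r φ ψ) (hx : 0 < x) :
    HasDerivAt (wronskian φ ψ) (-(2 * b x / σ x ^ 2) * wronskian φ ψ x) x :=
  H.hasDerivAt_wronskian_of hx H.fund.φ_smooth H.fund.ψ_smooth (H.fund.φ_ode x hx)
    (H.fund.ψ_ode x hx)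

/-- Division by the Wronskian removes the drift term and puts the equation in divergence form, which
makes `ψ r q` an exact derivative. -/
lemma hasDerivAt_deriv_ψ_div (H : GreenData b σ r φ ψ) (hx : 0 < x) :
    HasDerivAt (fun y => deriv ψ y / wronskian φ ψ y) (ψ x * (r x * weight σ φ ψ x)) x := by
  have hW := (H.wronskian_pos hx).ne'
  have hσ := (H.σ_pos x hx).ne'
  refine ((H.hasDerivAt_deriv_ψ hx).div (H.hasDerivAt_wronskian hx) hW).congr_deriv ?_
  rw [weight]
  field_simp
  ring

lemma hasDerivAt_deriv_φ_div (H : GreenData b σ r φ ψ) (hx : 0 < x) :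
    HasDerivAt (fun y => deriv φ y / wronskian φ ψ y) (φ x * (r x * weight σ φ ψ x)) x := by
  have hW := (H.wronskian_pos hx).ne'
  have hσ := (H.σ_pos x hx).ne'
  refine ((H.hasDerivAt_deriv_φ hx).div (H.hasDerivAt_wronskian hx) hW).congr_deriv ?_
  rw [weight]
  field_simp
  ring

lemma cont_ψ_mul (H : GreenData b σ r φ ψ) {F : ℝ → ℝ} (hF : ContinuousOn F (Ioi 0)) :
    ContinuousOn (fun y => ψ y * (F y * weight σ φ ψ y)) (Ioi 0) :=
  H.cont_ψ.mul (hF.mul H.cont_weight)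

lemma cont_φ_mul (H : GreenData b σ r φ ψ) {F : ℝ → ℝ} (hF : ContinuousOn F (Ioi 0)) :
    ContinuousOn (fun y => φ y * (F y * weight σ φ ψ y)) (Ioi 0) :=
  H.cont_φ.mul (hF.mul H.cont_weight)

/-- Only an inequality at this stage: the limit of `ψ' / W` at `0` is known to be nonnegative but
not yet to vanish. Equality comes from `R_r = 1` in `lowerInt_r_eq`. -/
lemma lower_r (H : GreenData b σ r φ ψ) (hx : 0 < x) :
    IntegrableOn (fun y => ψ y * (r y * weight σ φ ψ y)) (Ioc 0 x) ∧
      lowerInt σ φ ψ r x ≤ deriv ψ x / wronskian φ ψ x :=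
  integrableOn_Ioc_zero_of_deriv_nonneg (fun _ hy => H.hasDerivAt_deriv_ψ_div hy)
    (H.cont_ψ_mul H.r_cont)
    (fun y hy => (mul_pos (H.fund.ψ_pos y hy) (mul_pos (H.r_pos hy) (H.weight_pos hy))).le)
    (fun y hy => (div_pos (H.fund.ψ_incr y hy) (H.wronskian_pos hy)).le) hx

lemma upper_r (H : GreenData b σ r φ ψ) (hx : 0 < x) :
    IntegrableOn (fun y => φ y * (r y * weight σ φ ψ y)) (Ioi x) ∧
      upperInt σ φ ψ r x ≤ -(deriv φ x / wronskian φ ψ x) :=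
  integrableOn_Ioi_of_deriv_nonneg (fun _ hy => H.hasDerivAt_deriv_φ_div hy)
    (H.cont_φ_mul H.r_cont)
    (fun y hy => (mul_pos (H.fund.φ_pos y hy) (mul_pos (H.r_pos hy) (H.weight_pos hy))).le)
    (fun y hy => (div_neg_of_neg_of_pos (H.fund.φ_decr y hy) (H.wronskian_pos hy)).le) hx

lemma hasDerivAt_lowerInt (H : GreenData b σ r φ ψ) {F : ℝ → ℝ} (hF : ContinuousOn F (Ioi 0))
    (hi : GreenIntegrable σ φ ψ F) (hx : 0 < x) :
    HasDerivAt (lowerInt σ φ ψ F) (ψ x * (F x * weight σ φ ψ x)) x :=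
  hasDerivAt_integral_Ioc_zero (H.cont_ψ_mul hF) hx (hi x hx).1

lemma hasDerivAt_upperInt (H : GreenData b σ r φ ψ) {F : ℝ → ℝ} (hF : ContinuousOn F (Ioi 0))
    (hi : GreenIntegrable σ φ ψ F) (hx : 0 < x) :
    HasDerivAt (upperInt σ φ ψ F) (-(φ x * (F x * weight σ φ ψ x))) x :=
  hasDerivAt_integral_Ioi (H.cont_φ_mul hF) hx fun y hy => (hi y hy).2

/-- Differentiating the two integrals produces `φ ψ F q` with opposite signs, as in variation of
constants. -/
lemma hasDerivAt_greenSol (H : GreenData b σ r φ ψ) {F : ℝ → ℝ} (hF : ContinuousOn F (Ioi 0))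
    (hi : GreenIntegrable σ φ ψ F) (hx : 0 < x) :
    HasDerivAt (greenSol σ φ ψ F)
      (deriv φ x * lowerInt σ φ ψ F x + deriv ψ x * upperInt σ φ ψ F x) x := by
  refine HasDerivAt.congr_deriv (f := greenSol σ φ ψ F)
    (((H.hasDerivAt_φ hx).mul (H.hasDerivAt_lowerInt hF hi hx)).add
      ((H.hasDerivAt_ψ hx).mul (H.hasDerivAt_upperInt hF hi hx))) ?_
  ring

lemma hasDerivAt_deriv_greenSol (H : GreenData b σ r φ ψ) {F : ℝ → ℝ}
    (hF : ContinuousOn F (Ioi 0)) (hi : GreenIntegrable σ φ ψ F) (hx : 0 < x) :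
    HasDerivAt (fun y => deriv φ y * lowerInt σ φ ψ F y + deriv ψ y * upperInt σ φ ψ F y)
      (2 / σ x ^ 2 * (r x * greenSol σ φ ψ F x
        - b x * (deriv φ x * lowerInt σ φ ψ F x + deriv ψ x * upperInt σ φ ψ F x) - F x)) x := by
  have hW := (H.wronskian_pos hx).ne'
  have hσ := (H.σ_pos x hx).ne'
  refine (((H.hasDerivAt_deriv_φ hx).mul (H.hasDerivAt_lowerInt hF hi hx)).add
      ((H.hasDerivAt_deriv_ψ hx).mul (H.hasDerivAt_upperInt hF hi hx))).congr_deriv ?_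
  -- At second order the contributions of the integrals no longer cancel: they leave `-W q F`, the
  -- source term.
  have e : deriv φ x * (ψ x * (F x * weight σ φ ψ x)) -
      deriv ψ x * (φ x * (F x * weight σ φ ψ x)) = -(2 / σ x ^ 2 * F x) := by
    have : deriv φ x * (ψ x * (F x * weight σ φ ψ x)) -
      deriv ψ x * (φ x * (F x * weight σ φ ψ x)) =
        -(wronskian φ ψ x * weight σ φ ψ x * F x) := by rw [wronskian]; ring
    rw [this, weight]
    field_simp
  rw [greenSol]
  linear_combination e

lemma cont_lowerInt (H : GreenData b σ r φ ψ) {F : ℝ → ℝ} (hF : ContinuousOn F (Ioi 0))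
    (hi : GreenIntegrable σ φ ψ F) : ContinuousOn (lowerInt σ φ ψ F) (Ioi 0) := fun _ hx =>
  (H.hasDerivAt_lowerInt hF hi hx).continuousAt.continuousWithinAt

lemma cont_upperInt (H : GreenData b σ r φ ψ) {F : ℝ → ℝ} (hF : ContinuousOn F (Ioi 0))
    (hi : GreenIntegrable σ φ ψ F) : ContinuousOn (upperInt σ φ ψ F) (Ioi 0) := fun _ hx =>
  (H.hasDerivAt_upperInt hF hi hx).continuousAt.continuousWithinAt

lemma contDiffOn_greenSol (H : GreenData b σ r φ ψ) {F : ℝ → ℝ} (hF : ContinuousOn F (Ioi 0))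
    (hi : GreenIntegrable σ φ ψ F) : ContDiffOn ℝ 2 (greenSol σ φ ψ F) (Ioi 0) := by
  refine contDiffOn_two_of_hasDerivAt isOpen_Ioi (fun x hx => H.hasDerivAt_greenSol hF hi hx)
    (fun x hx => H.hasDerivAt_deriv_greenSol hF hi hx) ?_
  have hl := H.cont_lowerInt hF hi
  have hu := H.cont_upperInt hF hi
  refine (continuousOn_const.div (H.σ_cont.pow 2) fun x hx => (pow_pos (H.σ_pos x hx) 2).ne').mul ?_
  exact ((H.r_cont.mul ((H.cont_φ.mul hl).add (H.cont_ψ.mul hu))).sub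
    (H.b_cont.mul ((H.cont_deriv_φ.mul hl).add (H.cont_deriv_ψ.mul hu)))).sub hF

lemma opL_greenSol (H : GreenData b σ r φ ψ) {F : ℝ → ℝ} (hF : ContinuousOn F (Ioi 0))
    (hi : GreenIntegrable σ φ ψ F) (hx : 0 < x) : opL b σ r (greenSol σ φ ψ F) x = -F x := by
  have hσ := (H.σ_pos x hx).ne'
  rw [opL, deriv_deriv_eq_of_hasDerivAt (u'' := fun x => 2 / σ x ^ 2 * (r x * greenSol σ φ ψ F x
        - b x * (deriv φ x * lowerInt σ φ ψ F x + deriv ψ x * upperInt σ φ ψ F x) - F x))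
      (fun y hy => H.hasDerivAt_greenSol hF hi hy) hx (H.hasDerivAt_deriv_greenSol hF hi hx),
    (H.hasDerivAt_greenSol hF hi hx).deriv]
  field_simp
  ring

/-- A bounded right-hand side is admissible, and gives a bounded solution. -/
lemma greenIntegrable_of_bound (H : GreenData b σ r φ ψ) {F : ℝ → ℝ}
    (hF : ContinuousOn F (Ioi 0)) {C : ℝ} (hC : ∀ x, 0 < x → |F x| ≤ C) :
    GreenIntegrable σ φ ψ F ∧ ∃ B, ∀ x, 0 < x → |greenSol σ φ ψ F x| ≤ B := by
  obtain ⟨r₀, hr₀, hr⟩ := H.r_lower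
  have hC0 : 0 ≤ C := (abs_nonneg _).trans (hC 1 one_pos)
  -- All bounds come from comparison with the right-hand side `r`, whose integrals are explicit; the
  -- two Wronskian terms then add up to the constant `C / r₀`.
  have hFr : ∀ x, 0 < x → |F x| ≤ C / r₀ * r x := fun x hx => by
    rw [div_mul_eq_mul_div, le_div_iff₀ hr₀]
    exact mul_le_mul (hC x hx) (hr x hx) hr₀.le hC0
  have hb : ∀ {χ : ℝ → ℝ} {y : ℝ}, 0 < y → 0 < χ y → ‖χ y * (F y * weight σ φ ψ y)‖ ≤
      C / r₀ * (χ y * (r y * weight σ φ ψ y)) := fun {χ y} hy hχ => by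
    have hw := H.weight_pos hy
    rw [norm_mul, norm_mul, Real.norm_of_nonneg hχ.le, Real.norm_of_nonneg hw.le]
    have := mul_le_mul_of_nonneg_left (mul_le_mul_of_nonneg_right (hFr y hy) hw.le) hχ.le
    rw [Real.norm_eq_abs]
    linarith
  have i1 : ∀ x, 0 < x → IntegrableOn (fun y => ψ y * (F y * weight σ φ ψ y)) (Ioc 0 x) :=
    fun x hx => by
      refine Integrable.mono' ((H.lower_r hx).1.const_mul (C / r₀))
        (((H.cont_ψ_mul hF).mono fun y hy => hy.1).aestronglyMeasurable measurableSet_Ioc) ?_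
      filter_upwards [ae_restrict_mem measurableSet_Ioc] with y hy
      exact hb hy.1 (H.fund.ψ_pos y hy.1)
  have i2 : ∀ x, 0 < x → IntegrableOn (fun y => φ y * (F y * weight σ φ ψ y)) (Ioi x) :=
    fun x hx => by
      refine Integrable.mono' ((H.upper_r hx).1.const_mul (C / r₀))
        (((H.cont_φ_mul hF).mono fun y hy => hx.trans hy).aestronglyMeasurable measurableSet_Ioi) ?_
      filter_upwards [ae_restrict_mem measurableSet_Ioi] with y hy
      exact hb (hx.trans hy) (H.fund.φ_pos y (hx.trans hy))
  refine ⟨fun x hx => ⟨i1 x hx, i2 x hx⟩, C / r₀, fun x hx => ?_⟩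
  have hφ := H.fund.φ_pos x hx
  have hψ := H.fund.ψ_pos x hx
  have hW := H.wronskian_pos hx
  have hCr : 0 ≤ C / r₀ := div_nonneg hC0 hr₀.le
  have l1 : |lowerInt σ φ ψ F x| ≤ C / r₀ * (deriv ψ x / wronskian φ ψ x) := by
    refine le_trans ?_ (mul_le_mul_of_nonneg_left (H.lower_r hx).2 hCr)
    rw [lowerInt, lowerInt, ← integral_const_mul, ← Real.norm_eq_abs]
    refine norm_integral_le_of_norm_le ((H.lower_r hx).1.const_mul (C / r₀)) ?_
    filter_upwards [ae_restrict_mem measurableSet_Ioc] with y hy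
    exact hb hy.1 (H.fund.ψ_pos y hy.1)
  have l2 : |upperInt σ φ ψ F x| ≤ C / r₀ * -(deriv φ x / wronskian φ ψ x) := by
    refine le_trans ?_ (mul_le_mul_of_nonneg_left (H.upper_r hx).2 hCr)
    rw [upperInt, upperInt, ← integral_const_mul, ← Real.norm_eq_abs]
    refine norm_integral_le_of_norm_le ((H.upper_r hx).1.const_mul (C / r₀)) ?_
    filter_upwards [ae_restrict_mem measurableSet_Ioi] with y hy
    exact hb (hx.trans hy) (H.fund.φ_pos y (hx.trans hy))
  calc |greenSol σ φ ψ F x| ≤ φ x * |lowerInt σ φ ψ F x| + ψ x * |upperInt σ φ ψ F x| := by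
        refine (abs_add_le _ _).trans (le_of_eq ?_)
        rw [abs_mul, abs_mul, abs_of_pos hφ, abs_of_pos hψ]
    _ ≤ φ x * (C / r₀ * (deriv ψ x / wronskian φ ψ x)) +
        ψ x * (C / r₀ * -(deriv φ x / wronskian φ ψ x)) := by gcongr
    _ = C / r₀ * (wronskian φ ψ x / wronskian φ ψ x) := by
        conv_rhs => enter [2, 1]; rw [wronskian]
        ring
    _ = C / r₀ := by rw [div_self hW.ne', mul_one]

end GreenData

/-- The Green kernel. -/
noncomputable def greenKernel (σ φ ψ : ℝ → ℝ) (x y : ℝ) : ℝ :=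
  φ (max x y) * ψ (min x y) * weight σ φ ψ y

/-- The measure on `]0, ∞[` whose density is the Green kernel. -/
noncomputable def greenMeasure (σ φ ψ : ℝ → ℝ) (x : ℝ) : Measure ℝ :=
  (volume.restrict (Ioi 0)).withDensity fun y => ENNReal.ofReal (greenKernel σ φ ψ x y)

namespace GreenData

variable {b σ r φ ψ F : ℝ → ℝ} {x : ℝ}

lemma greenKernel_pos (H : GreenData b σ r φ ψ) (hx : 0 < x) {y : ℝ} (hy : 0 < y) :
    0 < greenKernel σ φ ψ x y :=
  mul_pos (mul_pos (H.fund.φ_pos _ (hx.trans_le (le_max_left _ _)))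
    (H.fund.ψ_pos _ (lt_min hx hy))) (H.weight_pos hy)

lemma cont_greenKernel (H : GreenData b σ r φ ψ) (hx : 0 < x) :
    ContinuousOn (greenKernel σ φ ψ x) (Ioi 0) :=
  ((H.cont_φ.comp (continuous_const.max continuous_id).continuousOn
    fun _ _ => hx.trans_le (le_max_left _ _)).mul
    (H.cont_ψ.comp (continuous_const.min continuous_id).continuousOn
      fun _ hy => lt_min hx hy)).mul H.cont_weight

lemma aemeasurable_greenKernel (H : GreenData b σ r φ ψ) (hx : 0 < x) :
    AEMeasurable (fun y => ENNReal.ofReal (greenKernel σ φ ψ x y)) (volume.restrict (Ioi 0)) :=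
  ((H.cont_greenKernel hx).aemeasurable measurableSet_Ioi).ennreal_ofReal

lemma toReal_greenKernel (H : GreenData b σ r φ ψ) (hx : 0 < x) (F : ℝ → ℝ) :
    (fun y => (ENNReal.ofReal (greenKernel σ φ ψ x y)).toReal • F y) =ᵐ[volume.restrict (Ioi 0)]
      fun y => greenKernel σ φ ψ x y * F y := by
  filter_upwards [ae_restrict_mem measurableSet_Ioi] with y hy
  rw [ENNReal.toReal_ofReal (H.greenKernel_pos hx hy).le, smul_eq_mul]

lemma integrable_greenMeasure_iff (H : GreenData b σ r φ ψ) (hx : 0 < x) :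
    Integrable F (greenMeasure σ φ ψ x) ↔
      IntegrableOn (fun y => greenKernel σ φ ψ x y * F y) (Ioi 0) := by
  rw [greenMeasure, integrable_withDensity_iff_integrable_smul₀' (H.aemeasurable_greenKernel hx)
    (ae_of_all _ fun _ => ENNReal.ofReal_lt_top)]
  exact integrable_congr (H.toReal_greenKernel hx F)

lemma integral_greenMeasure (H : GreenData b σ r φ ψ) (hx : 0 < x) :
    ∫ y, F y ∂(greenMeasure σ φ ψ x) = ∫ y in Ioi 0, greenKernel σ φ ψ x y * F y := by
  rw [greenMeasure, integral_withDensity_eq_integral_toReal_smul₀ (H.aemeasurable_greenKernel hx)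
    (ae_of_all _ fun _ => ENNReal.ofReal_lt_top)]
  exact integral_congr_ae (H.toReal_greenKernel hx F)

lemma greenKernel_lower {y : ℝ} (hy : y ∈ Ioc 0 x) :
    greenKernel σ φ ψ x y * F y = φ x * (ψ y * (F y * weight σ φ ψ y)) := by
  rw [greenKernel, max_eq_left hy.2, min_eq_right hy.2]
  ring

lemma greenKernel_upper {y : ℝ} (hy : y ∈ Ioi x) :
    greenKernel σ φ ψ x y * F y = ψ x * (φ y * (F y * weight σ φ ψ y)) := by
  rw [greenKernel, max_eq_right (le_of_lt hy), min_eq_left (le_of_lt hy)]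
  ring

lemma integrable_greenMeasure_iff' (H : GreenData b σ r φ ψ) (hx : 0 < x) :
    Integrable F (greenMeasure σ φ ψ x) ↔
      IntegrableOn (fun y => ψ y * (F y * weight σ φ ψ y)) (Ioc 0 x) ∧
      IntegrableOn (fun y => φ y * (F y * weight σ φ ψ y)) (Ioi x) := by
  rw [H.integrable_greenMeasure_iff hx, ← Ioc_union_Ioi_eq_Ioi hx.le, integrableOn_union,
    integrableOn_congr_fun (fun _ hy => greenKernel_lower hy) measurableSet_Ioc,
    integrableOn_congr_fun (fun _ hy => greenKernel_upper hy) measurableSet_Ioi,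
    IntegrableOn, IntegrableOn, IntegrableOn, IntegrableOn,
    integrable_const_mul_iff (H.fund.φ_pos x hx).ne'.isUnit,
    integrable_const_mul_iff (H.fund.ψ_pos x hx).ne'.isUnit]

lemma integral_greenMeasure_eq (H : GreenData b σ r φ ψ) (hx : 0 < x)
    (hi : Integrable F (greenMeasure σ φ ψ x)) :
    ∫ y, F y ∂(greenMeasure σ φ ψ x) = greenSol σ φ ψ F x := by
  have hk := (H.integrable_greenMeasure_iff hx).1 hi
  rw [← Ioc_union_Ioi_eq_Ioi hx.le, integrableOn_union] at hk
  rw [H.integral_greenMeasure hx, ← Ioc_union_Ioi_eq_Ioi hx.le,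
    setIntegral_union (Ioc_disjoint_Ioi le_rfl) measurableSet_Ioi hk.1 hk.2,
    setIntegral_congr_fun measurableSet_Ioc (fun _ hy => greenKernel_lower hy),
    setIntegral_congr_fun measurableSet_Ioi (fun _ hy => greenKernel_upper hy),
    integral_const_mul, integral_const_mul]
  rfl

end GreenData

lemma greenData_of (b σ r φ ψ : ℝ → ℝ) (hcoef : CoefficientAssumption b σ)
    (hr : DiscountAssumption r) (hfund : FundamentalSolutions b σ r φ ψ) :
    GreenData b σ r φ ψ where
  b_cont := hcoef.b_lip.continuousOn.mono Ioi_subset_Ici_self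
  σ_cont := hcoef.σ_lip.continuousOn.mono Ioi_subset_Ici_self
  σ_pos := hcoef.σ_pos
  r_cont := hr.cont.mono Ioi_subset_Ici_self
  r_lower := by
    obtain ⟨r₀, h0, h⟩ := hr.lower
    exact ⟨r₀, h0, fun x hx => h x hx.le⟩
  fund := hfund

/-! ### Identification of the resolvent with the Green operator. -/

section Representation

variable {Ω : Type*} [mΩ : MeasurableSpace Ω] {P : Measure Ω} {ℱ : Filtration ℝ≥0 mΩ}
  {Y : ℝ≥0 → Ω → ℝ} {b σ r φ ψ : ℝ → ℝ} {x : ℝ}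

/-- The discounted occupation measure of the diffusion has the Green kernel as its density. -/
theorem occ_eq_greenMeasure [IsProbabilityMeasure P] (hY : IsDiffusionFrom b σ P ℱ Y x)
    (hx : 0 < x) (hcoef : CoefficientAssumption b σ) (hr : DiscountAssumption r)
    (hfund : FundamentalSolutions b σ r φ ψ) :
    occ P Y (fun y => r (max y 0)) = greenMeasure σ φ ψ x := by
  have H := greenData_of b σ r φ ψ hcoef hr hfund
  obtain ⟨r₀, hr₀, hr0⟩ := hr.lower
  obtain ⟨L, hL⟩ := hr.bdd
  have hrc : Continuous fun y => r (max y 0) := continuous_comp_max_zero hr.cont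
  have hr0' : ∀ y, r₀ ≤ r (max y 0) := fun y => hr0 _ (le_max_right _ _)
  have hL' : ∀ y, r (max y 0) ≤ L := fun y => hL _ (le_max_right _ _)
  have hop : ∀ u y, 0 < y → opL b σ (fun y => r (max y 0)) u y = opL b σ r u y := fun u y hy => by
    simp only [opL, max_eq_left hy.le]
  have hfin := isFiniteMeasure_occ (P := P) hY.measurable hY.continuous_paths hrc hr₀ hr0'
  have hfin' : IsFiniteMeasure (greenMeasure σ φ ψ x) := by
    have := (H.integrable_greenMeasure_iff' hx).2
      ((H.greenIntegrable_of_bound (F := fun _ => (1 : ℝ)) continuousOn_const (C := 1)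
        (by simp)).1 x hx)
    exact (integrable_const_iff_isFiniteMeasure one_ne_zero).1 this
  have hψ0 : ∀ y, 0 < y → φ y ≤ φ y + ψ y := fun y hy => by linarith [hfund.ψ_pos y hy]
  have hφ0 : ∀ y, 0 < y → ψ y ≤ φ y + ψ y := fun y hy => by linarith [hfund.φ_pos y hy]
  -- Bounded continuous functions separate finite measures, and for such `f` the Green solution is
  -- bounded, so the bounded Feynman–Kac formula applies.
  refine ext_of_forall_integral_eq_of_IsFiniteMeasure fun f => ?_
  have hfc : ContinuousOn f (Ioi 0) := f.continuous.continuousOn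
  have hfb : ∀ y, 0 < y → |f y| ≤ ‖f‖ := fun y _ => f.norm_coe_le_norm y
  obtain ⟨hi, B, hB⟩ := H.greenIntegrable_of_bound hfc hfb
  rw [H.integral_greenMeasure_eq hx ((H.integrable_greenMeasure_iff' hx).2 (hi x hx))]
  refine integral_occ_eq_of_bounded hY hx hcoef.b_lip.continuousOn hcoef.σ_lip.continuousOn hrc
    hr₀ hr0' hL' (H.contDiffOn_greenSol hfc hi) hfc hfb hB
    (fun y hy => by rw [hop _ _ hy, H.opL_greenSol hfc hi hy])
    (S := φ + ψ) (hfund.φ_smooth.add hfund.ψ_smooth) (fun y hy => ?_) ?_ ?_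
  · have h1 := hfund.φ_ode y hy
    have h2 := hfund.ψ_ode y hy
    have d1 : deriv (φ + ψ) =ᶠ[𝓝 y] deriv φ + deriv ψ := by
      filter_upwards [Ioi_mem_nhds hy] with z hz
      exact ((H.hasDerivAt_φ hz).add (H.hasDerivAt_ψ hz)).deriv
    have d2 : deriv (deriv (φ + ψ)) y = deriv (deriv φ) y + deriv (deriv ψ) y := by
      rw [d1.deriv_eq]
      exact ((hasDerivAt_deriv_of_contDiffOn hfund.φ_smooth hy).add
        (hasDerivAt_deriv_of_contDiffOn hfund.ψ_smooth hy)).deriv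
    rw [hop _ _ hy]
    rw [opL] at h1 h2 ⊢
    rw [d2, d1.eq_of_nhds, Pi.add_apply, Pi.add_apply]
    linear_combination h1 + h2
  · refine tendsto_atTop_mono' _ ?_ hfund.φ_lim
    filter_upwards [self_mem_nhdsWithin] with y hy using hψ0 y hy
  · refine tendsto_atTop_mono' _ ?_ hfund.ψ_lim
    filter_upwards [Ioi_mem_atTop 0] with y hy using hφ0 y hy

lemma IsDiffusionFrom.discount_eq (hY : IsDiffusionFrom b σ P ℱ Y x) (ω : Ω) (t : ℝ) :
    discount r (fun s => Y s ω) t = discount (fun y => r (max y 0)) (fun s => Y s ω) t := by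
  simp only [discount, max_eq_left (hY.pos _ ω).le]

lemma greenIntegrable_of_discountedIntegrable [IsProbabilityMeasure P] {X : ℝ → ℝ≥0 → Ω → ℝ}
    (hX : ∀ x, 0 < x → IsDiffusionFrom b σ P ℱ (X x) x) (hcoef : CoefficientAssumption b σ)
    (hr : DiscountAssumption r) (hfund : FundamentalSolutions b σ r φ ψ) {F : ℝ → ℝ}
    (hF : ContinuousOn F (Ioi 0)) (hi : DiscountedIntegrable P X r F) :
    GreenIntegrable σ φ ψ F := by
  classical
  have H := greenData_of b σ r φ ψ hcoef hr hfund
  have hrc : Continuous fun y => r (max y 0) := continuous_comp_max_zero hr.cont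
  have hocc : ∀ x, 0 < x → Integrable F (occ P (X x) fun y => r (max y 0)) := by
    intro x hx
    have hY := hX x hx
    refine ⟨aestronglyMeasurable_occ hY.measurable hY.continuous_paths hY.pos hF, ?_⟩
    -- `F` is continuous on `]0, ∞[` only; its extension by zero is Borel and is indistinguishable
    -- from it along the paths.
    have hm : Measurable ((Ioi 0).piecewise F 0) :=
      hF.measurable_piecewise continuousOn_const measurableSet_Ioi
    rw [HasFiniteIntegral]
    have e : ∫⁻ y, ‖F y‖ₑ ∂(occ P (X x) fun y => r (max y 0)) =
        ∫⁻ y, ‖(Ioi 0).piecewise F 0 y‖ₑ ∂(occ P (X x) fun y => r (max y 0)) := by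
      refine lintegral_congr_ae ?_
      filter_upwards [ae_occ_pos hY.measurable hY.continuous_paths hY.pos] with y hy
      rw [piecewise_eq_of_mem _ _ _ hy]
    rw [e, lintegral_occ hY.measurable hY.continuous_paths hrc hm.enorm]
    convert hi x hx using 6 with ω t
    rw [piecewise_eq_of_mem _ _ _ (mem_Ioi.2 (hY.pos _ ω)), ENNReal.ofReal_mul (Real.exp_pos _).le,
      ← hY.discount_eq, Real.enorm_eq_ofReal_abs]
  have hgr : ∀ x, 0 < x → Integrable F (greenMeasure σ φ ψ x) := fun x hx => by
    rw [← occ_eq_greenMeasure (hX x hx) hx hcoef hr hfund]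
    exact hocc x hx
  exact fun x hx => (H.integrable_greenMeasure_iff' hx).1 (hgr x hx)

/-- The resolvent in terms of the Green kernel. -/
theorem R_eq_greenSol [IsProbabilityMeasure P] {X : ℝ → ℝ≥0 → Ω → ℝ}
    (hX : ∀ x, 0 < x → IsDiffusionFrom b σ P ℱ (X x) x) (hcoef : CoefficientAssumption b σ)
    (hr : DiscountAssumption r) (hfund : FundamentalSolutions b σ r φ ψ) {F : ℝ → ℝ}
    (hi : GreenIntegrable σ φ ψ F) (hx : 0 < x) : R P X r F x = greenSol σ φ ψ F x := by
  have H := greenData_of b σ r φ ψ hcoef hr hfund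
  have hrc : Continuous fun y => r (max y 0) := continuous_comp_max_zero hr.cont
  have hY := hX x hx
  have hgr := (H.integrable_greenMeasure_iff' hx).2 (hi x hx)
  have hocc := hgr
  rw [← occ_eq_greenMeasure hY hx hcoef hr hfund] at hocc
  rw [← H.integral_greenMeasure_eq hx hgr, ← occ_eq_greenMeasure hY hx hcoef hr hfund,
    integral_occ hY.measurable hY.continuous_paths hrc hocc, R]
  refine integral_congr_ae (ae_of_all _ fun ω => integral_congr_ae (ae_of_all _ fun t => ?_))
  simp only
  rw [hY.discount_eq (r := r) ω t]

/-- The resolvent of the discounting rate is `1`. -/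
theorem greenSol_r [IsProbabilityMeasure P] {X : ℝ → ℝ≥0 → Ω → ℝ}
    (hX : ∀ x, 0 < x → IsDiffusionFrom b σ P ℱ (X x) x) (hcoef : CoefficientAssumption b σ)
    (hr : DiscountAssumption r) (hfund : FundamentalSolutions b σ r φ ψ) :
    GreenIntegrable σ φ ψ r ∧ ∀ x, 0 < x → greenSol σ φ ψ r x = 1 := by
  have H := greenData_of b σ r φ ψ hcoef hr hfund
  have hg : GreenIntegrable σ φ ψ r := fun x hx => ⟨(H.lower_r hx).1, (H.upper_r hx).1⟩
  refine ⟨hg, fun x hx => ?_⟩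
  obtain ⟨r₀, hr₀, hr0⟩ := hr.lower
  obtain ⟨L, hL⟩ := hr.bdd
  have hY := hX x hx
  rw [← H.integral_greenMeasure_eq hx ((H.integrable_greenMeasure_iff' hx).2 (hg x hx)),
    ← integral_occ_self (P := P) hY.measurable hY.continuous_paths hY.pos
      (continuous_comp_max_zero hr.cont) hr₀ (fun y => hr0 _ (le_max_right _ _))
      (fun y => hL _ (le_max_right y 0)), occ_eq_greenMeasure hY hx hcoef hr hfund,
    H.integral_greenMeasure hx, H.integral_greenMeasure hx]
  refine setIntegral_congr_fun measurableSet_Ioi fun y hy => ?_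
  simp only [max_eq_left (le_of_lt (mem_Ioi.1 hy))]

end Representation

/-! ### The ratio `R_Θ' / ψ'` -/

/-- Continuity alone gives a weak inequality at the endpoint; an intermediate point restores
strictness. -/
lemma strictMonoOn_Ioc_of_Ioo {f : ℝ → ℝ} {ξ : ℝ} (hc : ContinuousOn f (Ioi 0))
    (h : StrictMonoOn f (Ioo 0 ξ)) : StrictMonoOn f (Ioc 0 ξ) := by
  intro s hs t ht hst
  rcases ht.2.lt_or_eq with hlt | rfl
  · exact h ⟨hs.1, hst.trans hlt⟩ ⟨ht.1, hlt⟩ hst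
  · obtain ⟨m, hm1, hm2⟩ := exists_between hst
    have hm0 := hs.1.trans hm1
    refine (h ⟨hs.1, hst⟩ ⟨hm0, hm2⟩ hm1).trans_le ?_
    have ht' : Tendsto f (𝓝[<] t) (𝓝 (f t)) :=
      ((hc.continuousAt (Ioi_mem_nhds ht.1)).tendsto).mono_left nhdsWithin_le_nhds
    refine ge_of_tendsto ht' ?_
    filter_upwards [Ioo_mem_nhdsLT hm2] with z hz
    exact (h ⟨hm0, hm2⟩ ⟨hm0.trans hz.1, hz.2⟩ hz.1).le

lemma strictAntiOn_Ici_of_Ioi {f : ℝ → ℝ} {ξ : ℝ} (hξ : 0 < ξ) (hc : ContinuousOn f (Ioi 0))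
    (h : StrictAntiOn f (Ioi ξ)) : StrictAntiOn f (Ici ξ) := by
  intro s hs t ht hst
  rcases (mem_Ici.1 hs).lt_or_eq with hlt | rfl
  · exact h hlt (hlt.trans hst) hst
  · obtain ⟨m, hm1, hm2⟩ := exists_between hst
    refine (h hm1 hst hm2).trans_le ?_
    have ht' : Tendsto f (𝓝[>] ξ) (𝓝 (f ξ)) :=
      ((hc.continuousAt (Ioi_mem_nhds hξ)).tendsto).mono_left nhdsWithin_le_nhds
    refine ge_of_tendsto ht' ?_
    filter_upwards [Ioo_mem_nhdsGT hm1] with z hz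
    exact (h hz.1 hm1 hz.2).le

/-- `(Θ / r) ∫_0^x r ψ q - ∫_0^x Θ ψ q`, which has the sign of `-(R_Θ' / ψ')'`. -/
noncomputable def turning (σ r φ ψ Θ : ℝ → ℝ) (x : ℝ) : ℝ :=
  Θ x / r x * lowerInt σ φ ψ r x - lowerInt σ φ ψ Θ x

namespace GreenData

variable {b σ r φ ψ Θ RΘ : ℝ → ℝ} {x ξ : ℝ}

/-- The equations `R_r = 1` and `R_r' = 0` are linear in the two integrals with determinant `W`;
Cramer's rule solves them. -/
lemma lowerInt_r_eq (H : GreenData b σ r φ ψ) (hone : ∀ x, 0 < x → greenSol σ φ ψ r x = 1)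
    (hx : 0 < x) : lowerInt σ φ ψ r x = deriv ψ x / wronskian φ ψ x := by
  have hg : GreenIntegrable σ φ ψ r := fun x hx => ⟨(H.lower_r hx).1, (H.upper_r hx).1⟩
  have h1 := hone x hx
  have hd : deriv φ x * lowerInt σ φ ψ r x + deriv ψ x * upperInt σ φ ψ r x = 0 := by
    rw [← (H.hasDerivAt_greenSol H.r_cont hg hx).deriv]
    have : greenSol σ φ ψ r =ᶠ[𝓝 x] fun _ => 1 := by
      filter_upwards [Ioi_mem_nhds hx] with y hy using hone y hy
    rw [this.deriv_eq, deriv_const]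
  rw [eq_div_iff (H.wronskian_pos hx).ne', wronskian]
  rw [greenSol] at h1
  linear_combination deriv ψ x * h1 - ψ x * hd

end GreenData

/-- The data entering the function `R_Θ' / ψ'`. -/
structure RatioData (b σ r φ ψ Θ RΘ : ℝ → ℝ) (ξ : ℝ) : Prop where
  green : GreenData b σ r φ ψ
  Θ_cont : ContinuousOn Θ (Ioi 0)
  Θ_int : GreenIntegrable σ φ ψ Θ
  r_one : ∀ x, 0 < x → greenSol σ φ ψ r x = 1
  R_eq : ∀ x, 0 < x → RΘ x = greenSol σ φ ψ Θ x
  ξ_pos : 0 < ξ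
  incr : StrictMonoOn (fun x => Θ x / r x) (Ioc 0 ξ)
  decr : StrictAntiOn (fun x => Θ x / r x) (Ici ξ)

namespace RatioData

variable {b σ r φ ψ Θ RΘ : ℝ → ℝ} {x y ξ : ℝ}

lemma deriv_R (D : RatioData b σ r φ ψ Θ RΘ ξ) (hx : 0 < x) :
    deriv RΘ x = deriv φ x * lowerInt σ φ ψ Θ x + deriv ψ x * upperInt σ φ ψ Θ x := by
  have : RΘ =ᶠ[𝓝 x] greenSol σ φ ψ Θ := by
    filter_upwards [Ioi_mem_nhds hx] with y hy using D.R_eq y hy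
  rw [this.deriv_eq, (D.green.hasDerivAt_greenSol D.Θ_cont D.Θ_int hx).deriv]

lemma ratio_eq (D : RatioData b σ r φ ψ Θ RΘ ξ) (hx : 0 < x) :
    ratio RΘ ψ x = deriv φ x / deriv ψ x * lowerInt σ φ ψ Θ x + upperInt σ φ ψ Θ x := by
  have := (D.green.fund.ψ_incr x hx).ne'
  rw [ratio, D.deriv_R hx]
  field_simp

lemma G_eq (D : RatioData b σ r φ ψ Θ RΘ ξ) (hx : 0 < x) :
    G RΘ ψ x = wronskian φ ψ x / deriv ψ x * lowerInt σ φ ψ Θ x := by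
  have := (D.green.fund.ψ_incr x hx).ne'
  rw [G, D.ratio_eq hx, D.R_eq x hx, greenSol, wronskian]
  field_simp
  ring

lemma lowerInt_r (D : RatioData b σ r φ ψ Θ RΘ ξ) (hx : 0 < x) :
    lowerInt σ φ ψ r x = deriv ψ x / wronskian φ ψ x :=
  D.green.lowerInt_r_eq D.r_one hx

lemma lowerInt_r_pos (D : RatioData b σ r φ ψ Θ RΘ ξ) (hx : 0 < x) :
    0 < lowerInt σ φ ψ r x := by
  rw [D.lowerInt_r hx]
  exact div_pos (D.green.fund.ψ_incr x hx) (D.green.wronskian_pos hx)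

/-- In `(φ'/ψ')'` the drift cancels and `2 r W / (σ² ψ'²)` remains. The integrals contribute `-W q Θ
/ ψ'`, which takes the same prefactor once `∫_0^x ψ r q = ψ' / W` is inserted. -/
lemma hasDerivAt_ratio (D : RatioData b σ r φ ψ Θ RΘ ξ) (hx : 0 < x) :
    HasDerivAt (ratio RΘ ψ) (-(2 * r x * wronskian φ ψ x / (σ x ^ 2 * deriv ψ x ^ 2)) *
      turning σ r φ ψ Θ x) x := by
  have H := D.green
  have hψ := (H.fund.ψ_incr x hx).ne'
  have hσ := (H.σ_pos x hx).ne'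
  have hW := (H.wronskian_pos hx).ne'
  have hr := (H.r_pos hx).ne'
  have h := (((H.hasDerivAt_deriv_φ hx).div (H.hasDerivAt_deriv_ψ hx) hψ).mul
    (H.hasDerivAt_lowerInt D.Θ_cont D.Θ_int hx)).add (H.hasDerivAt_upperInt D.Θ_cont D.Θ_int hx)
  have e : ratio RΘ ψ =ᶠ[𝓝 x] fun x =>
      deriv φ x / deriv ψ x * lowerInt σ φ ψ Θ x + upperInt σ φ ψ Θ x := by
    filter_upwards [Ioi_mem_nhds hx] with y hy using D.ratio_eq hy
  refine (h.congr_of_eventuallyEq e).congr_deriv ?_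
  have e1 : (2 / σ x ^ 2 * (r x * φ x - b x * deriv φ x) * deriv ψ x -
      deriv φ x * (2 / σ x ^ 2 * (r x * ψ x - b x * deriv ψ x))) / deriv ψ x ^ 2 =
      2 * r x * wronskian φ ψ x / (σ x ^ 2 * deriv ψ x ^ 2) := by
    rw [wronskian]
    field_simp
    ring
  have e2 : deriv φ x / deriv ψ x * (ψ x * (Θ x * weight σ φ ψ x)) +
      -(φ x * (Θ x * weight σ φ ψ x)) =
      -(2 * r x * wronskian φ ψ x / (σ x ^ 2 * deriv ψ x ^ 2)) *
        (Θ x / r x * lowerInt σ φ ψ r x) := by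
    have : deriv φ x / deriv ψ x * (ψ x * (Θ x * weight σ φ ψ x)) +
        -(φ x * (Θ x * weight σ φ ψ x)) =
        -(wronskian φ ψ x * weight σ φ ψ x) * Θ x / deriv ψ x := by
      rw [wronskian]
      field_simp
      ring
    rw [this, D.lowerInt_r hx, weight]
    field_simp
  rw [Pi.div_apply, e1, add_assoc, e2, turning]
  ring

lemma coef_pos (D : RatioData b σ r φ ψ Θ RΘ ξ) (hx : 0 < x) :
    0 < 2 * r x * wronskian φ ψ x / (σ x ^ 2 * deriv ψ x ^ 2) :=
  div_pos (mul_pos (mul_pos two_pos (D.green.r_pos hx)) (D.green.wronskian_pos hx))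
    (mul_pos (pow_pos (D.green.σ_pos x hx) 2) (pow_pos (D.green.fund.ψ_incr x hx) 2))

lemma deriv_ratio_neg_iff (D : RatioData b σ r φ ψ Θ RΘ ξ) (hx : 0 < x) :
    deriv (ratio RΘ ψ) x < 0 ↔ 0 < turning σ r φ ψ Θ x := by
  rw [(D.hasDerivAt_ratio hx).deriv, neg_mul, neg_lt_zero, mul_pos_iff_of_pos_left (D.coef_pos hx)]

lemma deriv_ratio_pos_iff (D : RatioData b σ r φ ψ Θ RΘ ξ) (hx : 0 < x) :
    0 < deriv (ratio RΘ ψ) x ↔ turning σ r φ ψ Θ x < 0 := by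
  rw [(D.hasDerivAt_ratio hx).deriv, neg_mul, neg_pos, ← not_le, ← not_le,
    mul_nonneg_iff_of_pos_left (D.coef_pos hx)]

/-- `R_Θ'` cancels `ρ ψ'` by the definition of `ρ`. -/
lemma hasDerivAt_G (D : RatioData b σ r φ ψ Θ RΘ ξ) (hx : 0 < x) :
    HasDerivAt (G RΘ ψ) (-(deriv (ratio RΘ ψ) x * ψ x)) x := by
  have H := D.green
  have hψ := (H.fund.ψ_incr x hx).ne'
  have e : RΘ =ᶠ[𝓝 x] greenSol σ φ ψ Θ := by
    filter_upwards [Ioi_mem_nhds hx] with y hy using D.R_eq y hy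
  have hR := (H.hasDerivAt_greenSol D.Θ_cont D.Θ_int hx).congr_of_eventuallyEq e
  have h := hR.sub ((D.hasDerivAt_ratio hx).mul (H.hasDerivAt_ψ hx))
  refine HasDerivAt.congr_deriv (f := G RΘ ψ) h ?_
  rw [(D.hasDerivAt_ratio hx).deriv, D.ratio_eq hx]
  field_simp
  ring

lemma Θ_eq (D : RatioData b σ r φ ψ Θ RΘ ξ) (hx : 0 < x) : Θ x = Θ x / r x * r x := by
  rw [div_mul_cancel₀ _ (D.green.r_pos hx).ne']

lemma integrand_eq (D : RatioData b σ r φ ψ Θ RΘ ξ) (hx : 0 < x) :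
    ψ x * (Θ x * weight σ φ ψ x) = Θ x / r x * (ψ x * (r x * weight σ φ ψ x)) := by
  conv_lhs => rw [D.Θ_eq hx]
  ring

lemma integrand_r_pos (D : RatioData b σ r φ ψ Θ RΘ ξ) (hx : 0 < x) :
    0 < ψ x * (r x * weight σ φ ψ x) :=
  mul_pos (D.green.fund.ψ_pos x hx) (mul_pos (D.green.r_pos hx) (D.green.weight_pos hx))

lemma lowerInt_le (D : RatioData b σ r φ ψ Θ RΘ ξ) (hx : 0 < x) {c : ℝ}
    (hc : ∀ y ∈ Ioc 0 x, Θ y / r y ≤ c) : lowerInt σ φ ψ Θ x ≤ c * lowerInt σ φ ψ r x := by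
  rw [lowerInt, lowerInt, ← integral_const_mul]
  refine setIntegral_mono_on (D.Θ_int x hx).1 ((D.green.lower_r hx).1.const_mul c)
    measurableSet_Ioc fun y hy => ?_
  rw [D.integrand_eq hy.1]
  exact mul_le_mul_of_nonneg_right (hc y hy) (D.integrand_r_pos hy.1).le

lemma lowerInt_sub (hxy : x ≤ y) (hx : 0 < x) {F : ℝ → ℝ}
    (hi : IntegrableOn (fun y => ψ y * (F y * weight σ φ ψ y)) (Ioc 0 y)) :
    lowerInt σ φ ψ F y - lowerInt σ φ ψ F x =
      ∫ s in Ioc x y, ψ s * (F s * weight σ φ ψ s) := by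
  rw [lowerInt, lowerInt, ← Ioc_union_Ioc_eq_Ioc hx.le hxy,
    setIntegral_union (Ioc_disjoint_Ioc_of_le le_rfl) measurableSet_Ioc
      (hi.mono_set (Ioc_subset_Ioc_right hxy)) (hi.mono_set (Ioc_subset_Ioc_left hx.le))]
  ring

lemma lowerInt_sub_le (D : RatioData b σ r φ ψ Θ RΘ ξ) (hx : 0 < x) (hxy : x ≤ y) {c : ℝ}
    (hc : ∀ s ∈ Ioc x y, Θ s / r s ≤ c) :
    lowerInt σ φ ψ Θ y - lowerInt σ φ ψ Θ x ≤
      c * (lowerInt σ φ ψ r y - lowerInt σ φ ψ r x) := by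
  have hy := hx.trans_le hxy
  rw [lowerInt_sub hxy hx (D.Θ_int y hy).1, lowerInt_sub hxy hx (D.green.lower_r hy).1,
    ← integral_const_mul]
  refine setIntegral_mono_on ((D.Θ_int y hy).1.mono_set (Ioc_subset_Ioc_left hx.le))
    (((D.green.lower_r hy).1.mono_set (Ioc_subset_Ioc_left hx.le)).const_mul c)
    measurableSet_Ioc fun s hs => ?_
  rw [D.integrand_eq (hx.trans hs.1)]
  exact mul_le_mul_of_nonneg_right (hc s hs) (D.integrand_r_pos (hx.trans hs.1)).le

lemma le_lowerInt_sub (D : RatioData b σ r φ ψ Θ RΘ ξ) (hx : 0 < x) (hxy : x ≤ y) {c : ℝ}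
    (hc : ∀ s ∈ Ioc x y, c ≤ Θ s / r s) :
    c * (lowerInt σ φ ψ r y - lowerInt σ φ ψ r x) ≤
      lowerInt σ φ ψ Θ y - lowerInt σ φ ψ Θ x := by
  have hy := hx.trans_le hxy
  rw [lowerInt_sub hxy hx (D.Θ_int y hy).1, lowerInt_sub hxy hx (D.green.lower_r hy).1,
    ← integral_const_mul]
  refine setIntegral_mono_on
    (((D.green.lower_r hy).1.mono_set (Ioc_subset_Ioc_left hx.le)).const_mul c)
    ((D.Θ_int y hy).1.mono_set (Ioc_subset_Ioc_left hx.le)) measurableSet_Ioc fun s hs => ?_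
  rw [D.integrand_eq (hx.trans hs.1)]
  exact mul_le_mul_of_nonneg_right (hc s hs) (D.integrand_r_pos (hx.trans hs.1)).le

/-- An average of `Θ / r` over `]0, x]` lies below its value at `x` while `Θ / r` increases.
Splitting at `x / 2` makes the inequality strict. -/
lemma turning_pos (D : RatioData b σ r φ ψ Θ RΘ ξ) (hx : 0 < x) (hxξ : x ≤ ξ) :
    0 < turning σ r φ ψ Θ x := by
  have hz : 0 < x / 2 := half_pos hx
  have hzx : x / 2 < x := half_lt_self hx
  have hzm : x / 2 ∈ Ioc 0 ξ := ⟨hz, hzx.le.trans hxξ⟩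
  have h1 := D.lowerInt_le hz (c := Θ (x / 2) / r (x / 2)) fun y hy =>
    D.incr.monotoneOn ⟨hy.1, hy.2.trans hzm.2⟩ hzm hy.2
  have h2 := D.lowerInt_sub_le hz hzx.le (c := Θ x / r x) fun y hy =>
    D.incr.monotoneOn ⟨hz.trans hy.1, hy.2.trans hxξ⟩ ⟨hx, hxξ⟩ hy.2
  have h3 := mul_lt_mul_of_pos_right (D.incr hzm ⟨hx, hxξ⟩ hzx) (D.lowerInt_r_pos hz)
  rw [turning]
  simp only at h3
  linarith

/-- From `x` to `y` the change is `(Θ(y)/r(y) - Θ(x)/r(x)) ∫_0^x ψ r q`, which is negative, plus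
`∫_x^y (Θ(y)/r(y) - Θ(s)/r(s)) ψ r q ds`, which is nonpositive. -/
lemma turning_strictAntiOn (D : RatioData b σ r φ ψ Θ RΘ ξ) :
    StrictAntiOn (turning σ r φ ψ Θ) (Ici ξ) := by
  intro x hx y hy hxy
  have hx0 : 0 < x := D.ξ_pos.trans_le hx
  have h1 := D.le_lowerInt_sub hx0 hxy.le (c := Θ y / r y) fun s hs =>
    D.decr.antitoneOn (mem_Ici.2 ((mem_Ici.1 hx).trans hs.1.le)) hy hs.2
  have h2 := mul_lt_mul_of_pos_right (D.decr hx hy hxy) (D.lowerInt_r_pos hx0)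
  rw [turning, turning]
  simp only at h2
  linarith

lemma cont_turning (D : RatioData b σ r φ ψ Θ RΘ ξ) :
    ContinuousOn (turning σ r φ ψ Θ) (Ioi 0) :=
  ((D.Θ_cont.div D.green.r_cont fun _ hx => (D.green.r_pos hx).ne').mul
    (D.green.cont_lowerInt D.green.r_cont fun _ hx =>
      ⟨(D.green.lower_r hx).1, (D.green.upper_r hx).1⟩)).sub
    (D.green.cont_lowerInt D.Θ_cont D.Θ_int)

/-- `xLow` is defined by choice, so its properties are available only once existence is proved.
Either `turning` stays positive, and `⊤` works, or it vanishes once beyond `ξ`. -/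
lemma exists_isTurningPoint (D : RatioData b σ r φ ψ Θ RΘ ξ) :
    ∃ y, IsTurningPoint ξ RΘ ψ y := by
  by_cases h : ∀ x, ξ ≤ x → 0 < turning σ r φ ψ Θ x
  · refine ⟨⊤, EReal.coe_lt_top ξ, fun x hx _ => (D.deriv_ratio_neg_iff hx).2 ?_,
      fun x hx => absurd hx not_top_lt⟩
    rcases le_total x ξ with hxξ | hxξ
    exacts [D.turning_pos hx hxξ, h x hxξ]
  · push Not at h
    obtain ⟨x₁, hx₁, hx₁'⟩ := h
    have hcont : ContinuousOn (turning σ r φ ψ Θ) (Icc ξ x₁) :=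
      D.cont_turning.mono fun s hs => D.ξ_pos.trans_le hs.1
    obtain ⟨x₀, hx₀, hx₀'⟩ := intermediate_value_Icc' hx₁ hcont
      ⟨hx₁', (D.turning_pos D.ξ_pos le_rfl).le⟩
    have hξx : ξ < x₀ := by
      refine hx₀.1.lt_of_ne fun h => ?_
      have := D.turning_pos D.ξ_pos le_rfl
      rw [h, hx₀'] at this
      exact lt_irrefl _ this
    refine ⟨x₀, EReal.coe_lt_coe_iff.2 hξx, fun x hx hxx => (D.deriv_ratio_neg_iff hx).2 ?_,
      fun x hxx => ?_⟩
    · rcases le_total x ξ with hxξ | hxξ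
      · exact D.turning_pos hx hxξ
      · rw [← hx₀']
        exact D.turning_strictAntiOn hxξ hx₀.1 (EReal.coe_lt_coe_iff.1 hxx)
    · have hxx' := EReal.coe_lt_coe_iff.1 hxx
      rw [D.deriv_ratio_pos_iff ((D.ξ_pos.trans hξx).trans hxx'), ← hx₀']
      exact D.turning_strictAntiOn hx₀.1 (hξx.le.trans hxx'.le) hxx'

/-- Beyond the turning point, `Θ / r` lies below `G_Θ`. -/
lemma div_lt_G (D : RatioData b σ r φ ψ Θ RΘ ξ) (hx : 0 < x)
    (h : 0 < deriv (ratio RΘ ψ) x) : Θ x / r x < G RΘ ψ x := by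
  rw [D.deriv_ratio_pos_iff hx, turning, D.lowerInt_r hx, sub_neg] at h
  have hψ := D.green.fund.ψ_incr x hx
  have hW := D.green.wronskian_pos hx
  rw [D.G_eq hx]
  calc Θ x / r x = wronskian φ ψ x / deriv ψ x * (Θ x / r x * (deriv ψ x / wronskian φ ψ x)) := by
        field_simp
    _ < _ := mul_lt_mul_of_pos_left h (div_pos hW hψ)

end RatioData

/-! ### The free boundary -/

/-- The ratio `R_Θ' / ψ'` turns from decreasing to increasing at the real point `x₀`. -/
structure TurningData (ξ : ℝ) (RΘ ψ : ℝ → ℝ) (x₀ : ℝ) : Prop where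
  x₀_pos : 0 < x₀
  low : xLow ξ RΘ ψ = (x₀ : EReal)
  ψ_mono : StrictMonoOn ψ (Ioi 0)
  deriv_ratio : ∀ x, 0 < x → HasDerivAt (ratio RΘ ψ) (deriv (ratio RΘ ψ) x) x
  deriv_G : ∀ x, 0 < x → HasDerivAt (G RΘ ψ) (-(deriv (ratio RΘ ψ) x * ψ x)) x
  neg : ∀ x, 0 < x → x < x₀ → deriv (ratio RΘ ψ) x < 0
  pos : ∀ x, x₀ < x → 0 < deriv (ratio RΘ ψ) x

lemma RatioData.exists_turningData {b σ r φ ψ Θ RΘ : ℝ → ℝ} {ξ : ℝ}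
    (D : RatioData b σ r φ ψ Θ RΘ ξ) (hlow : xLow ξ RΘ ψ < ⊤) :
    ∃ x₀, ξ < x₀ ∧ TurningData ξ RΘ ψ x₀ := by
  have h : IsTurningPoint ξ RΘ ψ (xLow ξ RΘ ψ) := Classical.epsilon_spec D.exists_isTurningPoint
  have hne : xLow ξ RΘ ψ ≠ ⊥ := (bot_le.trans_lt h.1).ne'
  have hx₀ : xLow ξ RΘ ψ = ((xLow ξ RΘ ψ).toReal : EReal) := (EReal.coe_toReal hlow.ne hne).symm
  set x₀ := (xLow ξ RΘ ψ).toReal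
  rw [hx₀] at h
  have hξ : ξ < x₀ := EReal.coe_lt_coe_iff.1 h.1
  exact ⟨x₀, hξ, D.ξ_pos.trans hξ, hx₀, D.green.mono_ψ,
    fun x hx => (D.hasDerivAt_ratio hx).differentiableAt.hasDerivAt, fun x hx => D.hasDerivAt_G hx,
    fun x hx hxx => h.2.1 x hx (EReal.coe_lt_coe_iff.2 hxx),
    fun x hxx => h.2.2 x (EReal.coe_lt_coe_iff.2 hxx)⟩

namespace TurningData

variable {ξ x₀ : ℝ} {RΘ ψ : ℝ → ℝ} {x y γ β γ₁ β₁ γ₂ β₂ : ℝ}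

lemma cont_ratio (T : TurningData ξ RΘ ψ x₀) : ContinuousOn (ratio RΘ ψ) (Ioi 0) := fun x hx =>
  (T.deriv_ratio x hx).continuousAt.continuousWithinAt

lemma anti (T : TurningData ξ RΘ ψ x₀) : StrictAntiOn (ratio RΘ ψ) (Ioc 0 x₀) :=
  strictAntiOn_of_deriv_neg (convex_Ioc 0 x₀) (T.cont_ratio.mono fun _ hx => hx.1) fun x hx => by
    rw [interior_Ioc] at hx
    exact T.neg x hx.1 hx.2

lemma mono (T : TurningData ξ RΘ ψ x₀) : StrictMonoOn (ratio RΘ ψ) (Ici x₀) :=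
  strictMonoOn_of_deriv_pos (convex_Ici x₀)
    (T.cont_ratio.mono fun _ hx => T.x₀_pos.trans_le hx) fun x hx => by
    rw [interior_Ici] at hx
    exact T.pos x hx

/-- The derivative of `G_Θ + c ρ` is `ρ' (c - ψ)`; taking for `c` the value of `ψ` at a suitable
endpoint fixes its sign on each branch of `ρ`. -/
lemma antitone_aux (T : TurningData ξ RΘ ψ x₀) {c : ℝ} (hx : 0 < x)
    (h : ∀ z ∈ Ioo x y, deriv (ratio RΘ ψ) z * (c - ψ z) ≤ 0) (hxy : x ≤ y) :
    G RΘ ψ y - G RΘ ψ x ≤ c * (ratio RΘ ψ x - ratio RΘ ψ y) := by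
  have hd : ∀ z, 0 < z → HasDerivAt (fun z => G RΘ ψ z + c * ratio RΘ ψ z)
      (deriv (ratio RΘ ψ) z * (c - ψ z)) z := fun z hz =>
    ((T.deriv_G z hz).add ((T.deriv_ratio z hz).const_mul c)).congr_deriv (by ring)
  have hanti : AntitoneOn (fun z => G RΘ ψ z + c * ratio RΘ ψ z) (Icc x y) := by
    refine antitoneOn_of_deriv_nonpos (convex_Icc x y)
      (fun z hz => (hd z (hx.trans_le hz.1)).continuousAt.continuousWithinAt) ?_ ?_
    · intro z hz
      rw [interior_Icc] at hz
      exact (hd z (hx.trans hz.1)).differentiableAt.differentiableWithinAt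
    · intro z hz
      rw [interior_Icc] at hz
      rw [(hd z (hx.trans hz.1)).deriv]
      exact h z hz
  have := hanti ⟨le_rfl, hxy⟩ ⟨hxy, le_rfl⟩ hxy
  simp only at this
  linarith

lemma G_sub_le_right (T : TurningData ξ RΘ ψ x₀) (hx : x₀ ≤ x) (hxy : x ≤ y) :
    G RΘ ψ y - G RΘ ψ x ≤ ψ x * (ratio RΘ ψ x - ratio RΘ ψ y) := by
  have hx0 := T.x₀_pos.trans_le hx
  refine T.antitone_aux hx0 (fun z hz => ?_) hxy
  refine mul_nonpos_of_nonneg_of_nonpos (T.pos z (hx.trans_lt hz.1)).le (sub_nonpos.2 ?_)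
  exact (T.ψ_mono hx0 (hx0.trans hz.1) hz.1).le

lemma G_sub_le_left (T : TurningData ξ RΘ ψ x₀) (hx : 0 < x) (hxy : x ≤ y) (hy : y ≤ x₀) :
    G RΘ ψ y - G RΘ ψ x ≤ ψ y * (ratio RΘ ψ x - ratio RΘ ψ y) := by
  refine T.antitone_aux hx (fun z hz => ?_) hxy
  refine mul_nonpos_of_nonpos_of_nonneg (T.neg z (hx.trans hz.1) (hz.2.trans_le hy)).le
    (sub_nonneg.2 ?_)
  exact (T.ψ_mono (mem_Ioi.2 (hx.trans hz.1)) (mem_Ioi.2 (hx.trans_le hxy)) hz.2).le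

lemma lt_of_ratio_eq (T : TurningData ξ RΘ ψ x₀) (hγ : 0 < γ) (hγβ : γ < β)
    (h : ratio RΘ ψ γ = ratio RΘ ψ β) : γ < x₀ ∧ x₀ < β := by
  constructor
  · by_contra hc
    have hc := not_lt.1 hc
    exact (T.mono hc (hc.trans hγβ.le) hγβ).ne h
  · by_contra hc
    have hc := not_lt.1 hc
    exact (T.anti ⟨hγ, hγβ.le.trans hc⟩ ⟨hγ.trans hγβ, hc⟩ hγβ).ne' h

/-- A larger `β` raises the level of `ρ` by some `Δ > 0` and pushes `γ` to the left. On the right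
`G_Θ` falls by at least `ψ(β₁) Δ`, on the left by at most `ψ(γ₁) Δ`, and `ψ(γ₁) < ψ(β₁)`. -/
lemma F_lt_F (T : TurningData ξ RΘ ψ x₀) (h₁ : 0 < γ₁) (h₁' : γ₁ < x₀) (h₁'' : x₀ < β₁)
    (e₁ : ratio RΘ ψ γ₁ = ratio RΘ ψ β₁) (h₂ : 0 < γ₂) (h₂' : γ₂ < x₀)
    (e₂ : ratio RΘ ψ γ₂ = ratio RΘ ψ β₂) (hβ : β₁ < β₂) :
    F RΘ ψ γ₂ β₂ < F RΘ ψ γ₁ β₁ := by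
  have hρ : ratio RΘ ψ β₁ < ratio RΘ ψ β₂ := T.mono h₁''.le (h₁''.trans hβ).le hβ
  have hγ : γ₂ < γ₁ := by
    by_contra hc
    have := T.anti.antitoneOn ⟨h₁, h₁'.le⟩ ⟨h₂, h₂'.le⟩ (not_lt.1 hc)
    linarith
  have k₁ := T.G_sub_le_right h₁''.le hβ.le
  have k₂ := T.G_sub_le_left h₂ hγ.le h₁'.le
  have hψ : ψ γ₁ < ψ β₁ := T.ψ_mono h₁ (T.x₀_pos.trans h₁'') (h₁'.trans h₁'')
  have k₃ := mul_lt_mul_of_pos_right hψ (sub_pos.2 hρ)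
  rw [e₁, e₂] at k₂
  rw [F, F]
  linarith

lemma pair_unique (T : TurningData ξ RΘ ψ x₀) (h₁ : 0 < γ₁) (h₁' : γ₁ < β₁)
    (e₁ : ratio RΘ ψ γ₁ = ratio RΘ ψ β₁) (h₂ : 0 < γ₂) (h₂' : γ₂ < β₂)
    (e₂ : ratio RΘ ψ γ₂ = ratio RΘ ψ β₂) (hF : F RΘ ψ γ₁ β₁ = F RΘ ψ γ₂ β₂) :
    γ₁ = γ₂ ∧ β₁ = β₂ := by
  have l₁ := T.lt_of_ratio_eq h₁ h₁' e₁
  have l₂ := T.lt_of_ratio_eq h₂ h₂' e₂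
  have hβ : β₁ = β₂ := by
    rcases lt_trichotomy β₁ β₂ with h | h | h
    · exact absurd hF (T.F_lt_F h₁ l₁.1 l₁.2 e₁ h₂ l₂.1 e₂ h).ne'
    · exact h
    · exact absurd hF (T.F_lt_F h₂ l₂.1 l₂.2 e₂ h₁ l₁.1 e₁ h).ne
  refine ⟨T.anti.injOn ⟨h₁, l₁.1.le⟩ ⟨h₂, l₂.1.le⟩ ?_, hβ⟩
  rw [e₁, e₂, hβ]

lemma signPattern (T : TurningData ξ RΘ ψ x₀) (hγ : 0 < γ) (hγx : γ < x₀) (hβ : x₀ < β)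
    (e : ratio RΘ ψ γ = ratio RΘ ψ β) : SignPattern RΘ ψ γ β := by
  refine ⟨fun x hx => ?_, sub_eq_zero.2 e, fun x hx => ?_⟩
  · rw [← e, sub_pos]
    exact T.anti ⟨hx.1, (hx.2.trans hγx).le⟩ ⟨hγ, hγx.le⟩ hx.2
  · rw [sub_neg]
    rcases le_total x x₀ with h | h
    · rw [← e]
      exact T.anti ⟨hγ, hγx.le⟩ ⟨hγ.trans hx.1, h⟩ hx.1
    · exact T.mono h hβ.le hx.2

/-- A monotone limit, taken in the extended reals since `ρ` may be unbounded at `0`. -/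
lemma tendsto_ratio_zero (T : TurningData ξ RΘ ψ x₀) :
    Tendsto (fun x => (ratio RΘ ψ x : EReal)) (𝓝[>] 0)
      (𝓝 (⨆ x ∈ Ioo 0 x₀, (ratio RΘ ψ x : EReal))) := by
  refine tendsto_order.2 ⟨fun a ha => ?_, fun a ha => ?_⟩
  · obtain ⟨x, hx⟩ := lt_iSup_iff.1 ha
    obtain ⟨hx', hax⟩ := lt_iSup_iff.1 hx
    filter_upwards [Ioo_mem_nhdsGT hx'.1] with y hy
    refine hax.trans (EReal.coe_lt_coe_iff.2 (T.anti ⟨hy.1, (hy.2.trans hx'.2).le⟩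
      ⟨hx'.1, hx'.2.le⟩ hy.2))
  · filter_upwards [Ioo_mem_nhdsGT T.x₀_pos] with y hy
    exact (le_iSup₂ (f := fun x (_ : x ∈ Ioo 0 x₀) => (ratio RΘ ψ x : EReal)) y hy).trans_lt ha

lemma ratioZero_eq (T : TurningData ξ RΘ ψ x₀) :
    ratioZero RΘ ψ = ⨆ x ∈ Ioo 0 x₀, (ratio RΘ ψ x : EReal) :=
  T.tendsto_ratio_zero.limUnder_eq

lemma lt_ratioZero (T : TurningData ξ RΘ ψ x₀) (hx : x ∈ Ioo 0 x₀) :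
    (ratio RΘ ψ x : EReal) < ratioZero RΘ ψ := by
  have h2 : 0 < x / 2 := half_pos hx.1
  have h3 : x / 2 < x := half_lt_self hx.1
  rw [T.ratioZero_eq]
  refine lt_of_lt_of_le ?_ (le_iSup₂ (f := fun x (_ : x ∈ Ioo 0 x₀) => (ratio RΘ ψ x : EReal))
    (x / 2) ⟨h2, h3.trans hx.2⟩)
  exact EReal.coe_lt_coe_iff.2 (T.anti ⟨h2, (h3.trans hx.2).le⟩ ⟨hx.1, hx.2.le⟩ h3)

/-- Just to the right of the turning point `ρ` is still below `ρ(x₀ / 2)`, hence below its limit at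
`0`. -/
lemma lt_xHigh (T : TurningData ξ RΘ ψ x₀) : (x₀ : EReal) < xHigh RΘ ψ := by
  have h2 : 0 < x₀ / 2 := half_pos T.x₀_pos
  have h3 : x₀ / 2 < x₀ := half_lt_self T.x₀_pos
  have h4 : ratio RΘ ψ x₀ < ratio RΘ ψ (x₀ / 2) := T.anti ⟨h2, h3.le⟩ ⟨T.x₀_pos, le_rfl⟩ h3
  have h5 : ∀ᶠ s in 𝓝[>] x₀, ratio RΘ ψ s < ratio RΘ ψ (x₀ / 2) :=
    ((T.deriv_ratio x₀ T.x₀_pos).continuousAt.eventually_lt_const h4).filter_mono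
      nhdsWithin_le_nhds
  obtain ⟨s, hs, hs'⟩ := (h5.and self_mem_nhdsWithin).exists
  refine lt_of_lt_of_le (EReal.coe_lt_coe_iff.2 hs') (le_sInf ?_)
  rintro _ ⟨t, ⟨ht0, ht⟩, rfl⟩
  refine EReal.coe_le_coe_iff.2 (not_lt.1 fun hts => ?_)
  refine lt_asymm ht ?_
  rcases lt_or_ge t x₀ with h | h
  · exact T.lt_ratioZero ⟨ht0, h⟩
  · refine lt_trans (EReal.coe_lt_coe_iff.2 ?_) (T.lt_ratioZero ⟨h2, h3⟩)
    exact (T.mono h (le_of_lt hs') hts).trans hs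

/-- A point `t` strictly between `β` and `x̄` gives `ρ(β) < ρ(t) ≤ ρ(0+)`. This strict inequality
lets the left branch cross the level `ρ(β)`. -/
lemma exists_left (T : TurningData ξ RΘ ψ x₀) (hβ : x₀ < β) (hβ' : (β : EReal) < xHigh RΘ ψ) :
    ∃ γ, 0 < γ ∧ γ < x₀ ∧ ratio RΘ ψ γ = ratio RΘ ψ β := by
  obtain ⟨t, ht, ht'⟩ := EReal.lt_iff_exists_real_btwn.1 hβ'
  have hβt : β < t := EReal.coe_lt_coe_iff.1 ht
  have htz : (ratio RΘ ψ t : EReal) ≤ ratioZero RΘ ψ := by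
    refine not_lt.1 fun h => absurd ht' (not_lt.2 (sInf_le ⟨t, ⟨?_, h⟩, rfl⟩))
    exact (T.x₀_pos.trans hβ).trans hβt
  have hlt : (ratio RΘ ψ β : EReal) < ratioZero RΘ ψ :=
    (EReal.coe_lt_coe_iff.2 (T.mono hβ.le (hβ.trans hβt).le hβt)).trans_le htz
  rw [T.ratioZero_eq] at hlt
  obtain ⟨x, hx⟩ := lt_iSup_iff.1 hlt
  obtain ⟨hx', hax⟩ := lt_iSup_iff.1 hx
  have hax := EReal.coe_lt_coe_iff.1 hax
  have hb : ratio RΘ ψ x₀ < ratio RΘ ψ β := T.mono self_mem_Ici hβ.le hβ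
  obtain ⟨γ, hγ, e⟩ := intermediate_value_Ioo' hx'.2.le
    (T.cont_ratio.mono fun z hz => hx'.1.trans_le hz.1) ⟨hb, hax⟩
  exact ⟨γ, hx'.1.trans hγ.1, hγ.2, e⟩

lemma gam_spec (T : TurningData ξ RΘ ψ x₀) (hβ : x₀ < β) (hβ' : (β : EReal) < xHigh RΘ ψ) :
    0 < Gam ξ RΘ ψ β ∧ Gam ξ RΘ ψ β < x₀ ∧ ratio RΘ ψ (Gam ξ RΘ ψ β) = ratio RΘ ψ β := by
  obtain ⟨γ, h0, h1, e⟩ := T.exists_left hβ hβ'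
  have h := Classical.epsilon_spec
    (p := fun γ : ℝ => 0 < γ ∧ (γ : EReal) < xLow ξ RΘ ψ ∧ SignPattern RΘ ψ γ β)
    ⟨γ, h0, by rw [T.low]; exact EReal.coe_lt_coe_iff.2 h1, T.signPattern h0 h1 hβ e⟩
  exact ⟨h.1, EReal.coe_lt_coe_iff.1 (h.2.1.trans_eq T.low), sub_eq_zero.1 h.2.2.2.1⟩

lemma lt_gam_iff (T : TurningData ξ RΘ ψ x₀) (hβ : x₀ < β) (hβ' : (β : EReal) < xHigh RΘ ψ)
    (hx : 0 < x) (hx' : x < x₀) : x < Gam ξ RΘ ψ β ↔ ratio RΘ ψ β < ratio RΘ ψ x := by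
  obtain ⟨h0, h1, e⟩ := T.gam_spec hβ hβ'
  rw [← e]
  exact (T.anti.lt_iff_gt ⟨h0, h1.le⟩ ⟨hx, hx'.le⟩).symm

lemma gam_lt_iff (T : TurningData ξ RΘ ψ x₀) (hβ : x₀ < β) (hβ' : (β : EReal) < xHigh RΘ ψ)
    (hx : 0 < x) (hx' : x < x₀) : Gam ξ RΘ ψ β < x ↔ ratio RΘ ψ x < ratio RΘ ψ β := by
  obtain ⟨h0, h1, e⟩ := T.gam_spec hβ hβ'
  rw [← e]
  exact (T.anti.lt_iff_gt ⟨hx, hx'.le⟩ ⟨h0, h1.le⟩).symm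

lemma eventually_lt_xHigh (hβ' : (β : EReal) < xHigh RΘ ψ) :
    ∀ᶠ s in 𝓝 β, ((s : ℝ) : EReal) < xHigh RΘ ψ :=
  continuous_coe_real_ereal.continuousAt.eventually_lt_const hβ'

/-- By `lt_gam_iff` and `gam_lt_iff`, comparing `Γ(β)` with a fixed point of the left branch amounts
to a strict inequality on `ρ(β)`, an open condition. -/
lemma continuousAt_gam (T : TurningData ξ RΘ ψ x₀) (hβ : x₀ < β)
    (hβ' : (β : EReal) < xHigh RΘ ψ) : ContinuousAt (Gam ξ RΘ ψ) β := by
  obtain ⟨h0, h1, -⟩ := T.gam_spec hβ hβ'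
  have hρ := (T.deriv_ratio β (T.x₀_pos.trans hβ)).continuousAt
  refine tendsto_order.2 ⟨fun a ha => ?_, fun a ha => ?_⟩
  · obtain ⟨a', ha', ha''⟩ := exists_between (max_lt ha h0)
    have ha0 := (le_max_right _ _).trans_lt ha'
    filter_upwards [eventually_lt_xHigh hβ', Ioi_mem_nhds hβ,
      hρ.eventually_lt_const ((T.lt_gam_iff hβ hβ' ha0 (ha''.trans h1)).1 ha'')] with s k1 k2 k3
    exact ((le_max_left _ _).trans_lt ha').trans
      ((T.lt_gam_iff k2 k1 ha0 (ha''.trans h1)).2 k3)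
  · obtain ⟨a', ha', ha''⟩ := exists_between (lt_min ha h1)
    have ha0 := ha''.trans_le (min_le_right _ _)
    filter_upwards [eventually_lt_xHigh hβ', Ioi_mem_nhds hβ,
      hρ.eventually_const_lt ((T.gam_lt_iff hβ hβ' (h0.trans ha') ha0).1 ha')] with s k1 k2 k3
    exact ((T.gam_lt_iff k2 k1 (h0.trans ha') ha0).2 k3).trans (ha''.trans_le (min_le_left _ _))

lemma F_gam_lt (T : TurningData ξ RΘ ψ x₀) (h₁ : x₀ < β₁) (hβ : β₁ < β₂)
    (h₂ : (β₂ : EReal) < xHigh RΘ ψ) :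
    F RΘ ψ (Gam ξ RΘ ψ β₂) β₂ < F RΘ ψ (Gam ξ RΘ ψ β₁) β₁ := by
  obtain ⟨a0, a1, a2⟩ := T.gam_spec h₁ ((EReal.coe_lt_coe_iff.2 hβ).trans h₂)
  obtain ⟨c0, c1, c2⟩ := T.gam_spec (h₁.trans hβ) h₂
  exact T.F_lt_F a0 a1 h₁ a2 c0 c1 c2 hβ

lemma neBot_comap (T : TurningData ξ RΘ ψ x₀) :
    (comap (fun β : ℝ => (β : EReal)) (𝓝[<] xHigh RΘ ψ)).NeBot := by
  refine comap_neBot fun t ht => ?_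
  obtain ⟨a, ha, hat⟩ := (mem_nhdsLT_iff_exists_Ioo_subset' T.lt_xHigh).1 ht
  obtain ⟨s, hs, hs'⟩ := EReal.lt_iff_exists_real_btwn.1 (mem_Iio.1 ha)
  exact ⟨s, hat ⟨hs, hs'⟩⟩

/-- `F(Γ(β), β)` decreases in `β`, so its limit at `x̄` from the left is its infimum. The filter on
the reals is nontrivial even if `x̄ = ∞`. -/
lemma cStar_eq (T : TurningData ξ RΘ ψ x₀) : cStar ξ RΘ ψ =
    -⨅ β ∈ {β : ℝ | x₀ < β ∧ (β : EReal) < xHigh RΘ ψ},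
      (F RΘ ψ (Gam ξ RΘ ψ β) β : EReal) := by
  have hne := T.neBot_comap
  rw [cStar]
  congr 1
  have hmem : ∀ a : ℝ, (a : EReal) < xHigh RΘ ψ →
      ∀ᶠ s : ℝ in comap (fun β : ℝ => (β : EReal)) (𝓝[<] xHigh RΘ ψ),
        a < s ∧ (s : EReal) < xHigh RΘ ψ := fun a ha => by
    filter_upwards [preimage_mem_comap (Ioo_mem_nhdsLT ha)] with s hs
    exact ⟨EReal.coe_lt_coe_iff.1 hs.1, hs.2⟩
  refine Tendsto.limUnder_eq (tendsto_order.2 ⟨fun a ha => ?_, fun a ha => ?_⟩)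
  · filter_upwards [hmem x₀ T.lt_xHigh] with s hs
    exact ha.trans_le (iInf₂_le (f := fun (β : ℝ) (_ : β ∈ {β : ℝ | x₀ < β ∧
      (β : EReal) < xHigh RΘ ψ}) => (F RΘ ψ (Gam ξ RΘ ψ β) β : EReal)) s hs)
  · obtain ⟨β, hβ⟩ := iInf_lt_iff.1 ha
    obtain ⟨hβ', hβa⟩ := iInf_lt_iff.1 hβ
    filter_upwards [hmem β hβ'.2] with s hs
    exact (EReal.coe_lt_coe_iff.2 (T.F_gam_lt hβ'.1 hs.1 hs.2)).trans hβa

lemma exists_F_gam_gt (T : TurningData ξ RΘ ψ x₀) {c : ℝ} (hc : 0 < c) (h₁ : x₀ < β₁)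
    (h₁' : (β₁ : EReal) < xHigh RΘ ψ) :
    ∃ β, x₀ < β ∧ β < β₁ ∧ -c < F RΘ ψ (Gam ξ RΘ ψ β) β := by
  have hG := (T.deriv_G x₀ T.x₀_pos).continuousAt
  have hG1 : ∀ᶠ s in 𝓝 x₀, |G RΘ ψ s - G RΘ ψ x₀| < c / 2 := by
    have := (Metric.tendsto_nhds.1 hG.tendsto) (c / 2) (half_pos hc)
    simpa [Real.dist_eq] using this
  obtain ⟨δ, hδ, hball⟩ := Metric.eventually_nhds_iff.1 hG1
  -- A positive point of the left branch within `δ` of `x₀`. Once `ρ(β) < ρ(γ₀)`, `Γ(β)` is trapped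
  -- between `γ₀` and `x₀`, so `G_Θ` is nearly constant across the pair.
  set γ₀ := max (x₀ - δ / 2) (x₀ / 2) with hγ₀
  have hγ0 : 0 < γ₀ := (half_pos T.x₀_pos).trans_le (le_max_right _ _)
  have hγx : γ₀ < x₀ := max_lt (by linarith) (half_lt_self T.x₀_pos)
  have hργ : ratio RΘ ψ x₀ < ratio RΘ ψ γ₀ := T.anti ⟨hγ0, hγx.le⟩ ⟨T.x₀_pos, le_rfl⟩ hγx
  have h5 : ∀ᶠ s in 𝓝[>] x₀, ratio RΘ ψ s < ratio RΘ ψ γ₀ :=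
    ((T.deriv_ratio x₀ T.x₀_pos).continuousAt.eventually_lt_const hργ).filter_mono
      nhdsWithin_le_nhds
  obtain ⟨β, hβ, hβ'⟩ := (h5.and (Ioo_mem_nhdsGT (lt_min h₁ (lt_add_of_pos_right x₀ hδ)))).exists
  have hββ : β < β₁ := hβ'.2.trans_le (min_le_left _ _)
  have hβδ : β < x₀ + δ := hβ'.2.trans_le (min_le_right _ _)
  have hβx := (EReal.coe_lt_coe_iff.2 hββ).trans h₁'
  refine ⟨β, hβ'.1, hββ, ?_⟩
  have hgt := (T.lt_gam_iff hβ'.1 hβx hγ0 hγx).2 hβ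
  obtain ⟨g0, g1, -⟩ := T.gam_spec hβ'.1 hβx
  have hγδ : x₀ - δ / 2 ≤ γ₀ := le_max_left _ _
  have k1 := hball (y := β) (by rw [Real.dist_eq, abs_of_pos (sub_pos.2 hβ'.1)]; linarith)
  have k2 := hball (y := Gam ξ RΘ ψ β) (by
    rw [Real.dist_eq, abs_of_neg (sub_neg.2 g1)]; linarith)
  rw [abs_lt] at k1 k2
  rw [F]
  linarith [k1.1, k2.2]

theorem exists_freeBoundary (T : TurningData ξ RΘ ψ x₀) {c : ℝ} (hc : 0 < c)
    (hc' : (c : EReal) < cStar ξ RΘ ψ) : ∃ γ β, IsFreeBoundary ξ RΘ ψ c γ β := by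
  rw [T.cStar_eq, EReal.lt_neg_comm] at hc'
  obtain ⟨β₁, h⟩ := iInf_lt_iff.1 hc'
  obtain ⟨hβ₁, h₁⟩ := iInf_lt_iff.1 h
  rw [← EReal.coe_neg] at h₁
  have h₁ := EReal.coe_lt_coe_iff.1 h₁
  obtain ⟨β₀, h0, h01, h₀⟩ := T.exists_F_gam_gt hc hβ₁.1 hβ₁.2
  have hcont : ContinuousOn (fun β => F RΘ ψ (Gam ξ RΘ ψ β) β) (Icc β₀ β₁) := by
    intro β hβ
    have k1 := h0.trans_le hβ.1
    have k2 : (β : EReal) < xHigh RΘ ψ := (EReal.coe_le_coe_iff.2 hβ.2).trans_lt hβ₁.2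
    refine ContinuousAt.continuousWithinAt ?_
    exact (T.deriv_G β (T.x₀_pos.trans k1)).continuousAt.sub
      (ContinuousAt.comp (T.deriv_G _ (T.gam_spec k1 k2).1).continuousAt
        (T.continuousAt_gam k1 k2))
  obtain ⟨β, hβ, e⟩ := intermediate_value_Icc' h01.le hcont ⟨h₁.le, h₀.le⟩
  have k1 := h0.trans_le hβ.1
  have k2 : (β : EReal) < xHigh RΘ ψ := (EReal.coe_le_coe_iff.2 hβ.2).trans_lt hβ₁.2
  obtain ⟨g0, g1, g2⟩ := T.gam_spec k1 k2
  exact ⟨Gam ξ RΘ ψ β, β, g0, by rw [T.low]; exact EReal.coe_lt_coe_iff.2 g1,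
    by rw [T.low]; exact EReal.coe_lt_coe_iff.2 k1, k2, T.signPattern g0 g1 k1 g2, e⟩

end TurningData

/-! ### Asymptotics of the resolvent and of the primitive of `k` -/

namespace GreenData

variable {b σ r φ ψ F F₁ F₂ : ℝ → ℝ} {x δ : ℝ}

lemma greenKernel_le_lower (H : GreenData b σ r φ ψ) (hx : 0 < x) {y : ℝ} (hy : 0 < y) :
    greenKernel σ φ ψ x y ≤ φ x * ψ y * weight σ φ ψ y :=
  mul_le_mul_of_nonneg_right (mul_le_mul
    (H.anti_φ.antitoneOn hx (mem_Ioi.2 (hx.trans_le (le_max_left _ _))) (le_max_left _ _))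
    (H.mono_ψ.monotoneOn (mem_Ioi.2 (lt_min hx hy)) hy (min_le_right _ _))
    (H.fund.ψ_pos _ (lt_min hx hy)).le (H.fund.φ_pos x hx).le) (H.weight_pos hy).le

lemma greenKernel_le_upper (H : GreenData b σ r φ ψ) (hx : 0 < x) {y : ℝ} (hy : 0 < y) :
    greenKernel σ φ ψ x y ≤ ψ x * φ y * weight σ φ ψ y := by
  rw [mul_comm (ψ x)]
  exact mul_le_mul_of_nonneg_right (mul_le_mul
    (H.anti_φ.antitoneOn hy (mem_Ioi.2 (hx.trans_le (le_max_left _ _))) (le_max_right _ _))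
    (H.mono_ψ.monotoneOn (mem_Ioi.2 (lt_min hx hy)) hx (min_le_left _ _))
    (H.fund.ψ_pos _ (lt_min hx hy)).le (H.fund.φ_pos y hy).le) (H.weight_pos hy).le

lemma greenIntegrable_abs (H : GreenData b σ r φ ψ) (hi : GreenIntegrable σ φ ψ F) :
    GreenIntegrable σ φ ψ fun y => |F y| := by
  intro x hx
  have h := hi x hx
  refine ⟨(integrableOn_congr_fun (fun y hy => ?_) measurableSet_Ioc).1 h.1.norm,
    (integrableOn_congr_fun (fun y hy => ?_) measurableSet_Ioi).1 h.2.norm⟩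
  · rw [norm_mul, norm_mul, Real.norm_of_nonneg (H.fund.ψ_pos y hy.1).le,
      Real.norm_of_nonneg (H.weight_pos hy.1).le, Real.norm_eq_abs]
  · have hy0 : 0 < y := hx.trans hy
    rw [norm_mul, norm_mul, Real.norm_of_nonneg (H.fund.φ_pos y hy0).le,
      Real.norm_of_nonneg (H.weight_pos hy0).le, Real.norm_eq_abs]

/-- The kernel is bounded by both `φ(x) ψ(y) q(y)` and `ψ(x) φ(y) q(y)` for every `y`, so the
integral may be split at a point `δ` independent of `x`. Choosing `δ` first and letting `x` move
afterwards gives the asymptotics at `0` and `∞`. -/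
lemma abs_greenSol_le (H : GreenData b σ r φ ψ) (hi : GreenIntegrable σ φ ψ F) (hx : 0 < x)
    (hδ : 0 < δ) : |greenSol σ φ ψ F x| ≤
      φ x * lowerInt σ φ ψ (fun y => |F y|) δ + ψ x * upperInt σ φ ψ (fun y => |F y|) δ := by
  have hm := (H.integrable_greenMeasure_iff' hx).2 (hi x hx)
  have hk := (H.integrable_greenMeasure_iff hx).1 hm
  have ha := H.greenIntegrable_abs hi δ hδ
  rw [← H.integral_greenMeasure_eq hx hm, H.integral_greenMeasure hx]
  rw [← Ioc_union_Ioi_eq_Ioi hδ.le, integrableOn_union] at hk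
  rw [← Ioc_union_Ioi_eq_Ioi hδ.le,
    setIntegral_union (Ioc_disjoint_Ioi le_rfl) measurableSet_Ioi hk.1 hk.2]
  refine (abs_add_le _ _).trans (add_le_add ?_ ?_)
  · rw [lowerInt, ← integral_const_mul, ← Real.norm_eq_abs]
    refine norm_integral_le_of_norm_le (ha.1.const_mul _) ?_
    filter_upwards [ae_restrict_mem measurableSet_Ioc] with y hy
    rw [norm_mul, Real.norm_of_nonneg (H.greenKernel_pos hx hy.1).le, Real.norm_eq_abs]
    have := mul_le_mul_of_nonneg_right (H.greenKernel_le_lower hx hy.1) (abs_nonneg (F y))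
    linarith
  · rw [upperInt, ← integral_const_mul, ← Real.norm_eq_abs]
    refine norm_integral_le_of_norm_le (ha.2.const_mul _) ?_
    filter_upwards [ae_restrict_mem measurableSet_Ioi] with y hy
    have hy0 : 0 < y := hδ.trans hy
    rw [norm_mul, Real.norm_of_nonneg (H.greenKernel_pos hx hy0).le, Real.norm_eq_abs]
    have := mul_le_mul_of_nonneg_right (H.greenKernel_le_upper hx hy0) (abs_nonneg (F y))
    linarith

lemma tendsto_ψ_div_φ (H : GreenData b σ r φ ψ) :
    Tendsto (fun x => ψ x / φ x) (𝓝[>] 0) (𝓝 0) := by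
  refine squeeze_zero' ?_ ?_ ((tendsto_const_nhds (x := ψ 1)).div_atTop H.fund.φ_lim)
  · filter_upwards [self_mem_nhdsWithin] with x hx
    exact (div_pos (H.fund.ψ_pos x hx) (H.fund.φ_pos x hx)).le
  · filter_upwards [Ioo_mem_nhdsGT one_pos] with x hx
    exact div_le_div_of_nonneg_right
      (H.mono_ψ.monotoneOn hx.1 (mem_Ioi.2 one_pos) hx.2.le) (H.fund.φ_pos x hx.1).le

lemma tendsto_φ_div_ψ (H : GreenData b σ r φ ψ) :
    Tendsto (fun x => φ x / ψ x) atTop (𝓝 0) := by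
  refine squeeze_zero' ?_ ?_ ((tendsto_const_nhds (x := φ 1)).div_atTop H.fund.ψ_lim)
  · filter_upwards [Ioi_mem_atTop 0] with x hx
    exact (div_pos (H.fund.φ_pos x hx) (H.fund.ψ_pos x hx)).le
  · filter_upwards [eventually_ge_atTop 1] with x hx
    have hx0 : 0 < x := one_pos.trans_le hx
    exact div_le_div_of_nonneg_right
      (H.anti_φ.antitoneOn (mem_Ioi.2 one_pos) hx0 hx) (H.fund.ψ_pos x hx0).le

lemma tendsto_greenSol_div_φ (H : GreenData b σ r φ ψ) (hi : GreenIntegrable σ φ ψ F) :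
    Tendsto (fun x => greenSol σ φ ψ F x / φ x) (𝓝[>] 0) (𝓝 0) := by
  rw [Metric.tendsto_nhds]
  intro ε hε
  have hl : Tendsto (lowerInt σ φ ψ fun y => |F y|) (𝓝[>] 0) (𝓝 0) :=
    tendsto_integral_Ioc_zero one_pos (H.greenIntegrable_abs hi 1 one_pos).1
  obtain ⟨δ, hδ, hδ0⟩ := ((hl.eventually_lt_const (half_pos hε)).and self_mem_nhdsWithin).exists
  have hu := H.tendsto_ψ_div_φ.mul_const (upperInt σ φ ψ (fun y => |F y|) δ)
  rw [zero_mul] at hu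
  filter_upwards [hu.eventually_lt_const (half_pos hε), self_mem_nhdsWithin] with x h1 hx
  have hφ := H.fund.φ_pos x hx
  rw [Real.dist_eq, sub_zero, abs_div, abs_of_pos hφ, div_lt_iff₀ hφ]
  refine (H.abs_greenSol_le hi hx hδ0).trans_lt ?_
  rw [div_mul_eq_mul_div, div_lt_iff₀ hφ] at h1
  have := mul_lt_mul_of_pos_left hδ hφ
  linarith

lemma tendsto_greenSol_div_ψ (H : GreenData b σ r φ ψ) (hi : GreenIntegrable σ φ ψ F) :
    Tendsto (fun x => greenSol σ φ ψ F x / ψ x) atTop (𝓝 0) := by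
  rw [Metric.tendsto_nhds]
  intro ε hε
  have hl : Tendsto (upperInt σ φ ψ fun y => |F y|) atTop (𝓝 0) :=
    tendsto_integral_Ioi_atTop fun x hx => (H.greenIntegrable_abs hi x hx).2
  obtain ⟨δ, hδ, hδ0⟩ := ((hl.eventually_lt_const (half_pos hε)).and (Ioi_mem_atTop 0)).exists
  have hu := H.tendsto_φ_div_ψ.mul_const (lowerInt σ φ ψ (fun y => |F y|) δ)
  rw [zero_mul] at hu
  filter_upwards [hu.eventually_lt_const (half_pos hε), Ioi_mem_atTop 0] with x h1 hx
  have hψ := H.fund.ψ_pos x hx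
  rw [Real.dist_eq, sub_zero, abs_div, abs_of_pos hψ, div_lt_iff₀ hψ]
  refine (H.abs_greenSol_le hi hx hδ0).trans_lt ?_
  rw [div_mul_eq_mul_div, div_lt_iff₀ hψ] at h1
  have := mul_lt_mul_of_pos_left hδ hψ
  linarith

lemma greenIntegrable_add (h₁ : GreenIntegrable σ φ ψ F₁) (h₂ : GreenIntegrable σ φ ψ F₂) :
    GreenIntegrable σ φ ψ fun y => F₁ y + F₂ y := fun x hx => by
  simp only [add_mul, mul_add]
  exact ⟨(h₁ x hx).1.add (h₂ x hx).1, (h₁ x hx).2.add (h₂ x hx).2⟩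

lemma greenSol_add (h₁ : GreenIntegrable σ φ ψ F₁) (h₂ : GreenIntegrable σ φ ψ F₂) (hx : 0 < x) :
    greenSol σ φ ψ (fun y => F₁ y + F₂ y) x = greenSol σ φ ψ F₁ x + greenSol σ φ ψ F₂ x := by
  simp only [greenSol, lowerInt, upperInt, add_mul, mul_add]
  rw [integral_add (h₁ x hx).1 (h₂ x hx).1, integral_add (h₁ x hx).2 (h₂ x hx).2]
  ring

/-- Positivity of the kernel, compared with `C R_r = C`. -/
lemma le_greenSol (H : GreenData b σ r φ ψ) (hone : ∀ x, 0 < x → greenSol σ φ ψ r x = 1)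
    (hi : GreenIntegrable σ φ ψ F) {C : ℝ} (hC : ∀ y, 0 < y → C * r y ≤ F y) (hx : 0 < x) :
    C ≤ greenSol σ φ ψ F x := by
  have hr := (H.integrable_greenMeasure_iff' hx).2 ⟨(H.lower_r hx).1, (H.upper_r hx).1⟩
  have hF := (H.integrable_greenMeasure_iff' hx).2 (hi x hx)
  have e := H.integral_greenMeasure_eq hx hr
  rw [hone x hx] at e
  rw [← H.integral_greenMeasure_eq hx hF, ← mul_one C, ← e, ← integral_const_mul]
  refine integral_mono_ae (hr.const_mul C) hF ?_
  have h0 : ∀ᵐ y ∂(volume.restrict (Ioi (0 : ℝ))), y ∈ Ioi (0 : ℝ) :=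
    ae_restrict_mem measurableSet_Ioi
  filter_upwards [(withDensity_absolutelyContinuous _ _).ae_le h0] with y hy using hC y hy

/-- The Wronskians of `(z, ψ)` and `(φ, z)` are constant multiples of that of `(φ, ψ)`, and `z W(φ,
ψ) = φ W(z, ψ) + ψ W(φ, z)`. -/
lemma exists_combination (H : GreenData b σ r φ ψ) {z : ℝ → ℝ} (hz : ContDiffOn ℝ 2 z (Ioi 0))
    (hz0 : ∀ x, 0 < x → opL b σ r z x = 0) :
    ∃ A B : ℝ, ∀ x, 0 < x → z x = A * φ x + B * ψ x := by
  have hconst : ∀ {u v : ℝ → ℝ}, ContDiffOn ℝ 2 u (Ioi 0) → ContDiffOn ℝ 2 v (Ioi 0) →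
      (∀ x, 0 < x → opL b σ r u x = 0) → (∀ x, 0 < x → opL b σ r v x = 0) →
      ∃ A, ∀ x, 0 < x → wronskian u v x = A * wronskian φ ψ x := by
    intro u v hu hv hu0 hv0
    have hd : ∀ x, 0 < x → HasDerivAt (fun x => wronskian u v x / wronskian φ ψ x) 0 x := by
      intro x hx
      refine ((H.hasDerivAt_wronskian_of hx hu hv (hu0 x hx) (hv0 x hx)).div
        (H.hasDerivAt_wronskian hx) (H.wronskian_pos hx).ne').congr_deriv ?_
      ring
    obtain ⟨A, hA⟩ := isOpen_Ioi.exists_is_const_of_deriv_eq_zero isPreconnected_Ioi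
      (fun x hx => (hd x hx).differentiableAt.differentiableWithinAt)
      (fun x hx => (hd x hx).deriv)
    refine ⟨A, fun x hx => ?_⟩
    rw [← hA x hx, div_mul_cancel₀ _ (H.wronskian_pos hx).ne']
  obtain ⟨A, hA⟩ := hconst hz H.fund.ψ_smooth hz0 H.fund.ψ_ode
  obtain ⟨B, hB⟩ := hconst H.fund.φ_smooth hz H.fund.φ_ode hz0
  refine ⟨A, B, fun x hx => ?_⟩
  have h1 := hA x hx
  have h2 := hB x hx
  have hW := (H.wronskian_pos hx).ne'
  rw [← mul_left_inj' hW, add_mul]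
  rw [wronskian] at h1 h2
  rw [wronskian] at h1 h2 ⊢
  linear_combination φ x * h1 + ψ x * h2

end GreenData

/-! ### Regularity of `k` and growth of its primitive. -/

section PrimK

variable {b σ r φ ψ h k : ℝ → ℝ} {x : ℝ}

/-- Regularity of the marginal profit `k`. -/
structure ProfitData (b σ r k : ℝ → ℝ) : Prop where
  ac : ∀ u v, 0 < u → u < v → AbsolutelyContinuousOnInterval k u v
  int : IntegrableOn k (Ioc 0 1)
  L_cont : ContinuousOn (opL b σ r (primK k)) (Ioi 0)

namespace ProfitData

lemma cont (K : ProfitData b σ r k) : ContinuousOn k (Ioi 0) := by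
  intro x hx
  have hx : 0 < x := hx
  have h := (K.ac (x / 2) (2 * x) (half_pos hx) (by linarith)).continuousOn
  rw [uIcc_of_le (by linarith)] at h
  exact (h.continuousAt (Icc_mem_nhds (by linarith) (by linarith))).continuousWithinAt

lemma intOn (K : ProfitData b σ r k) (x : ℝ) : IntegrableOn k (Ioc 0 x) := by
  rcases le_total x 1 with hx | hx
  · exact K.int.mono_set (Ioc_subset_Ioc_right hx)
  · rw [← Ioc_union_Ioc_eq_Ioc zero_le_one hx]
    exact K.int.union (integrableOn_Ioc_of_Ioi K.cont one_pos)

lemma hasDerivAt_primK (K : ProfitData b σ r k) (hx : 0 < x) : HasDerivAt (primK k) (k x) x :=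
  hasDerivAt_intervalIntegral_zero K.cont hx (K.intOn x)

lemma deriv_deriv_primK (K : ProfitData b σ r k) (hx : 0 < x) :
    deriv (deriv (primK k)) x = deriv k x := by
  refine EventuallyEq.deriv_eq ?_
  filter_upwards [Ioi_mem_nhds hx] with y hy using (K.hasDerivAt_primK hy).deriv

/-- Since `σ > 0`, the expression `𝓛 (∫_0^· k)` can be solved for `k'`, which inherits its
continuity. -/
lemma cont_deriv (K : ProfitData b σ r k) (H : GreenData b σ r φ ψ) :
    ContinuousOn (deriv k) (Ioi 0) := by
  have hK : ContinuousOn (primK k) (Ioi 0) := fun x hx =>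
    (K.hasDerivAt_primK hx).continuousAt.continuousWithinAt
  have hc : ContinuousOn (fun x => 2 / σ x ^ 2 *
      (opL b σ r (primK k) x - b x * k x + r x * primK k x)) (Ioi 0) :=
    (continuousOn_const.div (H.σ_cont.pow 2) fun x hx => (pow_pos (H.σ_pos x hx) 2).ne').mul
      ((K.L_cont.sub (H.b_cont.mul K.cont)).add (H.r_cont.mul hK))
  refine hc.congr fun x hx => ?_
  have hσ := (H.σ_pos x hx).ne'
  simp only [opL]
  rw [K.deriv_deriv_primK hx, (K.hasDerivAt_primK hx).deriv]
  field_simp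
  ring

/-- Absolute continuity makes `k` the integral of its pointwise derivative; as that is continuous,
`k` is differentiable everywhere. -/
lemma hasDerivAt (K : ProfitData b σ r k) (H : GreenData b σ r φ ψ) (hx : 0 < x) :
    HasDerivAt k (deriv k x) x := by
  have hc := K.cont_deriv H
  have h2 : 0 < x / 2 := half_pos hx
  have h3 : x / 2 < x := half_lt_self hx
  have hi : IntervalIntegrable (deriv k) volume (x / 2) x :=
    (intervalIntegrable_iff_integrableOn_Ioc_of_le h3.le).2 (integrableOn_Ioc_of_Ioi hc h2)
  have h := (intervalIntegral.integral_hasDerivAt_right hi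
    (hc.stronglyMeasurableAtFilter isOpen_Ioi x hx)
    (hc.continuousAt (Ioi_mem_nhds hx))).const_add (k (x / 2))
  refine h.congr_of_eventuallyEq ?_
  filter_upwards [Ioi_mem_nhds h3] with y hy
  rw [(K.ac (x / 2) y h2 hy).integral_deriv_eq_sub]
  ring

lemma contDiffOn_k (K : ProfitData b σ r k) (H : GreenData b σ r φ ψ) :
    ContDiffOn ℝ 1 k (Ioi 0) :=
  contDiffOn_one_of_hasDerivAt isOpen_Ioi (fun _ hx => K.hasDerivAt H hx) (K.cont_deriv H)

lemma contDiffOn_primK (K : ProfitData b σ r k) (H : GreenData b σ r φ ψ) :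
    ContDiffOn ℝ 2 (primK k) (Ioi 0) :=
  contDiffOn_two_of_hasDerivAt isOpen_Ioi (fun _ hx => K.hasDerivAt_primK hx)
    (fun _ hx => K.hasDerivAt H hx) (K.cont_deriv H)

lemma integral_eq (K : ProfitData b σ r k) {a y : ℝ} (ha : 0 < a) (hy : 0 < y) :
    ∫ s in a..y, k s = primK k y - primK k a :=
  integral_eq_sub_of_hasDerivAt_Ioi (fun _ hx => K.hasDerivAt_primK hx) K.cont ha hy

/-- `∫_0^x k` grows like a multiple of `ψ`, up to the resolvent of `𝓛 (∫_0^· k)`. -/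
theorem exists_limit (K : ProfitData b σ r k) (H : GreenData b σ r φ ψ)
    (hi : GreenIntegrable σ φ ψ (opL b σ r (primK k))) {M : ℝ}
    (hM : ∀ x, 0 < x → M ≤ primK k x) :
    ∃ Kinf : ℝ, 0 ≤ Kinf ∧ Tendsto (fun x => primK k x / ψ x) atTop (𝓝 Kinf) ∧
      ∀ x, 0 < x → primK k x + greenSol σ φ ψ (opL b σ r (primK k)) x = Kinf * ψ x := by
  set N := greenSol σ φ ψ (opL b σ r (primK k)) with hN
  have hN2 : ContDiffOn ℝ 2 N (Ioi 0) := H.contDiffOn_greenSol K.L_cont hi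
  have hK2 := K.contDiffOn_primK H
  have hz0 : ∀ x, 0 < x → opL b σ r (primK k + N) x = 0 := by
    intro x hx
    have h1 := H.opL_greenSol K.L_cont hi hx
    have d1 : deriv (primK k + N) =ᶠ[𝓝 x] deriv (primK k) + deriv N := by
      filter_upwards [Ioi_mem_nhds hx] with z hz
      exact ((hasDerivAt_of_contDiffOn hK2 hz).add (hasDerivAt_of_contDiffOn hN2 hz)).deriv
    have d2 : deriv (deriv (primK k + N)) x = deriv (deriv (primK k)) x + deriv (deriv N) x := by
      rw [d1.deriv_eq]
      exact ((hasDerivAt_deriv_of_contDiffOn hK2 hx).add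
        (hasDerivAt_deriv_of_contDiffOn hN2 hx)).deriv
    rw [← hN] at h1
    simp only [opL] at h1 ⊢
    rw [d2, d1.eq_of_nhds, Pi.add_apply, Pi.add_apply]
    linear_combination h1
  obtain ⟨A, B, hAB⟩ := H.exists_combination (hK2.add hN2) hz0
  -- Divided by `φ`, both the primitive and the resolvent vanish at `0`.
  have hA : A = 0 := by
    have t1 : Tendsto (fun x => primK k x / φ x + N x / φ x) (𝓝[>] 0) (𝓝 (0 + 0)) := by
      refine Tendsto.add ?_ (H.tendsto_greenSol_div_φ hi)
      have hk0 : Tendsto (primK k) (𝓝[>] 0) (𝓝 0) := by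
        refine (tendsto_integral_Ioc_zero one_pos K.int).congr' ?_
        filter_upwards [self_mem_nhdsWithin] with x hx
        rw [primK, intervalIntegral.integral_of_le (le_of_lt hx)]
      exact hk0.div_atTop H.fund.φ_lim
    have t2 : Tendsto (fun x => A + B * (ψ x / φ x)) (𝓝[>] 0) (𝓝 (A + B * 0)) :=
      (H.tendsto_ψ_div_φ.const_mul B).const_add A
    have := tendsto_nhds_unique (t1.congr' ?_) t2
    · linarith
    · filter_upwards [self_mem_nhdsWithin] with x hx
      have := hAB x hx
      have hφ := (H.fund.φ_pos x hx).ne'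
      rw [← add_div, this]
      field_simp
  have hB : ∀ x, 0 < x → primK k x + N x = B * ψ x := fun x hx => by
    have := hAB x hx
    rwa [hA, zero_mul, zero_add] at this
  have ht : Tendsto (fun x => primK k x / ψ x) atTop (𝓝 B) := by
    have := (H.tendsto_greenSol_div_ψ hi).const_sub B
    rw [sub_zero] at this
    refine this.congr' ?_
    filter_upwards [Ioi_mem_atTop 0] with x hx
    have hψ := (H.fund.ψ_pos x hx).ne'
    have := hB x hx
    rw [← hN, eq_div_iff hψ, sub_mul, div_mul_cancel₀ _ hψ]
    linarith
  refine ⟨B, ?_, ht, hB⟩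
  have hMψ : Tendsto (fun x => M / ψ x) atTop (𝓝 0) := tendsto_const_nhds.div_atTop H.fund.ψ_lim
  refine le_of_tendsto_of_tendsto hMψ ht ?_
  filter_upwards [Ioi_mem_atTop 0] with x hx
  exact div_le_div_of_nonneg_right (hM x hx) (H.fund.ψ_pos x hx).le

end ProfitData

end PrimK

/-! ### The candidate value function -/

lemma opL_of_hasDerivAt {b σ r u u' : ℝ → ℝ} {x c : ℝ} (hx : 0 < x)
    (h1 : ∀ y, 0 < y → HasDerivAt u (u' y) y) (h2 : HasDerivAt u' c x) :
    opL b σ r u x = 1 / 2 * σ x ^ 2 * c + b x * u' x - r x * u x := by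
  have h : deriv u =ᶠ[𝓝 x] u' := by
    filter_upwards [Ioi_mem_nhds hx] with y hy using (h1 y hy).deriv
  rw [opL, h.deriv_eq, h2.deriv, h.eq_of_nhds]

/-- The part of the candidate that is not `∫_0^x k`: `R_Θ - ρ(β) ψ` on `]0, β[`, and constant
on `[β, ∞[`. -/
noncomputable def excess (RΘ ψ : ℝ → ℝ) (β x : ℝ) : ℝ :=
  if x < β then RΘ x - ratio RΘ ψ β * ψ x else G RΘ ψ β

/-- The function `R_Θ' - ρ(β) ψ'`, stopped at `β`. -/
noncomputable def excessDeriv (RΘ ψ : ℝ → ℝ) (β x : ℝ) : ℝ :=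
  deriv RΘ (min x β) - ratio RΘ ψ β * deriv ψ (min x β)

namespace RatioData

variable {b σ r φ ψ Θ RΘ : ℝ → ℝ} {x y ξ β γ c : ℝ}

lemma contDiffOn_R (D : RatioData b σ r φ ψ Θ RΘ ξ) : ContDiffOn ℝ 2 RΘ (Ioi 0) :=
  (D.green.contDiffOn_greenSol D.Θ_cont D.Θ_int).congr fun x hx => D.R_eq x hx

lemma opL_R (D : RatioData b σ r φ ψ Θ RΘ ξ) (hx : 0 < x) : opL b σ r RΘ x = -Θ x := by
  have h : RΘ =ᶠ[𝓝 x] greenSol σ φ ψ Θ := by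
    filter_upwards [Ioi_mem_nhds hx] with y hy using D.R_eq y hy
  rw [← D.green.opL_greenSol D.Θ_cont D.Θ_int hx, opL, opL, h.deriv.deriv_eq, h.deriv_eq,
    h.eq_of_nhds]

lemma excessDeriv_eq (D : RatioData b σ r φ ψ Θ RΘ ξ) (hx : 0 < x) (hxβ : x ≤ β) :
    excessDeriv RΘ ψ β x = deriv ψ x * (ratio RΘ ψ x - ratio RΘ ψ β) := by
  have hψ := (D.green.fund.ψ_incr x hx).ne'
  rw [excessDeriv, min_eq_left hxβ, mul_sub]
  nth_rewrite 2 [ratio]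
  rw [mul_div_cancel₀ _ hψ, mul_comm (deriv ψ x)]

lemma excessDeriv_eq_zero (D : RatioData b σ r φ ψ Θ RΘ ξ) (hβ : 0 < β) (hxβ : β ≤ x) :
    excessDeriv RΘ ψ β x = 0 := by
  have h := D.excessDeriv_eq hβ le_rfl
  rw [sub_self, mul_zero] at h
  rw [← h, excessDeriv, excessDeriv, min_eq_right hxβ, min_self]

lemma hasDerivAt_excess_aux (D : RatioData b σ r φ ψ Θ RΘ ξ) (hx : 0 < x) :
    HasDerivAt (fun x => RΘ x - ratio RΘ ψ β * ψ x)
      (deriv RΘ x - ratio RΘ ψ β * deriv ψ x) x :=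
  (hasDerivAt_of_contDiffOn D.contDiffOn_R hx).sub ((D.green.hasDerivAt_ψ hx).const_mul _)

/-- At `β` the left piece has value `G_Θ(β)` and slope `ψ'(β) (ρ(β) - ρ(β)) = 0`, matching the
constant on the right. -/
lemma hasDerivAt_excess (D : RatioData b σ r φ ψ Θ RΘ ξ) (hβ : 0 < β) (hx : 0 < x) :
    HasDerivAt (excess RΘ ψ β) (excessDeriv RΘ ψ β x) x := by
  rcases lt_trichotomy x β with h | rfl | h
  · rw [excessDeriv, min_eq_left h.le]
    refine (D.hasDerivAt_excess_aux hx).congr_of_eventuallyEq ?_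
    filter_upwards [Iio_mem_nhds h] with y hy
    rw [excess, if_pos (mem_Iio.1 hy)]
  · have h0 := D.excessDeriv_eq_zero hβ le_rfl
    have h1 := D.hasDerivAt_excess_aux (β := x) hx
    rw [excessDeriv, min_self] at h0 ⊢
    rw [h0] at h1 ⊢
    have e : excess RΘ ψ x x = G RΘ ψ x := by rw [excess, if_neg (lt_irrefl x)]
    have l : HasDerivWithinAt (excess RΘ ψ x) 0 (Iic x) x := by
      refine h1.hasDerivWithinAt.congr (fun y hy => ?_) e
      rcases (mem_Iic.1 hy).lt_or_eq with hlt | rfl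
      · rw [excess, if_pos hlt]
      · exact e
    have u : HasDerivWithinAt (excess RΘ ψ x) 0 (Ici x) x := by
      refine (hasDerivAt_const x (G RΘ ψ x)).hasDerivWithinAt.congr (fun y hy => ?_) e
      rw [excess, if_neg (not_lt.2 hy)]
    have := l.union u
    rwa [Iic_union_Ici, hasDerivWithinAt_univ] at this
  · rw [D.excessDeriv_eq_zero hβ h.le]
    refine (hasDerivAt_const x (G RΘ ψ β)).congr_of_eventuallyEq ?_
    filter_upwards [Ioi_mem_nhds h] with y hy
    rw [excess, if_neg (not_lt.2 (le_of_lt hy))]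

lemma contDiffOn_excessDeriv_aux (D : RatioData b σ r φ ψ Θ RΘ ξ) (β : ℝ) :
    ContDiffOn ℝ 1 (fun x => deriv RΘ x - ratio RΘ ψ β * deriv ψ x) (Ioi 0) :=
  (contDiffOn_deriv D.contDiffOn_R).sub
    (contDiffOn_const.mul (contDiffOn_deriv D.green.fund.ψ_smooth))

lemma cont_excessDeriv (D : RatioData b σ r φ ψ Θ RΘ ξ) (hβ : 0 < β) :
    ContinuousOn (excessDeriv RΘ ψ β) (Ioi 0) :=
  (D.contDiffOn_excessDeriv_aux β).continuousOn.comp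
    (continuous_id.min continuous_const).continuousOn fun _ hx => lt_min hx hβ

/-- Stopping at `β` is composition with `min · β`, which is 1-Lipschitz, so local Lipschitz bounds
survive the kink. -/
lemma lipschitzOn_excessDeriv (D : RatioData b σ r φ ψ Θ RΘ ξ) (hβ : 0 < β) {u v : ℝ}
    (hu : 0 < u) : ∃ K, LipschitzOnWith K (excessDeriv RΘ ψ β) (Icc u v) := by
  obtain ⟨K, hK⟩ := ((D.contDiffOn_excessDeriv_aux β).mono
    (fun x (hx : x ∈ Icc (min u β) (max v β)) => (lt_min hu hβ).trans_le hx.1)).exists_lipschitzOnWith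
    one_ne_zero (convex_Icc _ _) isCompact_Icc
  refine ⟨K * 1, hK.comp ((LipschitzWith.id.min_const β).lipschitzOnWith) fun x hx => ?_⟩
  exact ⟨min_le_min_right β hx.1, (min_le_right x β).trans (le_max_right _ _)⟩

lemma excess_monotoneOn (D : RatioData b σ r φ ψ Θ RΘ ξ) (hγ : 0 < γ) (hγβ : γ < β)
    (hs : SignPattern RΘ ψ γ β) : MonotoneOn (excess RΘ ψ β) (Ioc 0 γ) := by
  have hβ := hγ.trans hγβ
  refine monotoneOn_of_deriv_nonneg (convex_Ioc 0 γ)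
    (fun x hx => (D.hasDerivAt_excess hβ hx.1).continuousAt.continuousWithinAt) ?_ ?_
  · intro x hx
    rw [interior_Ioc] at hx
    exact (D.hasDerivAt_excess hβ hx.1).differentiableAt.differentiableWithinAt
  · intro x hx
    rw [interior_Ioc] at hx
    rw [(D.hasDerivAt_excess hβ hx.1).deriv, D.excessDeriv_eq hx.1 (hx.2.trans hγβ).le]
    exact mul_nonneg (D.green.fund.ψ_incr x hx.1).le (hs.1 x hx).le

lemma excess_antitoneOn (D : RatioData b σ r φ ψ Θ RΘ ξ) (hγ : 0 < γ) (hγβ : γ < β)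
    (hs : SignPattern RΘ ψ γ β) : AntitoneOn (excess RΘ ψ β) (Ici γ) := by
  have hβ := hγ.trans hγβ
  refine antitoneOn_of_deriv_nonpos (convex_Ici γ)
    (fun x hx => (D.hasDerivAt_excess hβ (hγ.trans_le hx)).continuousAt.continuousWithinAt) ?_ ?_
  · intro x hx
    rw [interior_Ici] at hx
    exact (D.hasDerivAt_excess hβ (hγ.trans hx)).differentiableAt.differentiableWithinAt
  · intro x hx
    rw [interior_Ici] at hx
    have hx0 := hγ.trans hx
    rw [(D.hasDerivAt_excess hβ hx0).deriv]
    rcases lt_or_ge x β with h | h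
    · rw [D.excessDeriv_eq hx0 h.le]
      exact mul_nonpos_of_nonneg_of_nonpos (D.green.fund.ψ_incr x hx0).le (hs.2.2 x ⟨hx, h⟩).le
    · rw [D.excessDeriv_eq_zero hβ h]

lemma excess_left (hγβ : γ < β) (hs : SignPattern RΘ ψ γ β) (hF : F RΘ ψ γ β = -c) :
    excess RΘ ψ β γ = G RΘ ψ β + c := by
  rw [excess, if_pos hγβ, ← sub_eq_zero.1 hs.2.1]
  rw [F] at hF
  change G RΘ ψ γ = _
  linarith

lemma excess_of_le (h : β ≤ x) : excess RΘ ψ β x = G RΘ ψ β := by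
  rw [excess, if_neg (not_lt.2 h)]

/-- The function rises to its maximum at `γ` and then falls by `c` in total, so no fall from left to
right exceeds `c`. -/
lemma excess_sub_le (D : RatioData b σ r φ ψ Θ RΘ ξ) (hγ : 0 < γ) (hγβ : γ < β)
    (hs : SignPattern RΘ ψ γ β) (hF : F RΘ ψ γ β = -c) (hc : 0 ≤ c) (hy : 0 < y) (hyx : y ≤ x) :
    excess RΘ ψ β y - excess RΘ ψ β x ≤ c := by
  have hm := D.excess_monotoneOn hγ hγβ hs
  have ha := D.excess_antitoneOn hγ hγβ hs
  have hl := excess_left hγβ hs hF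
  rcases le_total x γ with h | h
  · have := hm ⟨hy, hyx.trans h⟩ ⟨hy.trans_le hyx, h⟩ hyx
    linarith
  · have h1 : excess RΘ ψ β y ≤ excess RΘ ψ β γ := by
      rcases le_total y γ with h' | h'
      · exact hm ⟨hy, h'⟩ ⟨hγ, le_rfl⟩ h'
      · exact ha self_mem_Ici h' h'
    have h2 : excess RΘ ψ β (max x β) ≤ excess RΘ ψ β x :=
      ha h (mem_Ici.2 (h.trans (le_max_left _ _))) (le_max_left _ _)
    rw [excess_of_le (le_max_right _ _)] at h2
    linarith

end RatioData

/-! ### Verification of the HJB equation. -/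

section Candidate

variable {b σ r φ ψ h k RΘ w : ℝ → ℝ} {ξ β γ c : ℝ}

/-- Verification for a function `w` that equals the excess plus `∫_0^x k`. -/
theorem verification (D : RatioData b σ r φ ψ (Theta b σ r h k) RΘ ξ) (K : ProfitData b σ r k)
    (hγ : 0 < γ) (hγβ : γ < β) (hs : SignPattern RΘ ψ γ β) (hF : F RΘ ψ γ β = -c) (hc : 0 ≤ c)
    (hξβ : ξ < β) (hdβ : 0 < deriv (ratio RΘ ψ) β)
    (hw : ∀ x, 0 < x → w x = excess RΘ ψ β x + primK k x) :
    ContDiffOn ℝ 1 w (Ioi 0) ∧ ContDiffOn ℝ 2 w (Ioi 0 \ {β}) ∧ IsHJBSolution b σ r h k c w := by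
  have H := D.green
  have hβ := hγ.trans hγβ
  have hwd : ∀ x, 0 < x → HasDerivAt w (excessDeriv RΘ ψ β x + k x) x := fun x hx => by
    refine ((D.hasDerivAt_excess hβ hx).add (K.hasDerivAt_primK hx)).congr_of_eventuallyEq ?_
    filter_upwards [Ioi_mem_nhds hx] with y hy using hw y hy
  have hw1 : ContDiffOn ℝ 1 w (Ioi 0) := contDiffOn_one_of_hasDerivAt isOpen_Ioi hwd
    ((D.cont_excessDeriv hβ).add K.cont)
  have hdw : ∀ x, 0 < x → deriv w x = excessDeriv RΘ ψ β x + k x := fun x hx => (hwd x hx).deriv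
  refine ⟨hw1, ?_, hw1, ?_, ?_⟩
  · intro x hx
    have hx0 : 0 < x := hx.1
    have hK := (K.contDiffOn_primK H).contDiffAt (Ioi_mem_nhds hx0)
    refine ContDiffAt.contDiffWithinAt ?_
    rcases lt_or_gt_of_ne hx.2 with hlt | hgt
    · have h1 := ((D.contDiffOn_R.contDiffAt (Ioi_mem_nhds hx0)).sub
        ((contDiffAt_const (c := ratio RΘ ψ β)).mul
          (H.fund.ψ_smooth.contDiffAt (Ioi_mem_nhds hx0)))).add hK
      refine h1.congr_of_eventuallyEq ?_
      filter_upwards [Ioi_mem_nhds hx0, Iio_mem_nhds hlt] with y hy hy'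
      rw [hw y hy, excess, if_pos (mem_Iio.1 hy')]
    · refine ((contDiffAt_const (c := G RΘ ψ β)).add hK).congr_of_eventuallyEq ?_
      filter_upwards [Ioi_mem_nhds hx0, Ioi_mem_nhds hgt] with y hy hy'
      rw [hw y hy, RatioData.excess_of_le (le_of_lt hy')]
  · intro u v hu huv
    obtain ⟨K₁, hK₁⟩ := D.lipschitzOn_excessDeriv hβ (v := v) hu
    obtain ⟨K₂, hK₂⟩ := ((K.contDiffOn_k H).mono
      (fun x (hx : x ∈ Icc u v) => hu.trans_le hx.1)).exists_lipschitzOnWith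
      one_ne_zero (convex_Icc _ _) isCompact_Icc
    refine LipschitzOnWith.absolutelyContinuousOnInterval (K := K₁ + K₂) ?_
    rw [uIcc_of_le huv.le]
    refine LipschitzOnWith.of_dist_le_mul fun x hx y hy => ?_
    rw [hdw x (hu.trans_le hx.1), hdw y (hu.trans_le hy.1), NNReal.coe_add, add_mul]
    exact (dist_add_add_le _ _ _ _).trans
      (add_le_add (hK₁.dist_le_mul x hx y hy) (hK₂.dist_le_mul x hx y hy))
  · have hne : ∀ᵐ x ∂(volume.restrict (Ioi (0 : ℝ))), x ≠ β :=
      ae_restrict_of_ae (Measure.ae_ne volume β)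
    filter_upwards [hne, ae_restrict_mem measurableSet_Ioi] with x hxβ hx
    have hx0 : 0 < x := hx
    have hint : ∀ z ∈ Ico 0 x, ∫ s in (x - z)..x, (k s - deriv w s) =
        excess RΘ ψ β (x - z) - excess RΘ ψ β x := by
      intro z hz
      have hxz : 0 < x - z := sub_pos.2 hz.2
      rw [← neg_sub (excess RΘ ψ β x), ← integral_eq_sub_of_hasDerivAt_Ioi
        (fun y hy => D.hasDerivAt_excess hβ hy) (D.cont_excessDeriv hβ) hxz hx0,
        ← intervalIntegral.integral_neg]
      refine intervalIntegral.integral_congr fun s hs => ?_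
      rw [uIcc_of_le (sub_le_self x hz.1)] at hs
      rw [hdw s (hxz.trans_le hs.1)]
      ring
    have hsup : (⨆ z ∈ Ico 0 x, ((∫ s in (x - z)..x, (k s - deriv w s) : ℝ) : EReal)) ≤
        (c : EReal) := by
      refine iSup₂_le fun z hz => EReal.coe_le_coe_iff.2 ?_
      rw [hint z hz]
      exact D.excess_sub_le hγ hγβ hs hF hc (sub_pos.2 hz.2) (sub_le_self x hz.1)
    have hcc : -(c : EReal) + (c : EReal) = 0 := by
      rw [← EReal.coe_neg, ← EReal.coe_add, neg_add_cancel, EReal.coe_zero]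
    have hle : -(c : EReal) +
        (⨆ z ∈ Ico 0 x, ((∫ s in (x - z)..x, (k s - deriv w s) : ℝ) : EReal)) ≤ 0 :=
      (add_le_add le_rfl hsup).trans_eq hcc
    have hLK : opL b σ r (primK k) x =
        1 / 2 * σ x ^ 2 * deriv k x + b x * k x - r x * primK k x := by
      rw [opL, K.deriv_deriv_primK hx0, (K.hasDerivAt_primK hx0).deriv]
    -- Before `β`, `𝓛 w + h = (𝓛 R_Θ + Θ) - ρ(β) 𝓛 ψ = 0`. Beyond `β`, `w` is a constant plus the
    -- primitive of `k`, so `𝓛 w + h = Θ - r G_Θ(β)`.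
    rcases lt_or_gt_of_ne hxβ with hlt | hgt
    · have hd : HasDerivAt (excessDeriv RΘ ψ β)
          (deriv (deriv RΘ) x - ratio RΘ ψ β * deriv (deriv ψ) x) x := by
        refine ((hasDerivAt_deriv_of_contDiffOn D.contDiffOn_R hx0).sub
          ((hasDerivAt_deriv_of_contDiffOn H.fund.ψ_smooth hx0).const_mul _)).congr_of_eventuallyEq ?_
        filter_upwards [Iio_mem_nhds hlt] with y hy
        rw [excessDeriv, min_eq_left (le_of_lt hy)]
        rfl
      have hz : opL b σ r w x + h x = 0 := by
        have e1 := D.opL_R hx0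
        have e2 := H.fund.ψ_ode x hx0
        rw [Theta, hLK] at e1
        rw [opL_of_hasDerivAt hx0 hwd (hd.add (K.hasDerivAt H hx0)), hw x hx0, excess, if_pos hlt,
          excessDeriv, min_eq_left hlt.le]
        rw [opL] at e1 e2
        linear_combination e1 - ratio RΘ ψ β * e2
      rw [hz, EReal.coe_zero]
      exact max_eq_left hle
    · have hd : HasDerivAt (excessDeriv RΘ ψ β) 0 x := by
        refine (hasDerivAt_const x (0 : ℝ)).congr_of_eventuallyEq ?_
        filter_upwards [Ioi_mem_nhds hgt] with y hy
        exact D.excessDeriv_eq_zero hβ (le_of_lt hy)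
      have hz : opL b σ r w x + h x ≤ 0 := by
        have e1 := D.div_lt_G hβ hdβ
        have e2 := D.decr.antitoneOn hξβ.le (hξβ.le.trans hgt.le) hgt.le
        have e3 := (div_lt_iff₀ (H.r_pos hx0)).1 (e2.trans_lt e1)
        rw [Theta, hLK] at e3
        rw [opL_of_hasDerivAt hx0 hwd (hd.add (K.hasDerivAt H hx0)), hw x hx0,
          RatioData.excess_of_le hgt.le, D.excessDeriv_eq_zero hβ hgt.le]
        linarith
      have hge : (c : EReal) ≤
          ⨆ z ∈ Ico 0 x, ((∫ s in (x - z)..x, (k s - deriv w s) : ℝ) : EReal) := by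
        -- Harvesting down to `γ` attains the supremum.
        have hzm : x - γ ∈ Ico 0 x := ⟨sub_nonneg.2 (hγβ.trans hgt).le, sub_lt_self x hγ⟩
        refine le_trans (EReal.coe_le_coe_iff.2 ?_) (le_iSup₂ (f := fun z (_ : z ∈ Ico 0 x) =>
          ((∫ s in (x - z)..x, (k s - deriv w s) : ℝ) : EReal)) (x - γ) hzm)
        rw [hint _ hzm, sub_sub_cancel, RatioData.excess_left hγβ hs hF,
          RatioData.excess_of_le hgt.le]
        linarith
      rw [le_antisymm hsup hge, hcc]
      exact max_eq_right (EReal.coe_nonpos.2 hz)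

end Candidate

variable {b σ r φ ψ h k Rh RΘ : ℝ → ℝ} {Kinf ξ γ β c : ℝ}

lemma candidate_eq_excess (K : ProfitData b σ r k)
    (hRh : ∀ x, 0 < x → Rh x = RΘ x - (Kinf * ψ x - primK k x))
    (hγ : 0 < γ) (hγβ : γ < β) (hs : SignPattern RΘ ψ γ β) (hF : F RΘ ψ γ β = -c) {x : ℝ}
    (hx : 0 < x) :
    candidate Rh RΘ ψ k Kinf c γ β x = excess RΘ ψ β x + primK k x := by
  have hl := RatioData.excess_left hγβ hs hF
  rw [excess, if_pos hγβ] at hl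
  rw [candidate]
  split_ifs with hxβ
  · rw [excess, if_pos hxβ, hRh x hx]
    ring
  · rw [RatioData.excess_of_le (not_lt.1 hxβ), hRh γ hγ, K.integral_eq hγ hx]
    linarith

/-- Before `β` the increasing `ψ` is bounded by `ψ(β)`, so the sign of its coefficient is
irrelevant; beyond `β` the primitive of `k` is bounded below. -/
lemma exists_le_candidate (H : GreenData b σ r φ ψ) (K : ProfitData b σ r k) {M N : ℝ}
    (hRh : ∀ x, 0 < x → N ≤ Rh x) (hK : ∀ x, 0 < x → M ≤ primK k x) (hγ : 0 < γ) (hβ : 0 < β) :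
    ∃ C, ∀ x, 0 < x → C ≤ candidate Rh RΘ ψ k Kinf c γ β x := by
  set a := Kinf - ratio RΘ ψ β with ha
  refine ⟨min (N - |a| * ψ β) (Rh γ + a * ψ γ + (M - primK k γ) - c), fun x hx => ?_⟩
  rw [candidate]
  split_ifs with hxβ
  · have h1 : ψ x ≤ ψ β := H.mono_ψ.monotoneOn hx hβ hxβ.le
    have h2 : -(|a| * ψ β) ≤ a * ψ x := by
      rw [neg_le]
      calc -(a * ψ x) = -a * ψ x := by ring
        _ ≤ |a| * ψ x := mul_le_mul_of_nonneg_right (neg_le_abs a) (H.fund.ψ_pos x hx).le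
        _ ≤ |a| * ψ β := mul_le_mul_of_nonneg_left h1 (abs_nonneg a)
    exact (min_le_left _ _).trans (by linarith [hRh x hx])
  · rw [K.integral_eq hγ hx]
    exact (min_le_right _ _).trans (by linarith [hK x hx])

end Harvest

/-! ### Conclusion for the diffusion. -/

theorem mainTheorem5 {Ω : Type*} [mΩ : MeasurableSpace Ω] (P : Measure Ω) [IsProbabilityMeasure P]
    (ℱ : Filtration ℝ≥0 mΩ) (X : ℝ → ℝ≥0 → Ω → ℝ) (b σ r h k φ ψ : ℝ → ℝ) (ξ c : ℝ)
    (hcoef : Harvest.CoefficientAssumption b σ)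
    (hzero : Harvest.ZeroInaccessible b σ) (hinfty : Harvest.InftyNatural b σ)
    (hX : ∀ x, 0 < x → Harvest.IsDiffusionFrom b σ P ℱ (X x) x)
    (hr : Harvest.DiscountAssumption r)
    (hfund : Harvest.FundamentalSolutions b σ r φ ψ)
    (hpay : Harvest.PayoffAssumption P X b σ r h k ψ ξ)
    (hlow : Harvest.xLow ξ (Harvest.R P X r (Harvest.Theta b σ r h k)) ψ < ⊤)
    (hc_pos : 0 < c)
    (hc_lt : (c : EReal) < Harvest.cStar ξ (Harvest.R P X r (Harvest.Theta b σ r h k)) ψ) :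
    ∃ Kinf γ β : ℝ,
      0 ≤ Kinf ∧
      Tendsto (fun x => Harvest.primK k x / ψ x) atTop (𝓝 Kinf) ∧
      Harvest.IsFreeBoundary ξ (Harvest.R P X r (Harvest.Theta b σ r h k)) ψ c γ β ∧
      (∀ γ' β' : ℝ, 0 < γ' → γ' < β' →
        Harvest.ratio (Harvest.R P X r (Harvest.Theta b σ r h k)) ψ γ' =
          Harvest.ratio (Harvest.R P X r (Harvest.Theta b σ r h k)) ψ β' →
        Harvest.F (Harvest.R P X r (Harvest.Theta b σ r h k)) ψ γ' β' = -c →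
        γ' = γ ∧ β' = β) ∧
      ∀ w : ℝ → ℝ,
        w = Harvest.candidate (Harvest.R P X r h)
          (Harvest.R P X r (Harvest.Theta b σ r h k)) ψ k Kinf c γ β →
        ContDiffOn ℝ 1 w (Ioi 0) ∧
        ContDiffOn ℝ 2 w (Ioi 0 \ {β}) ∧
        (∃ M, ∀ x, 0 < x → M ≤ w x) ∧
        Harvest.IsHJBSolution b σ r h k c w := by
  open Harvest in
  have H := greenData_of b σ r φ ψ hcoef hr hfund
  have hLK : ContinuousOn (opL b σ r (primK k)) (Ioi 0) :=
    (hpay.Θ_cont.sub hpay.h_cont).congr fun x _ => (add_sub_cancel_left (h x) _).symm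
  have K : ProfitData b σ r k := ⟨hpay.k_ac, hpay.k_int, hLK⟩
  have ih := greenIntegrable_of_discountedIntegrable hX hcoef hr hfund hpay.h_cont hpay.h_int
  have iL := greenIntegrable_of_discountedIntegrable hX hcoef hr hfund hLK hpay.Lk_int
  have iΘ : GreenIntegrable σ φ ψ (Theta b σ r h k) := GreenData.greenIntegrable_add ih iL
  have hone := (greenSol_r hX hcoef hr hfund).2
  have hΘr : ContinuousOn (fun x => Theta b σ r h k x / r x) (Ioi 0) :=
    hpay.Θ_cont.div H.r_cont fun x hx => (H.r_pos hx).ne'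
  have D : RatioData b σ r φ ψ (Theta b σ r h k) (R P X r (Theta b σ r h k)) ξ :=
    { green := H
      Θ_cont := hpay.Θ_cont
      Θ_int := iΘ
      r_one := hone
      R_eq := fun x hx => R_eq_greenSol hX hcoef hr hfund iΘ hx
      ξ_pos := hpay.ξ_pos
      incr := strictMonoOn_Ioc_of_Ioo hΘr hpay.Θ_incr
      decr := strictAntiOn_Ici_of_Ioi hpay.ξ_pos hΘr hpay.Θ_decr }
  obtain ⟨x₀, hξ, T⟩ := D.exists_turningData hlow
  obtain ⟨MK, hMK⟩ := hpay.k_lower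
  obtain ⟨Mh, hMh⟩ := hpay.h_lower
  obtain ⟨Kinf, hK0, hKlim, hKeq⟩ := K.exists_limit H iL hMK
  obtain ⟨γ, β, B⟩ := T.exists_freeBoundary hc_pos hc_lt
  have hγx : γ < x₀ := EReal.coe_lt_coe_iff.1 (T.low ▸ B.γ_lt)
  have hxβ : x₀ < β := EReal.coe_lt_coe_iff.1 (T.low ▸ B.β_gt)
  have hγβ := hγx.trans hxβ
  -- Linearity splits `R_Θ` into `R_h` and the resolvent of `𝓛 (∫_0^· k)`, which is `K_∞ ψ - ∫_0^x
  -- k`.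
  have hRh : ∀ x, 0 < x → R P X r h x =
      R P X r (Theta b σ r h k) x - (Kinf * ψ x - primK k x) := fun x hx => by
    have e : greenSol σ φ ψ (Theta b σ r h k) x = _ := GreenData.greenSol_add ih iL hx
    rw [R_eq_greenSol hX hcoef hr hfund ih hx, D.R_eq x hx, e, ← hKeq x hx]
    ring
  refine ⟨Kinf, γ, β, hK0, hKlim, B, fun γ' β' h1 h2 h3 h4 => ?_, ?_⟩
  · exact T.pair_unique h1 h2 h3 B.γ_pos hγβ (sub_eq_zero.1 B.sign.2.1) (h4.trans B.F_eq.symm)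
  · rintro w rfl
    obtain ⟨v1, v2, v3⟩ := verification D K B.γ_pos hγβ B.sign B.F_eq hc_pos.le (hξ.trans hxβ)
      (T.pos β hxβ) fun x hx => candidate_eq_excess K hRh B.γ_pos hγβ B.sign B.F_eq hx
    refine ⟨v1, v2, ?_, v3⟩
    obtain ⟨r₀, hr₀, hr0⟩ := H.r_lower
    -- As `r ≥ r₀`, the lower bound of `h` gives `h ≥ -(|Mh| / r₀) r`, and `R_r = 1` turns this into
    -- a bound for `R_h`.
    refine exists_le_candidate (N := -(|Mh| / r₀)) H K (fun x hx => ?_) hMK B.γ_pos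
      (B.γ_pos.trans hγβ)
    rw [R_eq_greenSol hX hcoef hr hfund ih hx]
    refine H.le_greenSol hone ih (fun y hy => ?_) hx
    have h1 : |Mh| ≤ |Mh| / r₀ * r y := by
      rw [div_mul_eq_mul_div, le_div_iff₀ hr₀]
      exact mul_le_mul_of_nonneg_left (hr0 y hy) (abs_nonneg _)
    linarith [hMh y hy, neg_abs_le Mh]
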